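/- **Notation.** Let $n\ge 1$. For $P\in\mathbb N_0$ let $\mathcal S_P$ be the space of Schwartz functions $f:\mathbb R^n\to\mathbb C$ with $\int x^\alpha f(x)\,dx=0$ for all $|\alpha|\le P$, and let $\mathcal D_P=\mathcal S_P\cap C_0^\infty$. All pairings are bilinear. For $\psi\in\mathcal D_P$ and $k\in\mathbb Z$ put $\psi_k(x)=2^{kn}\psi(2^kx)$, and for $N>0$ put $\Phi_k^N(x)=2^{kn}(1+2^k|x|)^{-N}$. A linear operator $T:\mathcal S_P\to\mathcal S'$ is *continuous* if there is $\mathcal K\in\mathcal S'(\mathbb R^{2n})$ with $\langle Tf,g\rangle=\langle\mathcal K,g\otimes f\rangle$ for all $f\in\mathcal S_P$, $g\in\mathcal S$. Let $\nu\in\mathbb R$, $M\in\mathbb N_0$, $0<\gamma\le1$. One writes $T\in SIO_\nu(M+\gamma)$ if, for some $P\in\mathbb N_0$, $T$ is continuous from $\mathcal S_P$ into $\mathcal S'$, it has a transpose $T^*$ which is continuous from $\mathcal S_P$ into $\mathcal S'$ with $\langle Tf,g\rangle=\langle T^*g,f\rangle$ for $f,g\in\mathcal S_P$, and there is a kernel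 function $K$, of class $C^M$ off the diagonal, such that $$\langle Tf,g\rangle=\int_{\mathbb R^{2n}}K(x,y)f(y)g(x)\,dy\,dx$$ whenever $f,g$ have disjoint supports and $(f,g)\in\mathcal D_P\times C_0^\infty$ or $(f,g)\in C_0^\infty\times\mathcal D_P$ (in the second case $\langle Tf,g\rangle$ means $\langle T^*g,f\rangle$), with $$|D_x^\alpha D_y^\beta K(x,y)|\lesssim|x-y|^{-(n+\nu+|\alpha|+|\beta|)}\qquad(x\ne y,\ |\alpha|+|\beta|\le M),$$ $$|D_x^\alpha D_y^\beta K(x+h,y)-D_x^\alpha D_y^\beta K(x,y)|+|D_x^\alpha D_y^\beta K(x,y)-D_x^\alpha D_y^\beta K(x,y+h)|\lesssim\frac{|h|^\gamma}{|x-y|^{n+\nu+M+\gamma}}\qquad(|h|<|x-y|/2,\ |\alpha|+|\beta|=M).$$ $T$ satisfies $WBP_\nu$ if there are integers $m\ge P$, $N\ge0$ and a constant $C$ such that $|\langle T\psi,\varphi\rangle|+|\langle T^*\psi,\varphi\rangle|\le C|B|^{1-\nu/n}$ for every ball $B$ and all $\psi\in\mathcal D_m$, $\varphi\in C_0^\infty$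 supported in $B$ with $\|D^\alpha\psi\|_{L^\infty},\|D^\alpha\varphi\|_{L^\infty}\le|B|^{-|\alpha|/n}$ for $|\alpha|\le N$. For $|\alpha|<M+\nu+\gamma$, $T^*(x^\alpha)=0$ means that for some integer $Q\ge\max(P,M+|\nu|)$ one has $\lim_{R\to\infty}\langle T^*(x^\alpha\,\eta(x/R)),\psi\rangle=0$ for all $\psi\in\mathcal D_Q$, where $\eta\in\mathcal D_{2Q}$ equals $1$ on $B(0,1)$ (the limit does not depend on the choice of $\eta$). **Theorem 3.1.** Let $\nu\in\mathbb R$, let $M,L\ge0$ be integers with $\nu\le L\le M+\nu$, let $0<\gamma\le1$, and let $T\in SIO_\nu(M+\gamma)$ satisfy $WBP_\nu$ and $T^*(x^\alpha)=0$ for all $|\alpha|\le L$. Then for all sufficiently large $P$ and every $\psi\in\mathcal D_P$ there are functions $\theta_k:\mathbb R^n\times\mathbb R^n\to\mathbb C$, $k\in\mathbb Z$, such that $$\psi_k*Tf(x)=\int_{\mathbb R^n}\theta_k(x,y)f(y)\,dy\qquad(f\in\mathcal S_P,\ x\in\mathbb R^n,\ k\in\mathbb Z),$$ where $\psi_k*Tf(x)=\langle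 Tf,\psi_k(x-\cdot)\rangle$, the function $\theta_k(x,\cdot)$ is of class $C^{\lfloor L-\nu\rfloor}$, and $$|D_y^\alpha\theta_k(x,y)|\lesssim2^{(\nu+|\alpha|)k}\,\Phi_k^{n+\nu+M+\gamma}(x-y)\qquad\text{for }|\alpha|\le\lfloor L-\nu\rfloor,$$ $$|D_y^\alpha\theta_k(x,y+h)-D_y^\alpha\theta_k(x,y)|\lesssim2^{(\nu+|\alpha|)k}(2^k|h|)^{\gamma'}\,\Phi_k^{n+\nu+M+\gamma}(x-y)\qquad\text{for }|\alpha|=\lfloor L-\nu\rfloor$$ for all $k\in\mathbb Z$, all $x,y,h\in\mathbb R^n$ with $|h|<(2^{-k}+|x-y|)/2$, and every $0<\gamma'<\gamma$. The implicit constants do not depend on $k,x,y,h$ (the second may depend on $\gamma'$). -/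

import Mathlib

open MeasureTheory Set Filter Topology SchwartzMap
open scoped SchwartzMap ContDiff

/-- Euclidean space `ℝⁿ`. -/
abbrev Rn (n : ℕ) : Type := EuclideanSpace ℝ (Fin n)

/-! ### Multi-indices, monomials, partial derivatives -/

/-- The order `|α| = α₁ + ⋯ + αₙ` of a multi-index. -/
def multiOrder {n : ℕ} (α : Fin n → ℕ) : ℕ := ∑ i, α i

/-- The monomial `x ^ α = x₁ ^ α₁ ⋯ xₙ ^ αₙ`. -/
def monom {n : ℕ} (α : Fin n → ℕ) (x : Rn n) : ℝ := ∏ i, x i ^ α i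

/-- The list of coordinate directions `1, …, 1, 2, …, 2, …` in which `i` occurs `α i` times. -/
def directions {n : ℕ} (α : Fin n → ℕ) : List (Fin n) :=
  (List.finRange n).flatMap fun i => List.replicate (α i) i

/-- The partial derivative `D ^ α f (x)`, i.e. the Fréchet derivative of order `|α|` evaluated on
the coordinate vectors, the `i`-th one being repeated `α i` times. It is only used for functions
that are of class `C ^ |α|` near the point `x`. -/
noncomputable def pderiv {n : ℕ} (α : Fin n → ℕ) (f : Rn n → ℂ) (x : Rn n) : ℂ :=
  iteratedFDeriv ℝ (directions α).length f x
    fun j => EuclideanSpace.single ((directions α).get j) (1 : ℝ)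

lemma length_directions {n : ℕ} (α : Fin n → ℕ) : (directions α).length = multiOrder α := by
  simp [directions, multiOrder, List.length_flatMap, Fin.sum_univ_def]

lemma contDiff_monom {n : ℕ} (α : Fin n → ℕ) : ContDiff ℝ ∞ (monom α) := by
  unfold monom
  fun_prop

lemma abs_monom_le {n : ℕ} (α : Fin n → ℕ) (x : Rn n) : |monom α x| ≤ ‖x‖ ^ multiOrder α := by
  unfold monom multiOrder
  rw [Finset.abs_prod, ← Finset.prod_pow_eq_pow_sum]
  refine Finset.prod_le_prod (fun i _ => abs_nonneg _) fun i _ => ?_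
  rw [abs_pow]
  exact pow_le_pow_left₀ (abs_nonneg _) (by simpa using PiLp.norm_apply_le x i) _

lemma monom_smul {n : ℕ} (α : Fin n → ℕ) (c : ℝ) (x : Rn n) :
    monom α (c • x) = c ^ multiOrder α * monom α x := by
  simp [monom, multiOrder, mul_pow, Finset.prod_mul_distrib, Finset.prod_pow_eq_pow_sum]

lemma monom_add {n : ℕ} (α β : Fin n → ℕ) (x : Rn n) :
    monom (α + β) x = monom α x * monom β x := by
  simp [monom, pow_add, Finset.prod_mul_distrib]

lemma multiOrder_add {n : ℕ} (α β : Fin n → ℕ) :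
    multiOrder (α + β) = multiOrder α + multiOrder β := by
  simp [multiOrder, Finset.sum_add_distrib]

lemma integrable_monom_mul {n : ℕ} (α : Fin n → ℕ) (f : 𝓢(Rn n, ℂ)) :
    Integrable fun x => (monom α x : ℂ) * f x := by
  refine (f.integrable_pow_mul volume (multiOrder α)).mono' ?_ (Eventually.of_forall fun x => ?_)
  · exact ((Complex.continuous_ofReal.comp (contDiff_monom α).continuous).mul
      f.continuous).aestronglyMeasurable
  · rw [norm_mul, Complex.norm_real, Real.norm_eq_abs]
    exact mul_le_mul_of_nonneg_right (abs_monom_le α x) (norm_nonneg _)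

/-! ### Schwartz functions and test functions with vanishing moments -/

/-- `𝒮_P`: the Schwartz functions all of whose moments of order at most `P` vanish. -/
noncomputable def momentSchwartz (n P : ℕ) : Submodule ℂ 𝓢(Rn n, ℂ) where
  carrier := {f | ∀ α : Fin n → ℕ, multiOrder α ≤ P → ∫ x, (monom α x : ℂ) * f x = 0}
  zero_mem' := by
    intro α _
    simp
  add_mem' := by
    intro f g hf hg α hα
    have h := integral_add (integrable_monom_mul α f) (integrable_monom_mul α g)
    rw [hf α hα, hg α hα, add_zero] at h
    rw [← h]
    simp [mul_add]
  smul_mem' := by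
    intro c f hf α hα
    have h := integral_const_mul (μ := (volume : Measure (Rn n))) c fun x => (monom α x : ℂ) * f x
    rw [hf α hα, mul_zero] at h
    rw [← h]
    simp [mul_left_comm]

/-- `𝒟 = C_0^∞`: the smooth compactly supported functions, realized inside the Schwartz class. -/
def testFunctions (n : ℕ) : Set 𝓢(Rn n, ℂ) := {f | HasCompactSupport f}

/-- `𝒟_P`: the test functions all of whose moments of order at most `P` vanish. -/
def momentTest (n P : ℕ) : Set 𝓢(Rn n, ℂ) := {f | f ∈ momentSchwartz n P ∧ f ∈ testFunctions n}

lemma momentSchwartz_anti {n P Q : ℕ} (h : P ≤ Q) : momentSchwartz n Q ≤ momentSchwartz n P :=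
  fun _ hf α hα => hf α (hα.trans h)

/-- A test function in `𝒟_P` as an element of `𝒮_P₀`, for `P₀ ≤ P`. -/
def momentTest.toSchwartz {n P₀ P : ℕ} (h : P₀ ≤ P) {f : 𝓢(Rn n, ℂ)} (hf : f ∈ momentTest n P) :
    momentSchwartz n P₀ :=
  ⟨f, momentSchwartz_anti h hf.1⟩

/-- `ψ_k^x (u) = ψ_k (x - u)`, where `ψ_k (z) = 2 ^ (k n) ψ (2 ^ k z)`. -/
noncomputable def dilateReflect {n : ℕ} (ψ : 𝓢(Rn n, ℂ)) (k : ℤ) (x : Rn n) : 𝓢(Rn n, ℂ) :=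
  ((2 : ℂ) ^ (k * n)) •
    compSubConstCLM ℂ x
      (compCLMOfContinuousLinearEquiv ℂ
        (ContinuousLinearEquiv.smulLeft (Units.mk0 (-(2 : ℝ) ^ k)
          (neg_ne_zero.2 (zpow_ne_zero k two_ne_zero)))) ψ)

lemma dilateReflect_apply {n : ℕ} (ψ : 𝓢(Rn n, ℂ)) (k : ℤ) (x u : Rn n) :
    dilateReflect ψ k x u = (2 : ℂ) ^ (k * n) * ψ ((2 : ℝ) ^ k • (x - u)) := by
  have h : (-(2 : ℝ) ^ k) • (u - x) = (2 : ℝ) ^ k • (x - u) := by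
    rw [neg_smul, ← smul_neg, neg_sub]
  rw [← h]
  rfl

/-- The function `x ↦ x ^ α η_R (x)`, where `η_R (x) = η (x / R)`, for a test function `η`. -/
noncomputable def cutoffMonom {n : ℕ} (α : Fin n → ℕ) {η : 𝓢(Rn n, ℂ)} (hη : η ∈ testFunctions n)
    (R : {R : ℝ // 0 < R}) : 𝓢(Rn n, ℂ) :=
  HasCompactSupport.toSchwartzMap (f := fun x : Rn n => (monom α x : ℂ) * η ((R : ℝ)⁻¹ • x))
    ((HasCompactSupport.comp_smul hη (inv_ne_zero R.2.ne')).mul_left)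
    ((Complex.ofRealCLM.contDiff.comp (contDiff_monom α)).mul
      ((η.smooth ⊤).comp (contDiff_const_smul _)))

lemma cutoffMonom_apply {n : ℕ} (α : Fin n → ℕ) {η : 𝓢(Rn n, ℂ)} (hη : η ∈ testFunctions n)
    (R : {R : ℝ // 0 < R}) (x : Rn n) :
    cutoffMonom α hη R x = (monom α x : ℂ) * η ((R : ℝ)⁻¹ • x) := rfl

lemma cutoffMonom_mem {n Q : ℕ} {α : Fin n → ℕ} (hα : multiOrder α ≤ Q) {η : 𝓢(Rn n, ℂ)}
    (hη : η ∈ momentTest n (2 * Q)) (R : {R : ℝ // 0 < R}) :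
    cutoffMonom α hη.2 R ∈ momentSchwartz n Q := by
  intro β hβ
  have h0 := hη.1 (β + α) (by rw [multiOrder_add]; omega)
  have h1 := Measure.integral_comp_inv_smul (volume : Measure (Rn n))
    (fun x => (monom (β + α) x : ℂ) * η x) (R : ℝ)
  rw [h0, smul_zero] at h1
  have h2 : ∀ x : Rn n, (monom β x : ℂ) * cutoffMonom α hη.2 R x
      = ((R : ℝ) : ℂ) ^ multiOrder (β + α)
        * ((monom (β + α) ((R : ℝ)⁻¹ • x) : ℂ) * η ((R : ℝ)⁻¹ • x)) := by
    intro x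
    have hR : ((R : ℝ) : ℂ) ≠ 0 := by exact_mod_cast R.2.ne'
    have hRp : ((R : ℝ) : ℂ) ^ multiOrder (β + α) ≠ 0 := pow_ne_zero _ hR
    rw [cutoffMonom_apply, monom_smul, monom_add]
    push_cast
    rw [inv_pow, ← mul_assoc, ← mul_assoc, ← mul_assoc, ← mul_assoc, mul_inv_cancel₀ hRp, one_mul]
  simp_rw [h2]
  rw [integral_const_mul, h1, mul_zero]

/-- The tensor product `(g ⊗ f) (x, y) = g (x) f (y)` of two Schwartz functions. -/
noncomputable def schwartzTensor {n : ℕ} (g f : 𝓢(Rn n, ℂ)) : 𝓢(Rn n × Rn n, ℂ) where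
  toFun p := g p.1 * f p.2
  smooth' := ((g.smooth ⊤).comp contDiff_fst).mul ((f.smooth ⊤).comp contDiff_snd)
  decay' := by
    intro k m
    have key : ∀ (h : 𝓢(Rn n, ℂ)) (L : Rn n × Rn n →L[ℝ] Rn n), ‖L‖ ≤ 1 → ∀ (i : ℕ)
        (p : Rn n × Rn n),
        ‖iteratedFDeriv ℝ i (fun q => h (L q)) p‖ ≤ ‖iteratedFDeriv ℝ i h (L p)‖ := by
      intro h L hL i p
      have e := L.iteratedFDeriv_comp_right (f := h) (h.smooth ⊤) p (i := i) (by exact_mod_cast le_top)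
      have e' : iteratedFDeriv ℝ i (fun q => h (L q)) p = _ := e
      rw [e']
      refine (ContinuousMultilinearMap.norm_compContinuousLinearMap_le _ _).trans ?_
      refine mul_le_of_le_one_right (norm_nonneg _) ?_
      simpa using pow_le_one₀ (norm_nonneg _) hL
    have hdec : ∀ (h : 𝓢(Rn n, ℂ)) (j i : ℕ), ∃ C, 0 ≤ C ∧ ∀ x,
        ‖x‖ ^ j * ‖iteratedFDeriv ℝ i h x‖ ≤ C := by
      intro h j i
      obtain ⟨C, hC⟩ := h.decay j i
      exact ⟨C, hC.1.le, hC.2⟩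
    choose C hC0 hC using hdec
    refine ⟨∑ i ∈ Finset.range (m + 1), (m.choose i : ℝ) *
      (C g k i * C f 0 (m - i) + C g 0 i * C f k (m - i)), fun p => ?_⟩
    have hprod := norm_iteratedFDeriv_mul_le (𝕜 := ℝ) (N := ∞) (f := fun q : Rn n × Rn n => g q.1)
      (g := fun q : Rn n × Rn n => f q.2) ((g.smooth ⊤).comp contDiff_fst)
      ((f.smooth ⊤).comp contDiff_snd) p (n := m) (by exact_mod_cast le_top)
    refine (mul_le_mul_of_nonneg_left hprod (by positivity)).trans ?_
    rw [Finset.mul_sum]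
    refine Finset.sum_le_sum fun i _ => ?_
    have h1 := key g (ContinuousLinearMap.fst ℝ _ _) (ContinuousLinearMap.norm_fst_le ..) i p
    have h2 := key f (ContinuousLinearMap.snd ℝ _ _) (ContinuousLinearMap.norm_snd_le ..) (m - i) p
    simp only [ContinuousLinearMap.coe_fst', ContinuousLinearMap.coe_snd'] at h1 h2
    have a1 := hC g k i p.1
    have a2 := hC g 0 i p.1
    have b1 := hC f k (m - i) p.2
    have b2 := hC f 0 (m - i) p.2
    rw [pow_zero, one_mul] at a2 b2
    set A := ‖iteratedFDeriv ℝ i g p.1‖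
    set B := ‖iteratedFDeriv ℝ (m - i) f p.2‖
    have hA : 0 ≤ A := norm_nonneg _
    have hB : 0 ≤ B := norm_nonneg _
    have hp : ‖p‖ ^ k ≤ ‖p.1‖ ^ k + ‖p.2‖ ^ k := by
      rcases le_total ‖p.1‖ ‖p.2‖ with h | h
      · rw [Prod.norm_def, max_eq_right h]
        exact le_add_of_nonneg_left (by positivity)
      · rw [Prod.norm_def, max_eq_left h]
        exact le_add_of_nonneg_right (by positivity)
    calc ‖p‖ ^ k * ((m.choose i : ℝ) * ‖iteratedFDeriv ℝ i (fun q : Rn n × Rn n => g q.1) p‖ *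
          ‖iteratedFDeriv ℝ (m - i) (fun q : Rn n × Rn n => f q.2) p‖)
        ≤ (‖p.1‖ ^ k + ‖p.2‖ ^ k) * ((m.choose i : ℝ) * A * B) := by gcongr
      _ = (m.choose i : ℝ) * ((‖p.1‖ ^ k * A) * B + A * (‖p.2‖ ^ k * B)) := by ring
      _ ≤ _ := by
        gcongr
        · exact hC0 g k i
        · exact hC0 g 0 i

/-! ### Singular integral operators -/

/-- Continuity of a linear operator from `𝒮_P` into `𝒮'`: there is a distribution kernel
`𝒦 ∈ 𝒮'(ℝⁿ × ℝⁿ)` with `⟨T f, g⟩ = ⟨𝒦, g ⊗ f⟩`. -/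
def HasDistributionKernel {n P : ℕ} (T : momentSchwartz n P →ₗ[ℂ] 𝓢'(Rn n, ℂ)) : Prop :=
  ∃ 𝒦 : 𝓢'(Rn n × Rn n, ℂ), ∀ (f : momentSchwartz n P) (g : 𝓢(Rn n, ℂ)),
    T f g = 𝒦 (schwartzTensor g f)

/-- `D_x^α D_y^β K (x, y)`. -/
noncomputable def kernelDeriv {n : ℕ} (K : Rn n → Rn n → ℂ) (α β : Fin n → ℕ) (x y : Rn n) : ℂ :=
  pderiv α (fun x' => pderiv β (K x') y) x

/-- `K` is a `ν`-order standard kernel with regularity `M + γ`, off the diagonal. -/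
structure IsStandardKernel {n : ℕ} (ν : ℝ) (M : ℕ) (γ : ℝ) (K : Rn n → Rn n → ℂ) : Prop where
  contDiffOn : ContDiffOn ℝ M (fun p : Rn n × Rn n => K p.1 p.2) {p | p.1 ≠ p.2}
  size : ∃ C : ℝ, ∀ α β : Fin n → ℕ, multiOrder α + multiOrder β ≤ M → ∀ x y : Rn n, x ≠ y →
    ‖kernelDeriv K α β x y‖ ≤ C * ‖x - y‖ ^ (-(n + ν + multiOrder α + multiOrder β))
  holder : ∃ C : ℝ, ∀ α β : Fin n → ℕ, multiOrder α + multiOrder β = M → ∀ x y h : Rn n,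
    ‖h‖ < ‖x - y‖ / 2 →
    ‖kernelDeriv K α β (x + h) y - kernelDeriv K α β x y‖
        + ‖kernelDeriv K α β x y - kernelDeriv K α β x (y + h)‖
      ≤ C * ‖h‖ ^ γ * ‖x - y‖ ^ (-(n + ν + M + γ))

/-- `T ∈ SIO_ν (M + γ)`, where `T : 𝒮_P → 𝒮'` is given together with its transpose
`T* : 𝒮_P → 𝒮'`. All pairings are bilinear. For `f ∈ C_0^∞` and `g ∈ 𝒟_P`, the pairing
`⟨T f, g⟩` is `⟨T* g, f⟩`. -/
structure IsSIO {n P : ℕ} (ν : ℝ) (M : ℕ) (γ : ℝ)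
    (T Tstar : momentSchwartz n P →ₗ[ℂ] 𝓢'(Rn n, ℂ)) : Prop where
  continuous : HasDistributionKernel T
  continuous_transpose : HasDistributionKernel Tstar
  transpose : ∀ f g : momentSchwartz n P, T f (g : 𝓢(Rn n, ℂ)) = Tstar g (f : 𝓢(Rn n, ℂ))
  kernel : ∃ K : Rn n → Rn n → ℂ, IsStandardKernel ν M γ K ∧
    (∀ (f : 𝓢(Rn n, ℂ)) (hf : f ∈ momentTest n P), ∀ g ∈ testFunctions n,
      Disjoint (tsupport f) (tsupport g) →
        T (momentTest.toSchwartz le_rfl hf) g = ∫ x, ∫ y, K x y * f y * g x) ∧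
    (∀ f ∈ testFunctions n, ∀ (g : 𝓢(Rn n, ℂ)) (hg : g ∈ momentTest n P),
      Disjoint (tsupport f) (tsupport g) →
        Tstar (momentTest.toSchwartz le_rfl hg) f = ∫ x, ∫ y, K x y * f y * g x)

/-- The `ν`-order weak boundedness property `WBP_ν` of `T` (with transpose `T*`). -/
def SatisfiesWBP {n P : ℕ} (ν : ℝ) (T Tstar : momentSchwartz n P →ₗ[ℂ] 𝓢'(Rn n, ℂ)) : Prop :=
  ∃ (m N : ℕ) (hm : P ≤ m) (C : ℝ), ∀ (c : Rn n) (r : ℝ), 0 < r →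
    ∀ (ψ : 𝓢(Rn n, ℂ)) (hψ : ψ ∈ momentTest n m), ∀ φ ∈ testFunctions n,
      tsupport ψ ⊆ Metric.ball c r → tsupport φ ⊆ Metric.ball c r →
      (∀ α : Fin n → ℕ, multiOrder α ≤ N → ∀ x,
        ‖pderiv α ψ x‖ ≤ volume.real (Metric.ball c r) ^ (-(multiOrder α : ℝ) / n) ∧
        ‖pderiv α φ x‖ ≤ volume.real (Metric.ball c r) ^ (-(multiOrder α : ℝ) / n)) →
      ‖T (momentTest.toSchwartz hm hψ) φ‖ + ‖Tstar (momentTest.toSchwartz hm hψ) φ‖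
        ≤ C * volume.real (Metric.ball c r) ^ (1 - ν / n)

/-- `S (x ^ α) = 0` for an operator `S : 𝒮_P → 𝒮'` of the class `SIO_ν (M + γ)`, where
`|α| < M + ν + γ`: for some large `Q`, one has `lim_{R → ∞} ⟨S (x ^ α η_R), ψ⟩ = 0` for all
`ψ ∈ 𝒟_Q`, where `η ∈ 𝒟_{2Q}` equals `1` on the unit ball. (The limit does not depend on `η`.) -/
def VanishesOnMonom {n P : ℕ} (ν : ℝ) (M : ℕ) (S : momentSchwartz n P →ₗ[ℂ] 𝓢'(Rn n, ℂ))
    (α : Fin n → ℕ) : Prop :=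
  ∃ (Q : ℕ) (hPQ : P ≤ Q) (hα : multiOrder α ≤ Q), (M : ℝ) + |ν| ≤ Q ∧
    ∀ (η : 𝓢(Rn n, ℂ)) (hη : η ∈ momentTest n (2 * Q)), (∀ x ∈ Metric.ball (0 : Rn n) 1, η x = 1) →
      ∀ ψ ∈ momentTest n Q,
        Tendsto (fun R : {R : ℝ // 0 < R} =>
          S ⟨cutoffMonom α hη.2 R, momentSchwartz_anti hPQ (cutoffMonom_mem hα hη R)⟩ ψ)
          atTop (𝓝 0)

/-- `(ψ_k * u) (x) = ⟨u, ψ_k (x - ·)⟩` for a tempered distribution `u`. -/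
noncomputable def convDilate {n : ℕ} (ψ : 𝓢(Rn n, ℂ)) (k : ℤ) (u : 𝓢'(Rn n, ℂ)) (x : Rn n) : ℂ :=
  u (dilateReflect ψ k x)

/-- `Φ_k^N (x) = 2 ^ (k n) (1 + 2 ^ k |x|) ^ (-N)`. -/
noncomputable def bumpDecay {n : ℕ} (N : ℝ) (k : ℤ) (x : Rn n) : ℝ :=
  (2 : ℝ) ^ (k * n) * (1 + (2 : ℝ) ^ k * ‖x‖) ^ (-N)

/-!
Write `atom ψ t x` for the function `z ↦ t ^ (-n) ψ ((x - z) / t)`; for `t = 2 ^ (-k)` it is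
`ψ_k (x - ·)`, so `ψ_k * T f (x) = ⟨u, f⟩` with the tempered distribution `u = T* (atom ψ t x)`. The
theorem says that `u` is a function with regularity `L - ν + γ` (up to an endpoint) at the scale `t`,
decaying like the kernel. This is a Littlewood–Paley argument: let `φ` be a test function with integral
one and vanishing higher moments, and let `χ` be its dyadic difference, which has vanishing moments. Then
`θ (y) = ⟨u, atom φ t y⟩ + ∑ⱼ ⟨u, atom χ (t / 2 ^ j) y⟩` is a telescoping series which represents `u`,
since the atoms of `φ` form an approximate identity on tempered distributions
(`integral_tsum_dyadicTerm_mul`, `tendsto_integral_apply_atom_mul`).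

The analytic heart is the almost orthogonality estimate
`|⟨T* (atom ψ t x), atom χ r y⟩| ≲ (r / t) ^ (L - ν + δ) t ^ (-n - ν) (1 + |x - y| / t) ^ (-(n + ν + M + γ))`
for `r ≤ t` and `δ < γ` (`exists_norm_transpose_apply_atom_atom_le`). When the atoms are far apart, it
follows from the kernel bounds, the moments of `χ` annihilating the Taylor polynomials of the kernel
(`exists_norm_apply_atom_atom_le_of_far`). When they are close, one writes the pairing as
`⟨T (atom χ r y), atom ψ t x⟩`, subtracts from the second atom its Taylor polynomial of degree `L` at
`y`, which is allowed because `T* (x ^ α) = 0`, and splits the remainder at the distance `≈ r` from `y`: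
the inner part is controlled by weak boundedness, the outer part by the kernel
(`exists_norm_apply_atom_atom_le_of_le`). For the first term of the series only size matters, and weak
boundedness near the diagonal together with the kernel away from it suffice
(`exists_norm_apply_atom_atom_le`).

Finally, differentiating `y ↦ ⟨u, atom χ r y⟩` replaces `χ` by a derivative of `χ` and costs a factor
`1 / r` (`iteratedFDeriv_apply_atom`), so that the `j`-th term of the series obeys the same bounds
with an additional factor `2 ^ (j l)` for `l` derivatives; `IsDyadicFamily` records this. Summing up
gives the derivatives of order at most `⌊L - ν⌋`, and interpolating between the derivatives of order
`⌊L - ν⌋` and `⌊L - ν⌋ + 1` term by term gives the Hölder bound. Differentiation in `y` and the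
interchange of `u` with integrals rest on the fact that `u` factors through a Banach space of finitely
many weighted derivatives (`exists_eq_comp_jet`).
-/

/-! ### Iterated derivatives: symmetry and components -/

section IteratedDerivatives

variable {E F : Type*} [NormedAddCommGroup E] [NormedSpace ℝ E] [NormedAddCommGroup F]
  [NormedSpace ℝ F]

lemma iteratedFDeriv_list_cons {f : E → F} {x : E} (a : E) (l : List E)
    (hf : DifferentiableAt ℝ (iteratedFDeriv ℝ l.length f) x) :
    iteratedFDeriv ℝ (a :: l).length f x (a :: l).get
      = fderiv ℝ (fun y => iteratedFDeriv ℝ l.length f y l.get) x a := by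
  have h1 : iteratedFDeriv ℝ (a :: l).length f x (a :: l).get
      = fderiv ℝ (iteratedFDeriv ℝ l.length f) x a l.get :=
    iteratedFDeriv_succ_apply_left (𝕜 := ℝ) (f := f) (x := x) (n := l.length) (a :: l).get
  rw [h1]
  have h2 := ((ContinuousMultilinearMap.apply ℝ (fun _ : Fin l.length => E) F
    l.get).hasFDerivAt.comp x hf.hasFDerivAt).fderiv
  exact (congrArg (fun A : E →L[ℝ] F => A a) h2).symm

lemma iteratedFDeriv_list_cons_cons {f : E → F} {x : E} (a b : E) (l : List E)
    (hf : ContDiffAt ℝ (l.length + 2 : ℕ) f x) :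
    iteratedFDeriv ℝ (a :: b :: l).length f x (a :: b :: l).get
      = fderiv ℝ (fderiv ℝ (fun y => iteratedFDeriv ℝ l.length f y l.get)) x a b := by
  have hev : ∀ᶠ y in 𝓝 x, ContDiffAt ℝ (l.length + 2 : ℕ) f y :=
    hf.eventually fun h => ENat.natCast_ne_top (l.length + 2) (WithTop.coe_injective h)
  have hd : DifferentiableAt ℝ (iteratedFDeriv ℝ (b :: l).length f) x :=
    hf.differentiableAt_iteratedFDeriv (by
      simp only [List.length_cons]; exact_mod_cast Nat.lt_succ_self _)
  rw [iteratedFDeriv_list_cons a (b :: l) hd]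
  have he : (fun y => iteratedFDeriv ℝ (b :: l).length f y (b :: l).get) =ᶠ[𝓝 x]
      fun y => fderiv ℝ (fun y => iteratedFDeriv ℝ l.length f y l.get) y b := by
    filter_upwards [hev] with y hy
    exact iteratedFDeriv_list_cons b l
      (hy.differentiableAt_iteratedFDeriv (by exact_mod_cast (by omega)))
  rw [he.fderiv_eq]
  have hg : ContDiffAt ℝ 2 (fun y => iteratedFDeriv ℝ l.length f y l.get) x := by
    have := hf.iteratedFDeriv_right (m := 2) (i := l.length) (by norm_cast; omega)
    exact (ContinuousMultilinearMap.apply ℝ (fun _ : Fin l.length => E) F l.get).contDiff.contDiffAt.comp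
      x this
  have hdd : DifferentiableAt ℝ (fderiv ℝ (fun y => iteratedFDeriv ℝ l.length f y l.get)) x :=
    (hg.fderiv_right (m := 1) (by norm_num)).differentiableAt (by norm_num)
  rw [fderiv_clm_apply hdd (differentiableAt_const b)]
  simp

/-- Iterated derivatives of a `C^m` function do not depend on the order of the directions. Mathlib
has this for analytic functions, and for `m = 2`. -/
lemma iteratedFDeriv_list_perm {f : E → F} {l₁ l₂ : List E} (h : l₁.Perm l₂) :
    ∀ {x : E}, ContDiffAt ℝ l₁.length f x →
      iteratedFDeriv ℝ l₁.length f x l₁.get = iteratedFDeriv ℝ l₂.length f x l₂.get := by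
  induction h with
  | nil => intro x _; rfl
  | @cons a l₁ l₂ hl ih =>
    intro x hf
    have hlen := hl.length_eq
    have hev : ∀ᶠ y in 𝓝 x, ContDiffAt ℝ (a :: l₁).length f y := hf.eventually (by simp)
    have hd : ∀ k < l₁.length + 1, DifferentiableAt ℝ (iteratedFDeriv ℝ k f) x := fun k hk =>
      hf.differentiableAt_iteratedFDeriv (by simp only [List.length_cons]; exact_mod_cast hk)
    rw [iteratedFDeriv_list_cons a l₁ (hd _ (by omega)),
      iteratedFDeriv_list_cons a l₂ (hd _ (by omega))]
    have he : (fun y => iteratedFDeriv ℝ l₁.length f y l₁.get) =ᶠ[𝓝 x]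
        fun y => iteratedFDeriv ℝ l₂.length f y l₂.get := by
      filter_upwards [hev] with y hy
      exact ih (hy.of_le (by simp only [List.length_cons]; exact_mod_cast Nat.le_succ _))
    rw [he.fderiv_eq]
  | swap a b l =>
    intro x hf
    have hf' : ContDiffAt ℝ (l.length + 2 : ℕ) f x := hf
    rw [iteratedFDeriv_list_cons_cons b a l hf', iteratedFDeriv_list_cons_cons a b l hf']
    have hg : ContDiffAt ℝ 2 (fun y => iteratedFDeriv ℝ l.length f y l.get) x := by
      have := hf'.iteratedFDeriv_right (m := 2) (i := l.length) (by norm_cast; omega)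
      exact (ContinuousMultilinearMap.apply ℝ (fun _ : Fin l.length => E) F
        l.get).contDiff.contDiffAt.comp x this
    exact (hg.isSymmSndFDerivAt (by simp)).eq b a
  | @trans l₁ l₂ l₃ h₁₂ h₂₃ ih₁ ih₂ =>
    intro x hf
    rw [ih₁ hf, ih₂ (by rw [← h₁₂.length_eq]; exact hf)]

lemma iteratedFDeriv_eq_list {f : E → F} {x : E} {m : ℕ} (v : Fin m → E) (l : List E)
    (hl : List.ofFn v = l) :
    iteratedFDeriv ℝ m f x v = iteratedFDeriv ℝ l.length f x l.get := by
  subst hl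
  have key : ∀ (k : ℕ) (hk : k = m) (w : Fin k → E), (∀ j, w j = v (Fin.cast hk j)) →
      iteratedFDeriv ℝ m f x v = iteratedFDeriv ℝ k f x w := by
    intro k hk w hw
    subst hk
    congr 1
    funext j
    exact (hw j).symm
  exact key _ (List.length_ofFn) _ fun j => by simp [Fin.cast]

end IteratedDerivatives

/-- The multi-index counting how often each coordinate occurs in `σ`. -/
def countIndex {n m : ℕ} (σ : Fin m → Fin n) (i : Fin n) : ℕ := (List.ofFn σ).count i

lemma count_directions {n : ℕ} (α : Fin n → ℕ) (i : Fin n) : (directions α).count i = α i := by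
  unfold directions
  rw [List.count_flatMap]
  have : (List.map (List.count i ∘ fun j => List.replicate (α j) j) (List.finRange n)).sum
      = ∑ j, List.count i (List.replicate (α j) j) := by
    rw [Fin.sum_univ_def]; rfl
  rw [this]
  simp [List.count_replicate]

lemma directions_countIndex_perm {n m : ℕ} (σ : Fin m → Fin n) :
    (List.ofFn σ).Perm (directions (countIndex σ)) := by
  rw [List.perm_iff_count]
  intro i
  rw [count_directions]
  rfl

lemma multiOrder_countIndex {n m : ℕ} (σ : Fin m → Fin n) : multiOrder (countIndex σ) = m := by
  rw [← length_directions, ← (directions_countIndex_perm σ).length_eq, List.length_ofFn]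

/-- The `i`-th coordinate vector. -/
noncomputable abbrev basisVec {n : ℕ} (i : Fin n) : Rn n := EuclideanSpace.single i (1 : ℝ)

/-- Every component of the `m`-th derivative is one of the sorted partial derivatives. -/
lemma iteratedFDeriv_basisVec_eq_pderiv {n m : ℕ} (σ : Fin m → Fin n) {f : Rn n → ℂ} {x : Rn n}
    (hf : ContDiffAt ℝ m f x) :
    iteratedFDeriv ℝ m f x (fun j => basisVec (σ j)) = pderiv (countIndex σ) f x := by
  have hp := ((directions_countIndex_perm σ).map (basisVec (n := n)))
  have h1 : List.ofFn (fun j => basisVec (σ j)) = (List.ofFn σ).map basisVec := by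
    rw [List.map_ofFn]; rfl
  rw [iteratedFDeriv_eq_list _ _ h1, iteratedFDeriv_list_perm hp (by simpa using hf)]
  unfold pderiv
  refine (iteratedFDeriv_eq_list _ _ ?_).symm
  apply List.ext_get
  · simp
  · intro i h1 h2
    simp

lemma pderiv_zero_index {n : ℕ} (f : Rn n → ℂ) (x : Rn n) : pderiv 0 f x = f x := by
  have h : (directions (0 : Fin n → ℕ)).length = 0 := by
    rw [length_directions]; simp [multiOrder]
  unfold pderiv
  generalize hl : directions (0 : Fin n → ℕ) = l at h ⊢
  have : l = [] := List.length_eq_zero_iff.1 h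
  subst this
  exact iteratedFDeriv_zero_apply _

lemma norm_pderiv_le {n : ℕ} (α : Fin n → ℕ) (f : Rn n → ℂ) (x : Rn n) :
    ‖pderiv α f x‖ ≤ ‖iteratedFDeriv ℝ (multiOrder α) f x‖ := by
  rw [← length_directions]
  unfold pderiv
  refine (ContinuousMultilinearMap.le_opNorm _ _).trans ?_
  simp

lemma euclidean_eq_sum_basisVec {n : ℕ} (v : Rn n) : v = ∑ i, v i • basisVec i := by
  ext j
  simp [Finset.sum_apply, Pi.single_apply]

lemma multilinear_eq_sum_basisVec {n m : ℕ} (A : ContinuousMultilinearMap ℝ (fun _ : Fin m => Rn n) ℂ)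
    (v : Fin m → Rn n) :
    A v = ∑ σ : Fin m → Fin n, (∏ j, v j (σ j)) • A fun j => basisVec (σ j) := by
  conv_lhs => rw [show v = fun j => ∑ i, v j i • basisVec i from
    funext fun j => euclidean_eq_sum_basisVec (v j)]
  rw [A.map_sum]
  refine Finset.sum_congr rfl fun σ _ => ?_
  rw [A.map_smul_univ]

lemma norm_multilinear_le_sum_basisVec {n m : ℕ}
    (A : ContinuousMultilinearMap ℝ (fun _ : Fin m => Rn n) ℂ) :
    ‖A‖ ≤ ∑ σ : Fin m → Fin n, ‖A fun j => basisVec (σ j)‖ := by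
  refine A.opNorm_le_bound (Finset.sum_nonneg fun _ _ => norm_nonneg _) fun v => ?_
  rw [multilinear_eq_sum_basisVec A v, Finset.sum_mul]
  refine (norm_sum_le _ _).trans (Finset.sum_le_sum fun σ _ => ?_)
  rw [norm_smul, mul_comm, Real.norm_eq_abs, Finset.abs_prod]
  refine mul_le_mul_of_nonneg_left ?_ (norm_nonneg _)
  exact Finset.prod_le_prod (fun _ _ => abs_nonneg _) fun j _ => by
    simpa using PiLp.norm_apply_le (v j) (σ j)

/-! ### Taylor expansions -/

section Taylor

variable {E F : Type*} [NormedAddCommGroup E] [NormedSpace ℝ E] [NormedAddCommGroup F]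
  [NormedSpace ℝ F]

/-- The Taylor polynomial of order `L` of `f` at `a`, as a function of the increment `v`. -/
noncomputable def taylorPoly (L : ℕ) (f : E → F) (a v : E) : F :=
  ∑ i ∈ Finset.range (L + 1), ((i.factorial : ℝ)⁻¹) • iteratedFDeriv ℝ i f a fun _ => v

/-- If the top derivative varies by at most `A`, the Taylor remainder is at most `A ‖v‖ ^ M`. -/
lemma norm_sub_taylorPoly_le [CompleteSpace F] {f : E → F} {a v : E} {M : ℕ} {A : ℝ}
    (hf : ∀ t ∈ Set.Icc (0 : ℝ) 1, ContDiffAt ℝ M f (a + t • v))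
    (hA : ∀ t ∈ Set.Icc (0 : ℝ) 1, ‖iteratedFDeriv ℝ M f (a + t • v) - iteratedFDeriv ℝ M f a‖ ≤ A) :
    ‖f (a + v) - taylorPoly M f a v‖ ≤ A * ‖v‖ ^ M := by
  rcases M with _ | m
  · have h := hA 1 (by simp)
    have h1 := (iteratedFDeriv ℝ 0 f (a + (1 : ℝ) • v) - iteratedFDeriv ℝ 0 f a).le_opNorm
      (fun _ => v)
    simp only [taylorPoly, zero_add, Finset.range_one, Finset.sum_singleton, Nat.factorial_zero,
      Nat.cast_one, inv_one, one_smul, iteratedFDeriv_zero_apply, pow_zero, mul_one]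
    simp only [one_smul, sub_apply, iteratedFDeriv_zero_apply,
      Finset.univ_eq_empty, Finset.prod_empty, mul_one] at h1 h
    exact h1.trans h
  · have hT := map_add_eq_sum_add_integral_iteratedFDeriv (f := f) (x := a) (y := v) (n := m)
      (fun t ht => by exact_mod_cast hf t ht)
    have hc : (((m + 1).factorial : ℝ)⁻¹) • iteratedFDeriv ℝ (m + 1) f a (fun _ => v)
        = ((m.factorial : ℝ)⁻¹) • ∫ t in (0 : ℝ)..1, (1 - t) ^ m •
          iteratedFDeriv ℝ (m + 1) f a (fun _ => v) := by
      rw [intervalIntegral.integral_smul_const, smul_smul]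
      congr 1
      have : ∫ t in (0 : ℝ)..1, (1 - t) ^ m = ((m : ℝ) + 1)⁻¹ := by
        rw [intervalIntegral.integral_comp_sub_left (fun t => t ^ m) 1]
        simp
      rw [this, Nat.factorial_succ, mul_comm, Nat.cast_mul, mul_inv, mul_comm]
      push_cast
      ring
    have hcont : ContinuousOn (fun t : ℝ => (1 - t) ^ m •
        iteratedFDeriv ℝ (m + 1) f (a + t • v) (fun _ => v)) (Set.uIcc 0 1) := by
      rw [Set.uIcc_of_le zero_le_one]
      intro t ht
      have h1 : ContinuousAt (iteratedFDeriv ℝ (m + 1) f) (a + t • v) := by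
        have := (hf t ht).iteratedFDeriv_right (m := 0) (i := m + 1) (by simp)
        exact this.continuousAt
      have h2 : ContinuousAt (fun s : ℝ => a + s • v) t := by fun_prop
      have h3 : ContinuousAt (fun s : ℝ => iteratedFDeriv ℝ (m + 1) f (a + s • v)) t :=
        ContinuousAt.comp (f := fun s : ℝ => a + s • v) h1 h2
      have h4 : ContinuousAt (fun s : ℝ => iteratedFDeriv ℝ (m + 1) f (a + s • v) fun _ => v) t :=
        (ContinuousMultilinearMap.apply ℝ (fun _ : Fin (m + 1) => E) F
          (fun _ => v)).continuous.continuousAt.comp h3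
      exact ((by fun_prop : ContinuousAt (fun s : ℝ => (1 - s) ^ m) t).smul h4).continuousWithinAt
    have hint2 : IntervalIntegrable (fun t : ℝ => (1 - t) ^ m •
        iteratedFDeriv ℝ (m + 1) f a (fun _ => v)) volume 0 1 :=
      Continuous.intervalIntegrable (by fun_prop) _ _
    have hdiff : f (a + v) - taylorPoly (m + 1) f a v = ((m.factorial : ℝ)⁻¹) •
        ∫ t in (0 : ℝ)..1, (1 - t) ^ m •
          ((iteratedFDeriv ℝ (m + 1) f (a + t • v) - iteratedFDeriv ℝ (m + 1) f a) fun _ => v) := by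
      rw [taylorPoly, Finset.sum_range_succ, hc, hT, add_sub_add_left_eq_sub, ← smul_sub,
        ← intervalIntegral.integral_sub hcont.intervalIntegrable hint2]
      simp only [← smul_sub, sub_apply]
    rw [hdiff, norm_smul]
    have hA0 : 0 ≤ A := (norm_nonneg _).trans (hA 0 (by simp))
    have hb : ‖∫ t in (0 : ℝ)..1, (1 - t) ^ m •
          ((iteratedFDeriv ℝ (m + 1) f (a + t • v) - iteratedFDeriv ℝ (m + 1) f a) fun _ => v)‖
        ≤ (A * ‖v‖ ^ (m + 1)) * |1 - 0| := by
      refine intervalIntegral.norm_integral_le_of_norm_le_const fun t ht => ?_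
      rw [Set.uIoc_of_le zero_le_one] at ht
      have ht' : t ∈ Set.Icc (0 : ℝ) 1 := ⟨ht.1.le, ht.2⟩
      rw [norm_smul]
      have e1 : ‖(1 - t) ^ m‖ ≤ 1 := by
        rw [norm_pow, Real.norm_eq_abs, abs_of_nonneg (by linarith [ht.2])]
        exact pow_le_one₀ (by linarith [ht.2]) (by linarith [ht.1])
      have e2 := (iteratedFDeriv ℝ (m + 1) f (a + t • v)
        - iteratedFDeriv ℝ (m + 1) f a).le_opNorm (fun _ => v)
      simp only [Finset.prod_const, Finset.card_univ, Fintype.card_fin] at e2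
      calc _ ≤ 1 * (A * ‖v‖ ^ (m + 1)) := by
            refine mul_le_mul e1 (e2.trans ?_) (norm_nonneg _) zero_le_one
            exact mul_le_mul_of_nonneg_right (hA t ht') (by positivity)
        _ = _ := one_mul _
    rw [sub_zero, abs_one, mul_one] at hb
    have hfac : ‖((m.factorial : ℝ)⁻¹)‖ ≤ 1 := by
      rw [norm_inv, Real.norm_natCast]
      exact inv_le_one_of_one_le₀ (by exact_mod_cast Nat.factorial_pos m)
    calc _ ≤ 1 * (A * ‖v‖ ^ (m + 1)) := mul_le_mul hfac hb (norm_nonneg _) zero_le_one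
      _ = _ := one_mul _

lemma hasFDerivAt_iteratedFDeriv_diag {f : E → F} (hf : ContDiff ℝ ∞ f) (i : ℕ) (a v : E) :
    HasFDerivAt (fun w => iteratedFDeriv ℝ (i + 1) f a fun _ => w)
      (((i : ℝ) + 1) • iteratedFDeriv ℝ i (fderiv ℝ f) a fun _ => v) v := by
  have h1 := (iteratedFDeriv ℝ (i + 1) f a).hasFDerivAt (fun _ : Fin (i + 1) => v)
  have h2 : HasFDerivAt (fun w : E => (fun _ : Fin (i + 1) => w))
      (ContinuousLinearMap.pi fun _ => ContinuousLinearMap.id ℝ E) v :=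
    (ContinuousLinearMap.pi (fun _ : Fin (i + 1) => ContinuousLinearMap.id ℝ E)).hasFDerivAt
  have h3 := HasFDerivAt.comp v h1 h2
  refine h3.congr_fderiv ?_
  ext w
  have hsucc : iteratedFDeriv ℝ (i + 1) f a (Fin.snoc (fun _ => v) w)
      = iteratedFDeriv ℝ i (fderiv ℝ f) a (fun _ => v) w := by
    rw [iteratedFDeriv_succ_apply_right]
    simp
  have hterm : ∀ j : Fin (i + 1),
      iteratedFDeriv ℝ (i + 1) f a (Function.update (fun _ => v) j w)
        = iteratedFDeriv ℝ i (fderiv ℝ f) a (fun _ => v) w := by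
    intro j
    rw [← hsucc, iteratedFDeriv_eq_list (Function.update (fun _ => v) j w) _ rfl,
      iteratedFDeriv_eq_list (Fin.snoc (fun _ => v) w : Fin (i + 1) → E) _ rfl]
    apply iteratedFDeriv_list_perm
    · have e : Function.update (fun _ => v) j w
          = (Fin.snoc (fun _ => v) w : Fin (i + 1) → E) ∘ Equiv.swap j (Fin.last i) := by
        funext l
        rcases eq_or_ne l j with rfl | h
        · simp
        · rw [Function.update_of_ne h]
          rcases eq_or_ne l (Fin.last i) with rfl | h'
          · simp only [Function.comp, Equiv.swap_apply_right]
            obtain ⟨j', rfl⟩ := Fin.exists_castSucc_eq.2 (Ne.symm h)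
            simp
          · simp only [Function.comp, Equiv.swap_apply_of_ne_of_ne h h']
            obtain ⟨l', rfl⟩ := Fin.exists_castSucc_eq.2 h'
            simp
      rw [e]
      exact Equiv.Perm.ofFn_comp_perm _ _
    · exact (hf.contDiffAt).of_le (by exact_mod_cast le_top)
  simp only [ContinuousLinearMap.comp_apply, ContinuousMultilinearMap.linearDeriv_apply,
    ContinuousLinearMap.pi_apply, ContinuousLinearMap.id_apply, hterm]
  simp [Nat.cast_smul_eq_nsmul, add_smul]

lemma hasFDerivAt_taylorPoly {f : E → F} (hf : ContDiff ℝ ∞ f) (L : ℕ) (a v : E) :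
    HasFDerivAt (taylorPoly (L + 1) f a) (taylorPoly L (fderiv ℝ f) a v) v := by
  have h0 : HasFDerivAt (fun w => ((Nat.factorial 0 : ℝ)⁻¹) • iteratedFDeriv ℝ 0 f a fun _ => w)
      (0 : E →L[ℝ] F) v := by
    simp only [iteratedFDeriv_zero_apply]
    exact hasFDerivAt_const _ _
  have h1 : ∀ i ∈ Finset.range (L + 1), HasFDerivAt
      (fun w => (((i + 1).factorial : ℝ)⁻¹) • iteratedFDeriv ℝ (i + 1) f a fun _ => w)
      (((i.factorial : ℝ)⁻¹) • iteratedFDeriv ℝ i (fderiv ℝ f) a fun _ => v) v := by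
    intro i _
    refine ((hasFDerivAt_iteratedFDeriv_diag hf i a v).const_smul _).congr_fderiv ?_
    rw [smul_smul]
    congr 1
    rw [Nat.factorial_succ]
    have : (i.factorial : ℝ) ≠ 0 := by exact_mod_cast Nat.factorial_ne_zero i
    have : (i : ℝ) + 1 ≠ 0 := by positivity
    push_cast
    field_simp
  have h2 := (HasFDerivAt.fun_sum h1).add h0
  rw [add_zero] at h2
  refine h2.congr_of_eventuallyEq (Eventually.of_forall fun w => ?_)
  simp only [taylorPoly, Pi.add_apply]
  rw [Finset.sum_range_succ']

end Taylor

section TaylorRemainder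

/-- All derivatives of the Taylor remainder of order `L`: those of order `i ≤ L` vanish at the
centre to order `L + 1 - i`, the others are those of the function (the subtraction truncates). -/
lemma norm_iteratedFDeriv_taylor_remainder_le.{u} {E : Type u} [NormedAddCommGroup E] [NormedSpace ℝ E]
    (i : ℕ) : ∀ {F : Type u} [NormedAddCommGroup F] [NormedSpace ℝ F] [CompleteSpace F] (L : ℕ)
    (f : E → F) (C : ℝ), ContDiff ℝ ∞ f →
    (∀ x, ‖iteratedFDeriv ℝ (max (L + 1) i) f x‖ ≤ C) → ∀ a v : E,
      ‖iteratedFDeriv ℝ i (fun w => f (a + w) - taylorPoly L f a w) v‖ ≤ C * ‖v‖ ^ (L + 1 - i) := by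
  induction i with
  | zero =>
    intro F _ _ _ L f C hf hC a v
    rw [norm_iteratedFDeriv_zero]
    have hC' : ∀ x, ‖iteratedFDeriv ℝ (L + 1) f x‖ ≤ C := fun x => by
      have := hC x
      rwa [Nat.max_zero] at this
    have hmv : ∀ t ∈ Set.Icc (0 : ℝ) 1,
        ‖iteratedFDeriv ℝ L f (a + t • v) - iteratedFDeriv ℝ L f a‖ ≤ C * ‖v‖ := by
      intro t ht
      have h := Convex.norm_image_sub_le_of_norm_fderiv_le (𝕜 := ℝ) (s := (Set.univ : Set E))
        (f := iteratedFDeriv ℝ L f) (C := C) (x := a) (y := a + t • v)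
        (fun x _ => hf.differentiable_iteratedFDeriv (by exact_mod_cast ENat.natCast_lt_top L) x)
        (fun x _ => by rw [norm_fderiv_iteratedFDeriv]; exact hC' x) convex_univ (mem_univ _)
        (mem_univ _)
      refine h.trans (mul_le_mul_of_nonneg_left ?_ ((norm_nonneg _).trans (hC' a)))
      rw [add_sub_cancel_left, norm_smul, Real.norm_eq_abs, abs_of_nonneg ht.1]
      exact mul_le_of_le_one_left (norm_nonneg _) ht.2
    have := norm_sub_taylorPoly_le (M := L)
      (fun t _ => hf.contDiffAt.of_le (by exact_mod_cast le_top)) hmv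
    rwa [mul_assoc, ← pow_succ'] at this
  | succ i ih =>
    intro F _ _ _ L f C hf hC a v
    rw [← norm_iteratedFDeriv_fderiv]
    have hfd : ContDiff ℝ ∞ (fderiv ℝ f) := hf.fderiv_right (by simp)
    have hfa : ∀ w, HasFDerivAt (fun w => f (a + w)) (fderiv ℝ f (a + w)) w := fun w => by
      have h1 := (hf.differentiable (by simp) (a + w)).hasFDerivAt
      exact (h1.comp w ((hasFDerivAt_id w).const_add a)).congr_fderiv (ContinuousLinearMap.comp_id _)
    rcases L with _ | L
    · have h0 : fderiv ℝ (fun w => f (a + w) - taylorPoly 0 f a w) = fun w => fderiv ℝ f (a + w) := by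
        funext w
        have : HasFDerivAt (taylorPoly 0 f a) (0 : E →L[ℝ] F) w := by
          have : taylorPoly 0 f a = fun _ => f a := by
            funext w; simp [taylorPoly]
          rw [this]
          exact hasFDerivAt_const _ _
        exact ((hfa w).sub this).fderiv.trans (sub_zero _)
      rw [h0, iteratedFDeriv_comp_add_left, norm_iteratedFDeriv_fderiv]
      have := hC (a + v)
      rw [show max (0 + 1) (i + 1) = i + 1 by omega] at this
      simpa using this
    · have h0 : fderiv ℝ (fun w => f (a + w) - taylorPoly (L + 1) f a w)
          = fun w => fderiv ℝ f (a + w) - taylorPoly L (fderiv ℝ f) a w := by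
        funext w
        exact ((hfa w).sub (hasFDerivAt_taylorPoly hf L a w)).fderiv
      rw [h0]
      have := ih L (fderiv ℝ f) C hfd (fun x => by
        rw [norm_iteratedFDeriv_fderiv]
        have := hC x
        rwa [show max (L + 1 + 1) (i + 1) = max (L + 1) i + 1 by omega] at this) a v
      rwa [show L + 1 + 1 - (i + 1) = L + 1 - i by omega]

end TaylorRemainder

/-! ### Polynomial functions -/

/-- The complex polynomial functions of degree at most `d` on `ℝⁿ`. -/
noncomputable def polys (n d : ℕ) : Submodule ℂ (Rn n → ℂ) :=
  Submodule.span ℂ {p | ∃ α : Fin n → ℕ, multiOrder α ≤ d ∧ p = fun x => (monom α x : ℂ)}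

lemma monom_mem_polys {n d : ℕ} {α : Fin n → ℕ} (h : multiOrder α ≤ d) :
    (fun x => (monom α x : ℂ)) ∈ polys n d := Submodule.subset_span ⟨α, h, rfl⟩

lemma polys_mono {n d e : ℕ} (h : d ≤ e) : polys n d ≤ polys n e :=
  Submodule.span_mono fun _ ⟨α, hα, hp⟩ => ⟨α, hα.trans h, hp⟩

lemma const_mem_polys {n : ℕ} (d : ℕ) (c : ℂ) : (fun _ : Rn n => c) ∈ polys n d := by
  have h : (fun x : Rn n => (monom (0 : Fin n → ℕ) x : ℂ)) ∈ polys n d :=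
    monom_mem_polys (by simp [multiOrder])
  have := (polys n d).smul_mem c h
  convert this using 1
  funext x
  simp [monom]

lemma coord_mul_mem_polys {n d : ℕ} (i : Fin n) {p : Rn n → ℂ} (hp : p ∈ polys n d) :
    (fun x => (x i : ℂ) * p x) ∈ polys n (d + 1) := by
  induction hp using Submodule.span_induction with
  | mem p h =>
    obtain ⟨α, hα, rfl⟩ := h
    have h1 : (fun x : Rn n => (monom (Pi.single i 1 + α) x : ℂ)) ∈ polys n (d + 1) :=
      monom_mem_polys (by
        rw [multiOrder_add]
        have : multiOrder (Pi.single i 1 : Fin n → ℕ) = 1 := by simp [multiOrder]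
        omega)
    convert h1 using 1
    funext x
    rw [monom_add]
    have : monom (Pi.single i 1) x = x i := by
      unfold monom
      rw [Finset.prod_eq_single i]
      · simp
      · intro j _ hj; simp [Pi.single_eq_of_ne hj]
      · simp
    rw [this]
    push_cast
    rfl
  | zero =>
    convert (polys n (d + 1)).zero_mem using 1
    funext x
    simp
  | add p q _ _ hp hq =>
    convert (polys n (d + 1)).add_mem hp hq using 1
    funext x
    simp [mul_add]
  | smul c p _ hp =>
    convert (polys n (d + 1)).smul_mem c hp using 1
    funext x
    simp [mul_left_comm]

lemma affine_mul_mem_polys {n d : ℕ} (i : Fin n) (b c : ℂ) {p : Rn n → ℂ} (hp : p ∈ polys n d) :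
    (fun x => (b * (x i : ℂ) + c) * p x) ∈ polys n (d + 1) := by
  convert (polys n (d + 1)).add_mem ((polys n (d + 1)).smul_mem b (coord_mul_mem_polys i hp))
    ((polys n (d + 1)).smul_mem c (polys_mono (Nat.le_succ d) hp)) using 1
  funext x
  simp only [Pi.add_apply, Pi.smul_apply, smul_eq_mul]
  ring

lemma prod_affine_mem_polys {n : ℕ} (l : List (Fin n)) (b : ℂ) (c : Fin n → ℂ) :
    (fun x : Rn n => (l.map fun i => b * (x i : ℂ) + c i).prod) ∈ polys n l.length := by
  induction l with
  | nil => simpa using const_mem_polys 0 1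
  | cons i l ih => simpa using affine_mul_mem_polys i b (c i) ih

lemma monom_eq_prod_directions {n : ℕ} (α : Fin n → ℕ) (g : Fin n → ℂ) :
    ∏ i, g i ^ α i = ((directions α).map g).prod := by
  unfold directions
  rw [Fin.prod_univ_def]
  induction List.finRange n with
  | nil => simp
  | cons i l ih => simp [ih]

lemma comp_affine_mem_polys {n d : ℕ} {p : Rn n → ℂ} (hp : p ∈ polys n d) (b : ℝ) (c : Rn n) :
    (fun x => p (b • x + c)) ∈ polys n d := by
  induction hp using Submodule.span_induction with
  | mem p h =>
    obtain ⟨α, hα, rfl⟩ := h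
    have h1 := prod_affine_mem_polys (directions α) (b : ℂ) (fun i => (c i : ℂ))
    rw [length_directions] at h1
    refine polys_mono hα ?_
    convert h1 using 1
    funext x
    rw [← monom_eq_prod_directions]
    simp [monom]
  | zero => exact (polys n d).zero_mem
  | add p q _ _ hp hq =>
    exact (polys n d).add_mem hp hq
  | smul c p _ hp =>
    exact (polys n d).smul_mem c hp

lemma multilinear_diag_mem_polys {n m : ℕ}
    (A : ContinuousMultilinearMap ℝ (fun _ : Fin m => Rn n) ℂ) :
    (fun v => A fun _ => v) ∈ polys n m := by
  have h : (fun v => A fun _ => v)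
      = ∑ σ : Fin m → Fin n, (A fun j => basisVec (σ j)) •
        fun v : Rn n => ((List.ofFn σ).map fun i => (1 : ℂ) * (v i : ℂ) + 0).prod := by
    funext v
    rw [multilinear_eq_sum_basisVec A, Finset.sum_apply]
    refine Finset.sum_congr rfl fun σ _ => ?_
    simp [List.prod_ofFn, mul_comm]
  rw [h]
  refine Submodule.sum_mem _ fun σ _ => Submodule.smul_mem _ _ ?_
  have := prod_affine_mem_polys (List.ofFn σ) 1 (fun _ => 0)
  rwa [List.length_ofFn] at this

lemma taylorPoly_mem_polys {n : ℕ} (L : ℕ) (f : Rn n → ℂ) (a : Rn n) :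
    taylorPoly L f a ∈ polys n L := by
  have h : taylorPoly L f a = ∑ i ∈ Finset.range (L + 1), (((i.factorial : ℝ)⁻¹ : ℝ) : ℂ) •
      fun v => iteratedFDeriv ℝ i f a fun _ => v := by
    funext v
    simp [taylorPoly]
  rw [h]
  exact Submodule.sum_mem _ fun i hi => Submodule.smul_mem _ _
    (polys_mono (Nat.lt_succ_iff.1 (Finset.mem_range.1 hi)) (multilinear_diag_mem_polys _))

lemma contDiff_of_mem_polys {n d : ℕ} {p : Rn n → ℂ} (hp : p ∈ polys n d) : ContDiff ℝ ∞ p := by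
  induction hp using Submodule.span_induction with
  | mem p h =>
    obtain ⟨α, -, rfl⟩ := h
    exact Complex.ofRealCLM.contDiff.comp (contDiff_monom α)
  | zero => exact contDiff_const
  | add p q _ _ hp hq => exact hp.add hq
  | smul c p _ hp => exact contDiff_const.smul hp

lemma integrable_polys_mul {n d : ℕ} {p : Rn n → ℂ} (hp : p ∈ polys n d) (f : 𝓢(Rn n, ℂ)) :
    Integrable fun x => p x * f x := by
  induction hp using Submodule.span_induction with
  | mem p h =>
    obtain ⟨α, -, rfl⟩ := h
    exact integrable_monom_mul α f
  | zero => simp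
  | add p q _ _ hp hq => simpa [add_mul] using! hp.add hq
  | smul c p _ hp => simpa [mul_assoc] using hp.const_mul c

lemma mem_momentSchwartz_iff {n d : ℕ} {f : 𝓢(Rn n, ℂ)} :
    f ∈ momentSchwartz n d ↔ ∀ p ∈ polys n d, ∫ x, p x * f x = 0 := by
  constructor
  · intro hf p hp
    induction hp using Submodule.span_induction with
    | mem p h =>
      obtain ⟨α, hα, rfl⟩ := h
      exact hf α hα
    | zero => simp
    | add p q hp hq ihp ihq =>
      have := integral_add (integrable_polys_mul hp f) (integrable_polys_mul hq f)
      rw [ihp, ihq, add_zero] at this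
      rw [← this]
      simp [add_mul]
    | smul c p _ hp =>
      simp only [Pi.smul_apply, smul_eq_mul, mul_assoc]
      rw [integral_const_mul, hp, mul_zero]
  · intro h α hα
    exact h _ (monom_mem_polys hα)

/-! ### Rescaled and translated test functions -/

/-- The `L¹`-normalized reflected dilate `z ↦ r ^ (-n) φ ((y - z) / r)` at scale `r > 0`, centred
at `y`. For `r = 2 ^ (-k)` this is `dilateReflect φ k y`. -/
noncomputable def atom {n : ℕ} (φ : 𝓢(Rn n, ℂ)) {r : ℝ} (hr : 0 < r) (y : Rn n) : 𝓢(Rn n, ℂ) :=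
  (((r : ℂ) ^ n)⁻¹) •
    compSubConstCLM ℂ y
      (compCLMOfContinuousLinearEquiv ℂ
        (ContinuousLinearEquiv.smulLeft (Units.mk0 (-r⁻¹) (neg_ne_zero.2 (inv_ne_zero hr.ne')))) φ)

section Atom

variable {n : ℕ} (φ : 𝓢(Rn n, ℂ)) {r : ℝ} (hr : 0 < r) (y : Rn n)

lemma atom_apply (z : Rn n) : atom φ hr y z = ((r : ℂ) ^ n)⁻¹ * φ (r⁻¹ • (y - z)) := by
  have h : (-r⁻¹) • (z - y) = r⁻¹ • (y - z) := by
    rw [neg_smul, ← smul_neg, neg_sub]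
  rw [← h]
  rfl

lemma dilateReflect_eq_atom (k : ℤ) :
    dilateReflect φ k y = atom φ (zpow_pos (two_pos : (0 : ℝ) < 2) (-k)) y := by
  ext z
  rw [dilateReflect_apply, atom_apply, zpow_neg, inv_inv]
  congr 1
  push_cast
  rw [inv_pow, inv_inv, zpow_mul, zpow_natCast]

variable {φ}

lemma tsupport_atom_subset {ρ : ℝ} (h : tsupport φ ⊆ Metric.closedBall 0 ρ) :
    tsupport (atom φ hr y) ⊆ Metric.closedBall y (ρ * r) := by
  refine closure_minimal (fun z hz => ?_) Metric.isClosed_closedBall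
  rw [Function.mem_support, atom_apply] at hz
  have h1 : r⁻¹ • (y - z) ∈ tsupport φ := subset_tsupport _ (right_ne_zero_of_mul hz)
  have h2 := h h1
  rw [mem_closedBall_zero_iff, norm_smul, norm_inv, Real.norm_eq_abs, abs_of_pos hr,
    inv_mul_le_iff₀ hr] at h2
  rw [mem_closedBall_iff_norm', mul_comm]
  exact h2

lemma hasCompactSupport_of_subset_closedBall {f : Rn n → ℂ} {c : Rn n} {ρ : ℝ}
    (h : tsupport f ⊆ Metric.closedBall c ρ) : HasCompactSupport f :=
  (isCompact_closedBall c ρ).of_isClosed_subset (isClosed_tsupport f) h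

lemma exists_tsupport_subset_closedBall (h : φ ∈ testFunctions n) :
    ∃ ρ : ℝ, 1 ≤ ρ ∧ tsupport φ ⊆ Metric.closedBall 0 ρ := by
  obtain ⟨ρ, hρ⟩ := (HasCompactSupport.isCompact h).isBounded.subset_closedBall (0 : Rn n)
  exact ⟨max ρ 1, le_max_right _ _, hρ.trans (Metric.closedBall_subset_closedBall (le_max_left _ _))⟩

lemma atom_mem_testFunctions (h : φ ∈ testFunctions n) : atom φ hr y ∈ testFunctions n := by
  obtain ⟨ρ, -, hρ⟩ := exists_tsupport_subset_closedBall h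
  exact hasCompactSupport_of_subset_closedBall (tsupport_atom_subset hr y hρ)

include hr in
lemma integral_comp_atom {G : Type*} [NormedAddCommGroup G] [NormedSpace ℝ G] (g : Rn n → G) :
    ∫ z, g (r⁻¹ • (y - z)) = r ^ n • ∫ w, g w := by
  rw [integral_sub_left_eq_self (fun w => g (r⁻¹ • w)) volume y,
    Measure.integral_comp_inv_smul_of_nonneg volume g hr.le, finrank_euclideanSpace_fin]

variable (φ)

lemma integral_mul_atom (p : Rn n → ℂ) :
    ∫ z, p z * atom φ hr y z = ∫ w, p (y - r • w) * φ w := by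
  have h := integral_comp_atom hr y fun w => ((r : ℂ) ^ n)⁻¹ * (p (y - r • w) * φ w)
  rw [integral_const_mul (μ := volume) _ fun w : Rn n => p (y - r • w) * φ w] at h
  have hrn : (r : ℂ) ^ n ≠ 0 := pow_ne_zero _ (by exact_mod_cast hr.ne')
  have h' : r ^ n • (((r : ℂ) ^ n)⁻¹ * ∫ w, p (y - r • w) * φ w) = ∫ w, p (y - r • w) * φ w := by
    rw [Complex.real_smul]
    push_cast
    rw [← mul_assoc, mul_inv_cancel₀ hrn, one_mul]
  rw [← h', ← h]
  congr 1
  funext z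
  rw [atom_apply, smul_inv_smul₀ hr.ne', sub_sub_cancel]
  ring

lemma integral_norm_atom : ∫ z, ‖atom φ hr y z‖ = ∫ w, ‖φ w‖ := by
  have h := integral_comp_atom hr y fun w => (r ^ n)⁻¹ * ‖φ w‖
  rw [integral_const_mul (μ := volume) _ fun w : Rn n => ‖φ w‖, smul_eq_mul, mul_inv_cancel_left₀ (pow_pos hr n).ne'] at h
  rw [← h]
  congr 1
  funext z
  rw [atom_apply, norm_mul, norm_inv, norm_pow, Complex.norm_real, Real.norm_eq_abs, abs_of_pos hr]

variable {φ}

lemma atom_mem_momentSchwartz {P : ℕ} (h : φ ∈ momentSchwartz n P) :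
    atom φ hr y ∈ momentSchwartz n P := by
  rw [mem_momentSchwartz_iff] at h ⊢
  intro p hp
  rw [integral_mul_atom]
  have := h _ (comp_affine_mem_polys hp (-r) y)
  rw [← this]
  congr 1
  funext w
  rw [neg_smul, sub_eq_neg_add]

lemma atom_mem_momentTest {P : ℕ} (h : φ ∈ momentTest n P) : atom φ hr y ∈ momentTest n P :=
  ⟨atom_mem_momentSchwartz hr y h.1, atom_mem_testFunctions hr y h.2⟩

variable (φ)

lemma norm_iteratedFDeriv_atom (i : ℕ) (z : Rn n) :
    ‖iteratedFDeriv ℝ i (atom φ hr y) z‖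
      = (r ^ n)⁻¹ * (r⁻¹) ^ i * ‖iteratedFDeriv ℝ i φ (r⁻¹ • (y - z))‖ := by
  have h0 : (atom φ hr y : Rn n → ℂ)
      = fun z => (((r : ℂ) ^ n)⁻¹) • (fun w => φ ((-r⁻¹) • w)) (z - y) := by
    funext z
    simp only [atom_apply, smul_eq_mul, neg_smul, ← smul_neg, neg_sub]
  have hc : ContDiff ℝ i fun w => φ ((-r⁻¹) • w) := ((φ.smooth i).comp (contDiff_const_smul _))
  have hc' : ContDiff ℝ i fun z => (fun w => φ ((-r⁻¹) • w)) (z - y) :=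
    hc.comp (contDiff_id.sub contDiff_const)
  rw [h0, iteratedFDeriv_const_smul_apply' hc'.contDiffAt, norm_smul,
    iteratedFDeriv_comp_sub (𝕜 := ℝ) (f := fun w => φ ((-r⁻¹) • w)) i y z,
    iteratedFDeriv_comp_const_smul (-r⁻¹) (φ.smooth i)]
  simp only [norm_smul, norm_inv, norm_pow, Complex.norm_real, Real.norm_eq_abs, abs_neg,
    abs_of_pos hr, abs_inv]
  rw [neg_smul, ← smul_neg, neg_sub, mul_assoc]

end Atom

lemma exists_bound_iteratedFDeriv {n : ℕ} (φ : 𝓢(Rn n, ℂ)) (i : ℕ) :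
    ∃ C : ℝ, 0 ≤ C ∧ ∀ x, ‖iteratedFDeriv ℝ i φ x‖ ≤ C := by
  obtain ⟨C, hC⟩ := φ.decay 0 i
  exact ⟨C, hC.1.le, fun x => by simpa using hC.2 x⟩

lemma exists_bound_iteratedFDeriv_le {n : ℕ} (φ : 𝓢(Rn n, ℂ)) (N : ℕ) :
    ∃ C : ℝ, 0 < C ∧ ∀ i ≤ N, ∀ x, ‖iteratedFDeriv ℝ i φ x‖ ≤ C := by
  choose C hC0 hC using exists_bound_iteratedFDeriv φ
  refine ⟨∑ i ∈ Finset.range (N + 1), C i + 1, by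
    have := Finset.sum_nonneg fun i (_ : i ∈ Finset.range (N + 1)) => hC0 i
    linarith, fun i hi x => (hC i x).trans ?_⟩
  have := Finset.single_le_sum (fun i _ => hC0 i) (Finset.mem_range.2 (Nat.lt_succ_of_le hi))
  linarith

/-! ### Off-diagonal estimates -/

/-- `K (x, ·)` agrees near `y₀ ≠ x` with a polynomial of degree at most `M`, up to
`|y - y₀| ^ (M + γ) |x - y₀| ^ (-N)`. This is all the regularity of `K` in the second variable
that the estimates use. -/
def HasPolyApprox {n : ℕ} (M : ℕ) (γ N : ℝ) (K : Rn n → Rn n → ℂ) : Prop :=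
  ∃ C : ℝ, 0 ≤ C ∧ ∀ x y₀ : Rn n, x ≠ y₀ → ∃ p ∈ polys n M, ∀ y, ‖y - y₀‖ < ‖x - y₀‖ / 2 →
    ‖K x y - p y‖ ≤ C * ‖y - y₀‖ ^ (M + γ) * ‖x - y₀‖ ^ (-N)

lemma HasPolyApprox.of_holder {n M : ℕ} {γ N : ℝ} (hγ : 0 < γ) {K : Rn n → Rn n → ℂ}
    (hd : ∀ x y, x ≠ y → ContDiffAt ℝ M (K x) y) {C : ℝ}
    (hC : ∀ β : Fin n → ℕ, multiOrder β = M → ∀ x y h : Rn n, ‖h‖ < ‖x - y‖ / 2 →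
      ‖pderiv β (K x) (y + h) - pderiv β (K x) y‖ ≤ C * ‖h‖ ^ γ * ‖x - y‖ ^ (-N)) :
    HasPolyApprox M γ N K := by
  refine ⟨(Fintype.card (Fin M → Fin n) : ℝ) * max C 0, by positivity, fun x y₀ hxy => ?_⟩
  refine ⟨fun y => taylorPoly M (K x) y₀ (y - y₀), ?_, fun y hy => ?_⟩
  · have := comp_affine_mem_polys (taylorPoly_mem_polys M (K x) y₀) 1 (-y₀)
    simpa [sub_eq_add_neg] using this
  set v := y - y₀ with hv
  have hyv : y = y₀ + v := by rw [hv]; abel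
  have hsmall : ∀ t ∈ Set.Icc (0 : ℝ) 1, ‖t • v‖ ≤ ‖v‖ := fun t ht => by
    rw [norm_smul, Real.norm_eq_abs, abs_of_nonneg ht.1]
    exact mul_le_of_le_one_left (norm_nonneg _) ht.2
  have hne : ∀ t ∈ Set.Icc (0 : ℝ) 1, x ≠ y₀ + t • v := by
    intro t ht h
    have h1 := hsmall t ht
    have h2 : ‖x - y₀‖ = ‖t • v‖ := by rw [h, add_sub_cancel_left]
    have h3 : 0 < ‖x - y₀‖ := norm_pos_iff.2 (sub_ne_zero.2 hxy)
    linarith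
  have hA : ∀ t ∈ Set.Icc (0 : ℝ) 1,
      ‖iteratedFDeriv ℝ M (K x) (y₀ + t • v) - iteratedFDeriv ℝ M (K x) y₀‖
        ≤ (Fintype.card (Fin M → Fin n) : ℝ) * (max C 0 * ‖v‖ ^ γ * ‖x - y₀‖ ^ (-N)) := by
    intro t ht
    refine (norm_multilinear_le_sum_basisVec _).trans ?_
    rw [← nsmul_eq_mul]
    refine Finset.sum_le_card_nsmul _ _ _ fun σ _ => ?_
    rw [sub_apply, iteratedFDeriv_basisVec_eq_pderiv σ (hd x _ (hne t ht)),
      iteratedFDeriv_basisVec_eq_pderiv σ (hd x _ hxy)]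
    refine (hC _ (multiOrder_countIndex σ) x y₀ (t • v) ((hsmall t ht).trans_lt hy)).trans ?_
    gcongr
    · exact le_max_left _ _
    · exact hsmall t ht
  have h := norm_sub_taylorPoly_le (fun t ht => hd x _ (hne t ht)) hA
  change ‖K x y - taylorPoly M (K x) y₀ v‖ ≤ _
  rw [hyv]
  refine h.trans_eq ?_
  rw [add_comm (M : ℝ) γ, Real.rpow_add_natCast' (norm_nonneg v) (by positivity)]
  ring

lemma isOpen_offDiagonal {n : ℕ} : IsOpen {p : Rn n × Rn n | p.1 ≠ p.2} :=
  isOpen_ne_fun continuous_fst continuous_snd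

lemma IsStandardKernel.hasPolyApprox {n M : ℕ} {ν γ : ℝ} (hγ : 0 < γ) {K : Rn n → Rn n → ℂ}
    (hK : IsStandardKernel ν M γ K) : HasPolyApprox M γ (n + ν + M + γ) K := by
  obtain ⟨C, hC⟩ := hK.holder
  refine HasPolyApprox.of_holder hγ (fun x y hxy => ?_) (C := C) fun β hβ x y h hh => ?_
  · have h1 := hK.contDiffOn.contDiffAt (isOpen_offDiagonal.mem_nhds (show (x, y).1 ≠ (x, y).2 from hxy))
    exact h1.comp y (f := fun y => (x, y)) (contDiffAt_const.prodMk contDiffAt_id)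
  · have := hC 0 β (by simpa [multiOrder] using hβ) x y h hh
    simp only [kernelDeriv, pderiv_zero_index] at this
    rw [norm_sub_rev]
    exact (le_add_of_nonneg_left (norm_nonneg _)).trans this

lemma IsStandardKernel.hasPolyApprox_swap {n M : ℕ} {ν γ : ℝ} (hγ : 0 < γ) {K : Rn n → Rn n → ℂ}
    (hK : IsStandardKernel ν M γ K) : HasPolyApprox M γ (n + ν + M + γ) fun x y => K y x := by
  obtain ⟨C, hC⟩ := hK.holder
  refine HasPolyApprox.of_holder hγ (fun x y hxy => ?_) (C := C) fun β hβ x y h hh => ?_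
  · have h1 := hK.contDiffOn.contDiffAt
      (isOpen_offDiagonal.mem_nhds (show (y, x).1 ≠ (y, x).2 from hxy.symm))
    exact h1.comp y (f := fun y => (y, x)) (contDiffAt_id.prodMk contDiffAt_const)
  · rw [norm_sub_rev x y] at hh ⊢
    have := hC β 0 (by simpa [multiOrder] using hβ) y x h hh
    simp only [kernelDeriv, pderiv_zero_index] at this
    exact (le_add_of_nonneg_right (norm_nonneg _)).trans this

/-- `S` is given by the kernel function `K` for disjoint supports. -/
def HasKernelFunction {n P₀ : ℕ} (S : momentSchwartz n P₀ →ₗ[ℂ] 𝓢'(Rn n, ℂ))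
    (K : Rn n → Rn n → ℂ) : Prop :=
  ∀ (f : 𝓢(Rn n, ℂ)) (hf : f ∈ momentSchwartz n P₀), f ∈ testFunctions n →
    ∀ g ∈ testFunctions n, Disjoint (tsupport f) (tsupport g) →
      S ⟨f, hf⟩ g = ∫ x, ∫ y, K x y * f y * g x

lemma integral_swap_of_disjoint_tsupport {n : ℕ} {K : Rn n → Rn n → ℂ}
    (hK : ContinuousOn (fun p : Rn n × Rn n => K p.1 p.2) {p | p.1 ≠ p.2}) {f g : 𝓢(Rn n, ℂ)}
    (hf : f ∈ testFunctions n) (hg : g ∈ testFunctions n)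
    (hd : Disjoint (tsupport f) (tsupport g)) :
    ∫ x, ∫ y, K x y * f y * g x = ∫ y, ∫ x, K x y * f y * g x := by
  have hsupp : ∀ p : Rn n × Rn n, p ∉ tsupport g ×ˢ tsupport f → f p.2 * g p.1 = 0 := by
    intro p hp
    rw [Set.mem_prod, not_and_or] at hp
    rcases hp with h | h
    · rw [image_eq_zero_of_notMem_tsupport h, mul_zero]
    · rw [image_eq_zero_of_notMem_tsupport h, zero_mul]
  have hcl : IsClosed (tsupport g ×ˢ tsupport f) :=
    (isClosed_tsupport _).prod (isClosed_tsupport _)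
  refine integral_integral_swap_of_hasCompactSupport (f := fun x y => K x y * f y * g x) ?_ ?_
  · rw [continuous_iff_continuousAt]
    intro p
    by_cases hp : p ∈ tsupport g ×ˢ tsupport f
    · have hne : p.1 ≠ p.2 := fun h => hd.le_bot ⟨hp.2, h ▸ hp.1⟩
      have h1 := hK.continuousAt (isOpen_offDiagonal.mem_nhds hne)
      exact (h1.mul (f.continuous.comp continuous_snd).continuousAt).mul
        (g.continuous.comp continuous_fst).continuousAt
    · have h0 : (Function.uncurry fun x y => K x y * f y * g x) =ᶠ[𝓝 p] fun _ => 0 := by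
        filter_upwards [hcl.isOpen_compl.mem_nhds hp] with q hq
        have := hsupp q hq
        simp only [Function.uncurry, mul_assoc, this, mul_zero]
      exact continuousAt_const.congr h0.symm
  · refine HasCompactSupport.intro' ((HasCompactSupport.isCompact hg).prod
      (HasCompactSupport.isCompact hf)) hcl fun p hp => ?_
    simp only [Function.uncurry, mul_assoc, hsupp p hp, mul_zero]

lemma IsSIO.exists_kernel {n P₀ M : ℕ} {ν γ : ℝ} (hγ : 0 < γ)
    {T Tstar : momentSchwartz n P₀ →ₗ[ℂ] 𝓢'(Rn n, ℂ)} (hT : IsSIO ν M γ T Tstar) :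
    (∃ K, HasPolyApprox M γ (n + ν + M + γ) K ∧ HasKernelFunction T K) ∧
      ∃ K, HasPolyApprox M γ (n + ν + M + γ) K ∧ HasKernelFunction Tstar K := by
  obtain ⟨K, hK, h1, h2⟩ := hT.kernel
  refine ⟨⟨K, hK.hasPolyApprox hγ, fun f hf hf' g hg hd => h1 f ⟨hf, hf'⟩ g hg hd⟩,
    ⟨fun x y => K y x, hK.hasPolyApprox_swap hγ, fun g hg hg' f hf hd => ?_⟩⟩
  have h := h2 f hf g ⟨hg, hg'⟩ hd.symm
  rw [integral_swap_of_disjoint_tsupport hK.contDiffOn.continuousOn hf hg' hd.symm] at h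
  refine h.trans ?_
  congr 1
  funext x
  congr 1
  funext y
  ring

/-- The vanishing moments of an atom at scale `r` gain the factor `r ^ (M + γ)` at a distance from
its support. -/
lemma exists_norm_integral_kernel_mul_atom_le {n M P : ℕ} {γ N : ℝ} (hγ : 0 < γ)
    {K : Rn n → Rn n → ℂ} (hK : HasPolyApprox M γ N K) (hP : M ≤ P) {φ : 𝓢(Rn n, ℂ)}
    (hφ : φ ∈ momentSchwartz n P) {ρ : ℝ} (hρ0 : 0 < ρ) (hρ : tsupport φ ⊆ Metric.closedBall 0 ρ) :
    ∃ C : ℝ, 0 ≤ C ∧ ∀ (r : ℝ) (hr : 0 < r) (x y : Rn n), 2 * ρ * r < ‖x - y‖ →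
      ‖∫ z, K x z * atom φ hr y z‖ ≤ C * r ^ (M + γ) * ‖x - y‖ ^ (-N) := by
  obtain ⟨C, hC0, hC⟩ := hK
  refine ⟨C * ρ ^ (M + γ) * ∫ w, ‖φ w‖, by positivity, fun r hr x y hxy => ?_⟩
  have hpos : 0 < ‖x - y‖ := lt_trans (by positivity) hxy
  obtain ⟨p, hp, hpK⟩ := hC x y (sub_ne_zero.1 (norm_pos_iff.1 hpos))
  have hmem := atom_mem_momentSchwartz hr y (momentSchwartz_anti hP hφ)
  have h0 := (mem_momentSchwartz_iff.1 hmem) p hp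
  by_cases hint : Integrable fun z => K x z * atom φ hr y z
  · have h1 : ∫ z, K x z * atom φ hr y z = ∫ z, (K x z - p z) * atom φ hr y z := by
      simp only [sub_mul]
      rw [integral_sub hint (integrable_polys_mul hp _), h0, sub_zero]
    rw [h1]
    have h2 : ∀ z, ‖(K x z - p z) * atom φ hr y z‖
        ≤ C * (ρ * r) ^ (M + γ) * ‖x - y‖ ^ (-N) * ‖atom φ hr y z‖ := by
      intro z
      rw [norm_mul]
      by_cases hz : z ∈ tsupport (atom φ hr y)
      · have h3 : ‖z - y‖ ≤ ρ * r := by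
          simpa [dist_eq_norm] using tsupport_atom_subset hr y hρ hz
        refine mul_le_mul_of_nonneg_right ((hpK z (by linarith)).trans ?_) (norm_nonneg _)
        gcongr
      · simp [image_eq_zero_of_notMem_tsupport hz]
    refine (norm_integral_le_of_norm_le ((atom φ hr y).integrable.norm.const_mul _)
      (Eventually.of_forall h2)).trans_eq ?_
    rw [integral_const_mul, integral_norm_atom, Real.mul_rpow hρ0.le hr.le]
    ring
  · rw [integral_undef hint, norm_zero]
    positivity

/-- `S φ_r` decays like `r ^ (M + γ) |z - y| ^ (-N)` away from the support of the atom. -/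
lemma exists_norm_apply_atom_le {n M P₀ P : ℕ} {γ N : ℝ} (hγ : 0 < γ)
    {K : Rn n → Rn n → ℂ} (hK : HasPolyApprox M γ N K)
    {S : momentSchwartz n P₀ →ₗ[ℂ] 𝓢'(Rn n, ℂ)} (hS : HasKernelFunction S K)
    (hP : M ≤ P) {φ : 𝓢(Rn n, ℂ)} (hφ : φ ∈ momentTest n P) {ρ : ℝ} (hρ0 : 0 < ρ)
    (hρ : tsupport φ ⊆ Metric.closedBall 0 ρ) :
    ∃ C : ℝ, 0 ≤ C ∧ ∀ (r : ℝ) (hr : 0 < r) (y : Rn n) (hm : atom φ hr y ∈ momentSchwartz n P₀),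
      ∀ g ∈ testFunctions n, (∀ z ∈ tsupport g, 2 * ρ * r < ‖z - y‖) →
        ∀ b : Rn n → ℝ, Integrable b → (∀ z, ‖z - y‖ ^ (-N) * ‖g z‖ ≤ b z) →
          ‖S ⟨atom φ hr y, hm⟩ g‖ ≤ C * r ^ (M + γ) * ∫ z, b z := by
  obtain ⟨C, hC0, hC⟩ := exists_norm_integral_kernel_mul_atom_le hγ hK hP hφ.1 hρ0 hρ
  refine ⟨C, hC0, fun r hr y hm g hg hgs b hb hgb => ?_⟩
  have hdisj : Disjoint (tsupport (atom φ hr y)) (tsupport g) := by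
    rw [Set.disjoint_left]
    intro z hz hz'
    have h3 : ‖z - y‖ ≤ ρ * r := by
      simpa [dist_eq_norm] using tsupport_atom_subset hr y hρ hz
    have := hgs z hz'
    have : 0 < ρ * r := by positivity
    linarith
  rw [hS _ hm (atom_mem_testFunctions hr y hφ.2) g hg hdisj, ← integral_const_mul]
  refine norm_integral_le_of_norm_le (hb.const_mul _) (Eventually.of_forall fun x => ?_)
  rw [integral_mul_const, norm_mul]
  by_cases hx : x ∈ tsupport g
  · calc _ ≤ (C * r ^ (M + γ) * ‖x - y‖ ^ (-N)) * ‖g x‖ :=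
          mul_le_mul_of_nonneg_right (hC r hr x y (hgs x hx)) (norm_nonneg _)
      _ = C * r ^ (M + γ) * (‖x - y‖ ^ (-N) * ‖g x‖) := by ring
      _ ≤ _ := mul_le_mul_of_nonneg_left (hgb x) (by positivity)
  · rw [image_eq_zero_of_notMem_tsupport hx, norm_zero, mul_zero]
    have h0 := hgb x
    rw [image_eq_zero_of_notMem_tsupport hx, norm_zero, mul_zero] at h0
    positivity

/-- Two atoms that are far apart compared with the larger scale `t`, where the one at the smaller
scale `r` has vanishing moments. -/
lemma exists_norm_apply_atom_atom_le_of_far {n M P₀ P : ℕ} {γ ν : ℝ} (hγ : 0 < γ)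
    (hN : 0 < n + ν + M + γ)
    {K : Rn n → Rn n → ℂ} (hK : HasPolyApprox M γ (n + ν + M + γ) K)
    {S : momentSchwartz n P₀ →ₗ[ℂ] 𝓢'(Rn n, ℂ)} (hS : HasKernelFunction S K)
    (hP : M ≤ P) {φ χ : 𝓢(Rn n, ℂ)} (hφ : φ ∈ momentTest n P) (hχ : χ ∈ testFunctions n) {ρ : ℝ}
    (hρ1 : 1 ≤ ρ) (hρ : tsupport φ ⊆ Metric.closedBall 0 ρ)
    (hρ' : tsupport χ ⊆ Metric.closedBall 0 ρ) :
    ∃ C : ℝ, 0 ≤ C ∧ ∀ (r t : ℝ) (hr : 0 < r) (ht : 0 < t) (x y : Rn n)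
      (hm : atom φ hr y ∈ momentSchwartz n P₀), r ≤ t → 4 * ρ * t ≤ ‖x - y‖ →
        ‖S ⟨atom φ hr y, hm⟩ (atom χ ht x)‖ ≤ C * (r / t) ^ (M + γ) * t ^ (-(n + ν))
          * (1 + ‖x - y‖ / t) ^ (-(n + ν + M + γ)) := by
  have hρ0 : 0 < ρ := by linarith
  obtain ⟨C, hC0, hC⟩ := exists_norm_apply_atom_le hγ hK hS hP hφ hρ0 hρ
  set N := n + ν + M + γ with hNdef
  refine ⟨C * 4 ^ N * ∫ w, ‖χ w‖, by positivity, fun r t hr ht x y hm hrt hxy => ?_⟩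
  set d := ‖x - y‖ with hd
  have hd0 : 0 < d := lt_of_lt_of_le (by positivity) hxy
  have hz : ∀ z ∈ tsupport (atom χ ht x), d - ρ * t ≤ ‖z - y‖ := by
    intro z hz
    have h3 : ‖z - x‖ ≤ ρ * t := by
      simpa [dist_eq_norm] using tsupport_atom_subset ht x hρ' hz
    have h4 : d ≤ ‖z - x‖ + ‖z - y‖ := by
      rw [hd, norm_sub_rev z x]
      simpa using norm_add_le (x - z) (z - y)
    linarith
  have hρt : 0 < ρ * t := by positivity
  have hρr : ρ * r ≤ ρ * t := mul_le_mul_of_nonneg_left hrt hρ0.le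
  have h := hC r hr y hm (atom χ ht x) (atom_mem_testFunctions ht x hχ)
    (fun z hz' => by have := hz z hz'; linarith)
    (fun z => (d / 2) ^ (-N) * ‖atom χ ht x z‖) ((atom χ ht x).integrable.norm.const_mul _)
    (fun z => by
      by_cases hz' : z ∈ tsupport (atom χ ht x)
      · refine mul_le_mul_of_nonneg_right ?_ (norm_nonneg _)
        exact Real.rpow_le_rpow_of_nonpos (by positivity) (by have := hz z hz'; linarith)
          (by linarith)
      · simp [image_eq_zero_of_notMem_tsupport hz'])
  rw [integral_const_mul, integral_norm_atom] at h
  refine h.trans ?_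
  have hdt : (1 + d / t) ≤ 2 * (d / t) := by
    have : 1 ≤ d / t := by
      rw [le_div_iff₀ ht]
      nlinarith
    linarith
  have key : r ^ (M + γ) * (d / 2) ^ (-N)
      ≤ 4 ^ N * ((r / t) ^ (M + γ) * t ^ (-(n + ν)) * (1 + d / t) ^ (-N)) := by
    have e1 : (2 * (d / t)) ^ (-N) ≤ (1 + d / t) ^ (-N) :=
      Real.rpow_le_rpow_of_nonpos (by positivity) hdt (by linarith)
    have e2 : (d / 2) ^ (-N) = 4 ^ N * (2 * (d / t)) ^ (-N) * t ^ (-N) := by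
      have : d / 2 = (4 : ℝ)⁻¹ * (2 * (d / t)) * t := by field_simp; norm_num
      rw [this, Real.mul_rpow (by positivity) ht.le, Real.mul_rpow (by positivity) (by positivity),
        Real.inv_rpow (by norm_num), Real.rpow_neg (by norm_num), inv_inv]
    have e3 : t ^ (-N) = t ^ (-(n + ν)) * (t ^ (M + γ))⁻¹ := by
      rw [← Real.rpow_neg ht.le, ← Real.rpow_add ht, hNdef]
      congr 1
      ring
    rw [e2, e3, Real.div_rpow hr.le ht.le]
    calc _ = 4 ^ N * (r ^ (M + γ) / t ^ (M + γ) * t ^ (-(n + ν)) * (2 * (d / t)) ^ (-N)) := by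
          ring
      _ ≤ _ := by gcongr
  calc C * r ^ (M + γ) * ((d / 2) ^ (-N) * ∫ w, ‖χ w‖)
      = C * (∫ w, ‖χ w‖) * (r ^ (M + γ) * (d / 2) ^ (-N)) := by ring
    _ ≤ C * (∫ w, ‖χ w‖) * (4 ^ N * ((r / t) ^ (M + γ) * t ^ (-(n + ν)) * (1 + d / t) ^ (-N))) := by
        refine mul_le_mul_of_nonneg_left key (by positivity)
    _ = _ := by ring

/-! ### Weak boundedness and the coarse scale -/

lemma const_smul_mem_testFunctions {n : ℕ} (c : ℂ) {f : 𝓢(Rn n, ℂ)} (hf : f ∈ testFunctions n) :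
    c • f ∈ testFunctions n :=
  HasCompactSupport.smul_left (f := fun _ : Rn n => c) hf

lemma const_smul_mem_momentTest {n P : ℕ} (c : ℂ) {f : 𝓢(Rn n, ℂ)} (hf : f ∈ momentTest n P) :
    c • f ∈ momentTest n P :=
  ⟨(momentSchwartz n P).smul_mem c hf.1, const_smul_mem_testFunctions c hf.2⟩

lemma norm_pderiv_const_smul_le {n : ℕ} (α : Fin n → ℕ) (c : ℂ) (f : 𝓢(Rn n, ℂ)) (x : Rn n) :
    ‖pderiv α (c • f : 𝓢(Rn n, ℂ)) x‖ ≤ ‖c‖ * ‖iteratedFDeriv ℝ (multiOrder α) f x‖ := by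
  refine (norm_pderiv_le _ _ _).trans_eq ?_
  have : ((c • f : 𝓢(Rn n, ℂ)) : Rn n → ℂ) = c • (f : Rn n → ℂ) := rfl
  rw [this, iteratedFDeriv_const_smul_apply (f.smooth _).contDiffAt, norm_smul]

lemma volume_real_ball {n : ℕ} (hn : 0 < n) (c : Rn n) {r : ℝ} (hr : 0 < r) :
    volume.real (Metric.ball c r) = r ^ n * volume.real (Metric.ball (0 : Rn n) 1) := by
  have : Nonempty (Fin n) := ⟨⟨0, hn⟩⟩
  rw [Measure.real, Measure.addHaar_ball_of_pos volume c hr, finrank_euclideanSpace_fin,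
    ENNReal.toReal_mul, ENNReal.toReal_ofReal (by positivity)]
  rfl

/-- The weak boundedness property of a single operator, for functions that are normalized up to
constant factors. -/
def IsWeaklyBounded {n P₀ : ℕ} (ν : ℝ) (m J : ℕ) (C : ℝ)
    (S : momentSchwartz n P₀ →ₗ[ℂ] 𝓢'(Rn n, ℂ)) : Prop :=
  ∀ (c : Rn n) (r : ℝ), 0 < r → ∀ (ψ : 𝓢(Rn n, ℂ)) (hψ : ψ ∈ momentSchwartz n P₀),
    ψ ∈ momentTest n m → ∀ φ ∈ testFunctions n,
      tsupport ψ ⊆ Metric.ball c r → tsupport φ ⊆ Metric.ball c r → ∀ A B : ℝ, 0 < A → 0 < B →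
      (∀ i ≤ J, ∀ x, ‖iteratedFDeriv ℝ i ψ x‖ ≤ A * (r⁻¹) ^ i) →
      (∀ i ≤ J, ∀ x, ‖iteratedFDeriv ℝ i φ x‖ ≤ B * (r⁻¹) ^ i) →
      ‖S ⟨ψ, hψ⟩ φ‖ ≤ C * A * B * r ^ (n - ν)

lemma SatisfiesWBP.exists_isWeaklyBounded {n P₀ : ℕ} (hn : 0 < n) {ν : ℝ}
    {T Tstar : momentSchwartz n P₀ →ₗ[ℂ] 𝓢'(Rn n, ℂ)} (h : SatisfiesWBP ν T Tstar) :
    ∃ (m J : ℕ) (C : ℝ), P₀ ≤ m ∧ 0 ≤ C ∧ IsWeaklyBounded ν m J C T ∧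
      IsWeaklyBounded ν m J C Tstar := by
  obtain ⟨m, J, hm, C, hC⟩ := h
  have hn' : (n : ℝ) ≠ 0 := by exact_mod_cast hn.ne'
  set V := volume.real (Metric.ball (0 : Rn n) 1) with hV
  have hV0 : 0 < V := by
    rw [hV]
    exact ENNReal.toReal_pos (Metric.measure_ball_pos volume _ one_pos).ne' measure_ball_lt_top.ne
  set q : ℝ := V ^ (1 / (n : ℝ)) with hq
  have hq0 : 0 < q := Real.rpow_pos_of_pos hV0 _
  set κ : ℝ := (max 1 q) ^ J with hκ
  have hκ0 : 0 < κ := by positivity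
  have hvol : ∀ (r : ℝ), 0 < r → ∀ (c : Rn n) (i : ℕ), i ≤ J →
      κ⁻¹ * (r⁻¹) ^ i ≤ volume.real (Metric.ball c r) ^ (-(i : ℝ) / n) := by
    intro r hr c i hi
    have e : volume.real (Metric.ball c r) ^ (-(i : ℝ) / n) = (q ^ i)⁻¹ * (r⁻¹) ^ i := by
      rw [volume_real_ball hn c hr, ← hV, Real.mul_rpow (by positivity) hV0.le, mul_comm]
      congr 1
      · rw [hq, ← Real.rpow_natCast, ← Real.rpow_mul hV0.le, ← Real.rpow_neg hV0.le]
        congr 1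
        ring
      · rw [← Real.rpow_natCast, ← Real.rpow_mul hr.le, ← Real.rpow_natCast,
          Real.inv_rpow hr.le, ← Real.rpow_neg hr.le]
        congr 1
        field_simp
    rw [e]
    refine mul_le_mul_of_nonneg_right (inv_anti₀ (by positivity) ?_) (by positivity)
    calc q ^ i ≤ (max 1 q) ^ i := pow_le_pow_left₀ hq0.le (le_max_right _ _) _
      _ ≤ κ := pow_le_pow_right₀ (le_max_left _ _) hi
  refine ⟨m, J, max C 0 * κ ^ 2 * V ^ (1 - ν / n), hm, by positivity, ?_⟩
  rw [IsWeaklyBounded, IsWeaklyBounded]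
  simp only [← forall_and]
  intro c r hr ψ hψ hψm φ hφ hsψ hsφ A B hA hB hdψ hdφ
  have hsub : ∀ (a : ℂ) (f : 𝓢(Rn n, ℂ)), tsupport f ⊆ Metric.ball c r →
      tsupport (a • f : 𝓢(Rn n, ℂ)) ⊆ Metric.ball c r := fun a f hf =>
    (tsupport_smul_subset_right (fun _ : Rn n => a) f).trans hf
  have hnorm : ∀ (f : 𝓢(Rn n, ℂ)) (D : ℝ), 0 < D →
      (∀ i ≤ J, ∀ x, ‖iteratedFDeriv ℝ i f x‖ ≤ D * (r⁻¹) ^ i) →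
      ∀ α : Fin n → ℕ, multiOrder α ≤ J → ∀ x,
        ‖pderiv α (((D * κ : ℝ) : ℂ)⁻¹ • f : 𝓢(Rn n, ℂ)) x‖
          ≤ volume.real (Metric.ball c r) ^ (-(multiOrder α : ℝ) / n) := by
    intro f D hD hf α hα x
    refine (norm_pderiv_const_smul_le _ _ _ _).trans (le_trans ?_ (hvol r hr c _ hα))
    rw [norm_inv, Complex.norm_real, Real.norm_eq_abs, abs_of_pos (by positivity)]
    calc (D * κ)⁻¹ * ‖iteratedFDeriv ℝ (multiOrder α) f x‖
        ≤ (D * κ)⁻¹ * (D * (r⁻¹) ^ multiOrder α) := by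
          gcongr
          exact hf _ hα x
      _ = κ⁻¹ * (r⁻¹) ^ multiOrder α := by field_simp
  set a : ℂ := ((A * κ : ℝ) : ℂ)⁻¹ with ha
  set b : ℂ := ((B * κ : ℝ) : ℂ)⁻¹ with hb
  have key := hC c r hr (a • ψ) (const_smul_mem_momentTest a hψm) (b • φ)
    (const_smul_mem_testFunctions b hφ) (hsub _ _ hsψ) (hsub _ _ hsφ)
    (fun α hα x => ⟨hnorm ψ A hA hdψ α hα x, hnorm φ B hB hdφ α hα x⟩)
  have hlin : ∀ S : momentSchwartz n P₀ →ₗ[ℂ] 𝓢'(Rn n, ℂ),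
      S (momentTest.toSchwartz hm (const_smul_mem_momentTest a hψm)) (b • φ)
        = a * b * S ⟨ψ, hψ⟩ φ := by
    intro S
    have : momentTest.toSchwartz hm (const_smul_mem_momentTest a hψm)
        = a • (⟨ψ, hψ⟩ : momentSchwartz n P₀) := rfl
    rw [this, map_smul, map_smul]
    change b * (a * S ⟨ψ, hψ⟩ φ) = _
    ring
  have hab : ‖a * b‖ = (A * B * κ ^ 2)⁻¹ := by
    rw [norm_mul, ha, hb, norm_inv, norm_inv, Complex.norm_real, Complex.norm_real,
      Real.norm_eq_abs, Real.norm_eq_abs, abs_of_pos (by positivity), abs_of_pos (by positivity),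
      ← mul_inv]
    ring
  rw [hlin, hlin, norm_mul _ (T _ φ), norm_mul _ (Tstar _ φ), hab, ← mul_add, inv_mul_le_iff₀ (by positivity)] at key
  suffices hkey : ‖T ⟨ψ, hψ⟩ φ‖ + ‖Tstar ⟨ψ, hψ⟩ φ‖
      ≤ max C 0 * κ ^ 2 * V ^ (1 - ν / n) * A * B * r ^ (n - ν) from
    ⟨(le_add_of_nonneg_right (norm_nonneg _)).trans hkey,
      (le_add_of_nonneg_left (norm_nonneg _)).trans hkey⟩
  refine key.trans ?_
  have hvr : volume.real (Metric.ball c r) ^ (1 - ν / n) = r ^ (n - ν) * V ^ (1 - ν / n) := by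
    rw [volume_real_ball hn c hr, ← hV, Real.mul_rpow (by positivity) hV0.le,
      ← Real.rpow_natCast, ← Real.rpow_mul hr.le]
    congr 2
    field_simp
  rw [hvr]
  calc A * B * κ ^ 2 * (C * (r ^ (n - ν) * V ^ (1 - ν / n)))
      ≤ A * B * κ ^ 2 * (max C 0 * (r ^ (n - ν) * V ^ (1 - ν / n))) := by
        gcongr
        exact le_max_left _ _
    _ = _ := by ring

/-- Derivative bounds for an atom, measured at the scale `c r` with `c ≥ 1`. -/
lemma exists_bound_iteratedFDeriv_atom {n : ℕ} (φ : 𝓢(Rn n, ℂ)) (J : ℕ) {c : ℝ} (hc : 1 ≤ c) :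
    ∃ C : ℝ, 0 < C ∧ ∀ (r : ℝ) (hr : 0 < r) (y : Rn n), ∀ i ≤ J, ∀ z,
      ‖iteratedFDeriv ℝ i (atom φ hr y) z‖ ≤ (C * (r ^ n)⁻¹) * ((c * r)⁻¹) ^ i := by
  obtain ⟨C, hC0, hC⟩ := exists_bound_iteratedFDeriv_le φ J
  have hc0 : 0 < c := by linarith
  refine ⟨C * c ^ J, by positivity, fun r hr y i hi z => ?_⟩
  rw [norm_iteratedFDeriv_atom]
  calc (r ^ n)⁻¹ * r⁻¹ ^ i * ‖iteratedFDeriv ℝ i φ (r⁻¹ • (y - z))‖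
      ≤ (r ^ n)⁻¹ * r⁻¹ ^ i * C := by
        gcongr
        exact hC i hi _
    _ = C * c ^ i * (r ^ n)⁻¹ * ((c * r)⁻¹) ^ i := by
        rw [mul_inv, mul_pow]
        have : c ^ i * (c⁻¹) ^ i = 1 := by rw [← mul_pow, mul_inv_cancel₀ hc0.ne', one_pow]
        linear_combination (-(C * (r ^ n)⁻¹ * r⁻¹ ^ i)) * this
    _ ≤ _ := by
        gcongr

/-- The pairing of two atoms at the same scale. -/
lemma exists_norm_apply_atom_atom_le {n M P₀ P : ℕ} {γ ν : ℝ} (hγ : 0 < γ)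
    (hN : 0 < n + ν + M + γ) {Tstar : momentSchwartz n P₀ →ₗ[ℂ] 𝓢'(Rn n, ℂ)}
    {K : Rn n → Rn n → ℂ} (hK : HasPolyApprox M γ (n + ν + M + γ) K)
    (hS : HasKernelFunction Tstar K) {m J : ℕ} {CW : ℝ} (hCW : 0 ≤ CW)
    (hW : IsWeaklyBounded ν m J CW Tstar)
    (hP : M ≤ P) (hmP : m ≤ P) {ψ φ : 𝓢(Rn n, ℂ)} (hψ : ψ ∈ momentTest n P)
    (hφ : φ ∈ testFunctions n) :
    ∃ C : ℝ, 0 ≤ C ∧ ∀ (t : ℝ) (ht : 0 < t) (x y : Rn n)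
      (hx : atom ψ ht x ∈ momentSchwartz n P₀),
        ‖Tstar ⟨atom ψ ht x, hx⟩ (atom φ ht y)‖
          ≤ C * t ^ (-(n + ν)) * (1 + ‖x - y‖ / t) ^ (-(n + ν + M + γ)) := by
  obtain ⟨ρ₁, hρ₁1, hρ₁⟩ := exists_tsupport_subset_closedBall hψ.2
  obtain ⟨ρ₂, hρ₂1, hρ₂⟩ := exists_tsupport_subset_closedBall hφ
  set ρ := max ρ₁ ρ₂ with hρdef
  have hρ1 : 1 ≤ ρ := hρ₁1.trans (le_max_left _ _)
  have hψρ : tsupport ψ ⊆ Metric.closedBall 0 ρ :=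
    hρ₁.trans (Metric.closedBall_subset_closedBall (le_max_left _ _))
  have hφρ : tsupport φ ⊆ Metric.closedBall 0 ρ :=
    hρ₂.trans (Metric.closedBall_subset_closedBall (le_max_right _ _))
  obtain ⟨C₁, hC₁0, hC₁⟩ := exists_norm_apply_atom_atom_le_of_far hγ hN hK hS hP hψ hφ hρ1 hψρ hφρ
  obtain ⟨A, hA0, hA⟩ := exists_bound_iteratedFDeriv_atom ψ J (c := 6 * ρ) (by linarith)
  obtain ⟨B, hB0, hB⟩ := exists_bound_iteratedFDeriv_atom φ J (c := 6 * ρ) (by linarith)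
  set N := n + ν + M + γ with hNdef
  refine ⟨C₁ + CW * A * B * (6 * ρ) ^ (n - ν) * (1 + 4 * ρ) ^ N, by positivity,
    fun t ht x y hx => ?_⟩
  have hw0 : 0 < (1 + ‖x - y‖ / t) ^ (-N) := by positivity
  rcases le_total (4 * ρ * t) ‖x - y‖ with hfar | hnear
  · have h1 := hC₁ t t ht ht y x hx le_rfl (by rwa [norm_sub_rev])
    rw [div_self ht.ne', Real.one_rpow, mul_one, norm_sub_rev] at h1
    refine h1.trans ?_
    rw [mul_assoc, mul_assoc]
    refine mul_le_mul_of_nonneg_right ?_ (by positivity)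
    exact le_add_of_nonneg_right (by positivity)
  · have hρt : 0 < ρ * t := by positivity
    have h1 := hW x (6 * ρ * t) (by positivity) (atom ψ ht x) hx
      (atom_mem_momentTest ht x ⟨momentSchwartz_anti hmP hψ.1, hψ.2⟩) (atom φ ht y)
      (atom_mem_testFunctions ht y hφ)
      ((tsupport_atom_subset ht x hψρ).trans (Metric.closedBall_subset_ball (by linarith)))
      ((tsupport_atom_subset ht y hφρ).trans fun z hz => by
        rw [mem_closedBall_iff_norm] at hz
        rw [mem_ball_iff_norm]
        have : ‖z - x‖ ≤ ‖z - y‖ + ‖x - y‖ := by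
          rw [norm_sub_rev x y]
          simpa using norm_add_le (z - y) (y - x)
        linarith)
      (A * (t ^ n)⁻¹) (B * (t ^ n)⁻¹) (by positivity) (by positivity) (hA t ht x) (hB t ht y)
    refine h1.trans ?_
    have e1 : (t ^ n)⁻¹ * (t ^ n)⁻¹ * t ^ (n - ν) = t ^ (-(n + ν)) := by
      rw [← Real.rpow_natCast, ← Real.rpow_neg ht.le, ← Real.rpow_add ht, ← Real.rpow_add ht]
      congr 1
      ring
    have e2 : 1 ≤ (1 + 4 * ρ) ^ N * (1 + ‖x - y‖ / t) ^ (-N) := by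
      rw [Real.rpow_neg (by positivity), ← div_eq_mul_inv, one_le_div (by positivity)]
      refine Real.rpow_le_rpow (by positivity) ?_ hN.le
      have : ‖x - y‖ / t ≤ 4 * ρ := by rwa [div_le_iff₀ ht]
      linarith
    rw [Real.mul_rpow (by positivity) ht.le]
    calc CW * (A * (t ^ n)⁻¹) * (B * (t ^ n)⁻¹) * ((6 * ρ) ^ (n - ν) * t ^ (n - ν))
        = CW * A * B * (6 * ρ) ^ (n - ν) * ((t ^ n)⁻¹ * (t ^ n)⁻¹ * t ^ (n - ν)) * 1 := by ring
      _ ≤ CW * A * B * (6 * ρ) ^ (n - ν) * ((t ^ n)⁻¹ * (t ^ n)⁻¹ * t ^ (n - ν)) *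
          ((1 + 4 * ρ) ^ N * (1 + ‖x - y‖ / t) ^ (-N)) := by gcongr
      _ = CW * A * B * (6 * ρ) ^ (n - ν) * (1 + 4 * ρ) ^ N * t ^ (-(n + ν))
          * (1 + ‖x - y‖ / t) ^ (-N) := by rw [e1]; ring
      _ ≤ _ := by
        rw [mul_assoc _ (t ^ (-(n + ν))), mul_assoc _ (t ^ (-(n + ν)))]
        refine mul_le_mul_of_nonneg_right ?_ (by positivity)
        exact le_add_of_nonneg_left hC₁0

/-! ### Test functions with prescribed moments -/

lemma momentTest_anti {n P Q : ℕ} (h : P ≤ Q) : momentTest n Q ⊆ momentTest n P :=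
  fun _ hf => ⟨momentSchwartz_anti h hf.1, hf.2⟩

/-- Coefficients at the nodes `1, …, J + 1` that kill all powers `j = 1, …, J` (Vandermonde). -/
lemma exists_sum_mul_pow_eq (J : ℕ) :
    ∃ c : Fin (J + 1) → ℝ, ∀ j ≤ J, ∑ i, c i * ((i : ℕ) + 1 : ℝ) ^ j = if j = 0 then 1 else 0 := by
  set V : Matrix (Fin (J + 1)) (Fin (J + 1)) ℝ := Matrix.vandermonde fun i => ((i : ℕ) + 1 : ℝ) with hV
  have hdet : IsUnit V.det := by
    rw [isUnit_iff_ne_zero, hV, Matrix.det_vandermonde_ne_zero_iff]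
    intro i j hij
    have : ((i : ℕ) : ℝ) = (j : ℕ) := by simpa using hij
    exact Fin.ext (by exact_mod_cast this)
  refine ⟨Matrix.vecMul (Pi.single 0 1) V⁻¹, fun j hj => ?_⟩
  have h : Matrix.vecMul (Matrix.vecMul (Pi.single 0 1) V⁻¹) V = Pi.single 0 1 := by
    rw [Matrix.vecMul_vecMul, Matrix.nonsing_inv_mul V hdet, Matrix.vecMul_one]
  have h1 := congrFun h ⟨j, Nat.lt_succ_of_le hj⟩
  simp only [Matrix.vecMul, dotProduct, hV, Matrix.vandermonde_apply] at h1 ⊢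
  rw [h1]
  by_cases hj0 : j = 0
  · subst hj0; simp
  · rw [if_neg hj0, Pi.single_eq_of_ne]
    intro h
    exact hj0 (congrArg Fin.val h)

/-- A smooth function equal to `1` for `|x| ≤ a` and supported in `|x| ≤ b`. -/
lemma exists_bump {n : ℕ} {a b : ℝ} (ha : 0 < a) (hab : a < b) :
    ∃ χ : 𝓢(Rn n, ℂ), tsupport χ ⊆ Metric.closedBall 0 b ∧ (∀ x, ‖x‖ ≤ a → χ x = 1) ∧
      (∀ x, ‖1 - χ x‖ ≤ 1) ∧ ∫ x, χ x ≠ 0 := by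
  let f : ContDiffBump (0 : Rn n) := ⟨a, b, ha, hab⟩
  have hc : HasCompactSupport fun x => (f x : ℂ) :=
    f.hasCompactSupport.comp_left (g := ((↑) : ℝ → ℂ)) Complex.ofReal_zero
  refine ⟨hc.toSchwartzMap (Complex.ofRealCLM.contDiff.comp f.contDiff), ?_, ?_, ?_, ?_⟩
  · have : tsupport (f : Rn n → ℝ) = Metric.closedBall 0 b := f.tsupport_eq
    rw [← this]
    refine closure_mono fun x hx => ?_
    rw [Function.mem_support] at hx ⊢
    intro h
    apply hx
    change ((f x : ℝ) : ℂ) = 0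
    rw [h, Complex.ofReal_zero]
  · intro x hx
    change ((f x : ℝ) : ℂ) = 1
    rw [f.one_of_mem_closedBall (by simpa using hx), Complex.ofReal_one]
  · intro x
    change ‖1 - ((f x : ℝ) : ℂ)‖ ≤ 1
    rw [← Complex.ofReal_one, ← Complex.ofReal_sub, Complex.norm_real, Real.norm_eq_abs,
      abs_of_nonneg (by linarith [f.le_one (x := x)])]
    linarith [f.nonneg (x := x)]
  · change ∫ x, ((f x : ℝ) : ℂ) ≠ 0
    rw [integral_complex_ofReal]
    exact_mod_cast (f.integral_pos (μ := volume)).ne'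

lemma integral_monom_mul_atom_zero {n : ℕ} (φ : 𝓢(Rn n, ℂ)) {r : ℝ} (hr : 0 < r) (α : Fin n → ℕ) :
    ∫ x, (monom α x : ℂ) * atom φ hr 0 x
      = (r : ℂ) ^ multiOrder α * ((-1) ^ multiOrder α * ∫ x, (monom α x : ℂ) * φ x) := by
  rw [integral_mul_atom, ← mul_assoc, ← integral_const_mul]
  congr 1
  funext w
  rw [zero_sub, ← neg_smul, monom_smul]
  push_cast
  rw [neg_pow]
  ring

lemma sum_atom_spec {n J : ℕ} (φ : 𝓢(Rn n, ℂ)) (a : Fin (J + 1) → ℝ) :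
    ∀ α : Fin n → ℕ, ∫ x, (monom α x : ℂ) *
        (∑ i : Fin (J + 1), (a i : ℂ) •
          atom φ (r := ((i : ℕ) + 1 : ℝ)) (by positivity) 0 : 𝓢(Rn n, ℂ)) x
      = (((∑ i, a i * ((i : ℕ) + 1 : ℝ) ^ multiOrder α : ℝ)) : ℂ)
        * ((-1) ^ multiOrder α * ∫ x, (monom α x : ℂ) * φ x) := by
  intro α
  have h : ∀ x, (monom α x : ℂ) * (∑ i : Fin (J + 1), (a i : ℂ) •
          atom φ (r := ((i : ℕ) + 1 : ℝ)) (by positivity) 0 : 𝓢(Rn n, ℂ)) x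
      = ∑ i : Fin (J + 1), (a i : ℂ) *
          ((monom α x : ℂ) * atom φ (r := ((i : ℕ) + 1 : ℝ)) (by positivity) 0 x) := by
    intro x
    rw [sum_apply, Finset.mul_sum]
    refine Finset.sum_congr rfl fun i _ => ?_
    rw [smul_apply, smul_eq_mul]
    ring
  simp_rw [h]
  rw [integral_finsetSum _ fun i _ => (integrable_monom_mul α _).const_mul _]
  push_cast
  rw [Finset.sum_mul]
  refine Finset.sum_congr rfl fun i _ => ?_
  rw [integral_const_mul, integral_monom_mul_atom_zero]
  push_cast
  ring

lemma sum_mem_testFunctions {n : ℕ} {ι : Type*} (s : Finset ι) (f : ι → 𝓢(Rn n, ℂ))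
    (h : ∀ i ∈ s, f i ∈ testFunctions n) : ∑ i ∈ s, f i ∈ testFunctions n := by
  classical
  induction s using Finset.induction_on with
  | empty => exact HasCompactSupport.zero
  | insert i s hi ih =>
    rw [Finset.sum_insert hi]
    exact HasCompactSupport.add (h i (Finset.mem_insert_self _ _))
      (ih fun j hj => h j (Finset.mem_insert_of_mem hj))

/-- Cut-off functions with vanishing moments exist, so that `VanishesOnMonom` is not vacuous. -/
lemma exists_cutoff {n : ℕ} (hn : 0 < n) (Q : ℕ) :
    ∃ η ∈ momentTest n Q, ∀ x ∈ Metric.ball (0 : Rn n) 1, η x = 1 := by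
  obtain ⟨χ, hχ, hχ1, -, -⟩ := exists_bump (n := n) one_pos (one_lt_two)
  have hχt : χ ∈ testFunctions n := hasCompactSupport_of_subset_closedBall hχ
  obtain ⟨c, hc⟩ := exists_sum_mul_pow_eq (n + Q)
  refine ⟨∑ i : Fin (n + Q + 1), ((c i * ((i : ℕ) + 1 : ℝ) ^ n : ℝ) : ℂ) •
      atom χ (r := ((i : ℕ) + 1 : ℝ)) (by positivity) 0, ⟨?_, ?_⟩, ?_⟩
  · intro α hα
    rw [sum_atom_spec]
    have := hc (n + multiOrder α) (by omega)
    rw [if_neg (by omega)] at this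
    simp only [mul_assoc, ← pow_add]
    rw [this, Complex.ofReal_zero, zero_mul]
  · exact sum_mem_testFunctions _ _ fun i _ =>
      const_smul_mem_testFunctions _ (atom_mem_testFunctions _ _ hχt)
  · intro x hx
    have h1 : ∀ i : Fin (n + Q + 1), (((c i * ((i : ℕ) + 1 : ℝ) ^ n : ℝ) : ℂ) •
        atom χ (r := ((i : ℕ) + 1 : ℝ)) (by positivity) 0 : 𝓢(Rn n, ℂ)) x = (c i : ℂ) := by
      intro i
      have hi : (0 : ℝ) < (i : ℕ) + 1 := by positivity
      rw [smul_apply, smul_eq_mul, atom_apply, hχ1, mul_one]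
      · have : ((((i : ℕ) + 1 : ℝ) : ℂ)) ^ n ≠ 0 := pow_ne_zero _ (by exact_mod_cast hi.ne')
        push_cast at this ⊢
        field_simp
      · rw [zero_sub, smul_neg, norm_neg, norm_smul, norm_inv, Real.norm_eq_abs, abs_of_pos hi]
        rw [mem_ball_zero_iff] at hx
        rw [inv_mul_le_iff₀ hi]
        have : (0 : ℝ) ≤ (i : ℕ) := Nat.cast_nonneg _
        linarith
    rw [sum_apply]
    simp_rw [h1]
    have := hc 0 (Nat.zero_le _)
    simp only [pow_zero, mul_one, if_pos] at this
    exact_mod_cast this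

/-- An approximate identity all of whose moments of order `1, …, P` vanish. -/
lemma exists_approximate_identity (n P : ℕ) :
    ∃ φ ∈ testFunctions n, ∫ x, φ x = 1 ∧
      ∀ α : Fin n → ℕ, multiOrder α ≠ 0 → multiOrder α ≤ P → ∫ x, (monom α x : ℂ) * φ x = 0 := by
  obtain ⟨χ, hχ, -, -, hχ0⟩ := exists_bump (n := n) one_pos (one_lt_two)
  have hχt : χ ∈ testFunctions n := hasCompactSupport_of_subset_closedBall hχ
  obtain ⟨c, hc⟩ := exists_sum_mul_pow_eq P
  set φ : 𝓢(Rn n, ℂ) := ∑ i : Fin (P + 1), (c i : ℂ) •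
    atom χ (r := ((i : ℕ) + 1 : ℝ)) (by positivity) 0 with hφ
  have hφt : φ ∈ testFunctions n := sum_mem_testFunctions _ _ fun i _ =>
    const_smul_mem_testFunctions _ (atom_mem_testFunctions _ _ hχt)
  have hmom := sum_atom_spec χ c
  have hint : ∫ x, φ x = ∫ x, χ x := by
    have h0 := hmom 0
    have hm0 : multiOrder (0 : Fin n → ℕ) = 0 := by simp [multiOrder]
    rw [hm0, hc 0 (Nat.zero_le _)] at h0
    simpa [monom, hφ] using h0
  refine ⟨(∫ x, χ x)⁻¹ • φ, const_smul_mem_testFunctions _ hφt, ?_, fun α h0 h1 => ?_⟩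
  · simp only [smul_apply, smul_eq_mul]
    rw [integral_const_mul, hint, inv_mul_cancel₀ hχ0]
  · simp only [smul_apply, smul_eq_mul, mul_left_comm _ ((∫ x, χ x)⁻¹)]
    rw [integral_const_mul, hmom α, hc _ h1, if_neg h0]
    simp

/-- The difference of two consecutive dyadic mollifiers is an atom with vanishing moments. -/
lemma exists_dyadic_difference {n P : ℕ} {φ : 𝓢(Rn n, ℂ)} (hφt : φ ∈ testFunctions n)
    (hφ : ∀ α : Fin n → ℕ, multiOrder α ≠ 0 → multiOrder α ≤ P → ∫ x, (monom α x : ℂ) * φ x = 0) :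
    ∃ χ ∈ momentTest n P, ∀ (r : ℝ) (hr : 0 < r) (y : Rn n),
      atom φ (half_pos hr) y - atom φ hr y = atom χ hr y := by
  refine ⟨atom (atom φ one_pos 0) (half_pos one_pos) 0 - φ, ⟨?_, ?_⟩, fun r hr y => ?_⟩
  · intro α hα
    simp only [sub_apply, mul_sub]
    rw [integral_sub (integrable_monom_mul α _) (integrable_monom_mul α _),
      integral_monom_mul_atom_zero, integral_monom_mul_atom_zero]
    by_cases h0 : multiOrder α = 0
    · simp [h0]
    · simp [hφ α h0 hα]
  · exact HasCompactSupport.sub (atom_mem_testFunctions _ _ (atom_mem_testFunctions _ _ hφt)) hφt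
  · ext z
    simp only [sub_apply, atom_apply]
    have hrc : (r : ℂ) ≠ 0 := by exact_mod_cast hr.ne'
    have e : (1 : ℝ)⁻¹ • ((0 : Rn n) - (1 / 2 : ℝ)⁻¹ • (0 - r⁻¹ • (y - z)))
        = (r / 2)⁻¹ • (y - z) := by
      rw [inv_one, one_smul, zero_sub, zero_sub, smul_neg, neg_neg, smul_smul]
      congr 1
      field_simp
    rw [e]
    push_cast
    rw [div_pow, div_pow, one_pow]
    field_simp

/-! ### The fine scales: cancellation against Taylor polynomials -/

section ScaledTaylor

variable {n J L : ℕ} {f : Rn n → ℂ} {t A : ℝ}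

lemma norm_iteratedFDeriv_scaled_remainder_le (hf : ContDiff ℝ ∞ f) (ht : 0 < t) (hA0 : 0 ≤ A)
    (hL : L + 1 ≤ J) (hA : ∀ i ≤ J, ∀ x, ‖iteratedFDeriv ℝ i f x‖ ≤ A * (t⁻¹) ^ i)
    {c r : ℝ} (hc : 1 ≤ c) (hr : 0 < r) (hrt : r ≤ t) {a v : Rn n} (hv : ‖v‖ ≤ c * r)
    {l : ℕ} (hl : l ≤ J) :
    ‖iteratedFDeriv ℝ l (fun w => f (a + w) - taylorPoly L f a w) v‖
      ≤ A * c ^ (L + 1) * (r / t) ^ (L + 1) * (r⁻¹) ^ l := by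
  have h1 := norm_iteratedFDeriv_taylor_remainder_le l L f (A * (t⁻¹) ^ (max (L + 1) l)) hf
    (hA _ (max_le hL hl)) a v
  refine h1.trans ?_
  have e : max (L + 1) l = (L + 1 - l) + l := by omega
  have e1 : (t⁻¹) ^ (max (L + 1) l) * r ^ (L + 1 - l) = (r / t) ^ (max (L + 1) l) * (r⁻¹) ^ l := by
    rw [div_pow, e, pow_add r, inv_pow, inv_pow]
    field_simp
  have e2 : (r / t) ^ (max (L + 1) l) ≤ (r / t) ^ (L + 1) :=
    pow_le_pow_of_le_one (by positivity) ((div_le_one ht).2 hrt) (le_max_left _ _)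
  have e3 : c ^ (L + 1 - l) ≤ c ^ (L + 1) := pow_le_pow_right₀ hc (Nat.sub_le _ _)
  calc A * (t⁻¹) ^ (max (L + 1) l) * ‖v‖ ^ (L + 1 - l)
      ≤ A * (t⁻¹) ^ (max (L + 1) l) * (c * r) ^ (L + 1 - l) := by gcongr
    _ = A * c ^ (L + 1 - l) * ((t⁻¹) ^ (max (L + 1) l) * r ^ (L + 1 - l)) := by
        rw [mul_pow]; ring
    _ = A * c ^ (L + 1 - l) * ((r / t) ^ (max (L + 1) l) * (r⁻¹) ^ l) := by rw [e1]
    _ ≤ A * c ^ (L + 1) * ((r / t) ^ (L + 1) * (r⁻¹) ^ l) := by gcongr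
    _ = _ := by ring

lemma norm_scaled_remainder_le (hf : ContDiff ℝ ∞ f)
    (hL : L + 1 ≤ J) (hA : ∀ i ≤ J, ∀ x, ‖iteratedFDeriv ℝ i f x‖ ≤ A * (t⁻¹) ^ i) (a v : Rn n) :
    ‖f (a + v) - taylorPoly L f a v‖ ≤ A * (‖v‖ / t) ^ (L + 1) := by
  have h1 := norm_iteratedFDeriv_taylor_remainder_le 0 L f (A * (t⁻¹) ^ (L + 1)) hf
    (fun x => by rw [Nat.max_zero]; exact hA _ hL x) a v
  rw [norm_iteratedFDeriv_zero] at h1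
  refine h1.trans_eq ?_
  rw [div_eq_mul_inv, mul_pow, Nat.sub_zero]
  ring

lemma norm_scaled_taylorPoly_le (ht : 0 < t) (hA0 : 0 ≤ A)
    (hL : L + 1 ≤ J) (hA : ∀ i ≤ J, ∀ x, ‖iteratedFDeriv ℝ i f x‖ ≤ A * (t⁻¹) ^ i) (a : Rn n)
    {v : Rn n} (hv : t ≤ ‖v‖) :
    ‖taylorPoly L f a v‖ ≤ (L + 1) * (A * (‖v‖ / t) ^ L) := by
  have h1 : 1 ≤ ‖v‖ / t := (one_le_div ht).2 hv
  refine (norm_sum_le _ _).trans ?_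
  have : ∀ i ∈ Finset.range (L + 1),
      ‖((i.factorial : ℝ)⁻¹) • iteratedFDeriv ℝ i f a fun _ => v‖ ≤ A * (‖v‖ / t) ^ L := by
    intro i hi
    have hi' : i ≤ L := Nat.lt_succ_iff.1 (Finset.mem_range.1 hi)
    have hfac : ‖((i.factorial : ℝ)⁻¹)‖ ≤ 1 := by
      rw [norm_inv, Real.norm_natCast]
      exact inv_le_one_of_one_le₀ (by exact_mod_cast Nat.factorial_pos i)
    have h2 := (iteratedFDeriv ℝ i f a).le_opNorm fun _ => v
    simp only [Finset.prod_const, Finset.card_univ, Fintype.card_fin] at h2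
    rw [norm_smul]
    calc _ ≤ 1 * (A * (t⁻¹) ^ i * ‖v‖ ^ i) := by
          refine mul_le_mul hfac (h2.trans ?_) (norm_nonneg _) zero_le_one
          gcongr
          exact hA i (by omega) a
      _ = A * (‖v‖ / t) ^ i := by rw [div_eq_mul_inv, mul_pow]; ring
      _ ≤ _ := by gcongr
  refine (Finset.sum_le_card_nsmul _ _ _ this).trans_eq ?_
  simp

end ScaledTaylor

/-- A rescaled cut-off times a function with derivative bounds on the support of the cut-off. -/
lemma norm_iteratedFDeriv_cutoff_mul_le {n J : ℕ} {χ : 𝓢(Rn n, ℂ)} {c A B r : ℝ} (hr : 0 < r)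
    (hχ : tsupport χ ⊆ Metric.closedBall 0 c) (hA : ∀ i ≤ J, ∀ x, ‖iteratedFDeriv ℝ i χ x‖ ≤ A)
    {F : Rn n → ℂ} (hF : ContDiff ℝ ∞ F) (hA0 : 0 ≤ A) (hB0 : 0 ≤ B)
    (hB : ∀ i ≤ J, ∀ w, ‖w‖ ≤ c * r → ‖iteratedFDeriv ℝ i F w‖ ≤ B * (r⁻¹) ^ i)
    {i : ℕ} (hi : i ≤ J) (w : Rn n) :
    ‖iteratedFDeriv ℝ i (fun w => χ (r⁻¹ • w) * F w) w‖ ≤ 2 ^ J * A * B * (r⁻¹) ^ i := by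
  by_cases hw : ‖w‖ ≤ c * r
  · have hχr : ContDiff ℝ ∞ fun w => χ (r⁻¹ • w) := (χ.smooth ⊤).comp (contDiff_const_smul _)
    refine (norm_iteratedFDeriv_mul_le hχr hF w (n := i) (by exact_mod_cast le_top)).trans ?_
    have h1 : ∀ j ∈ Finset.range (i + 1), (i.choose j : ℝ) *
        ‖iteratedFDeriv ℝ j (fun w => χ (r⁻¹ • w)) w‖ * ‖iteratedFDeriv ℝ (i - j) F w‖
          ≤ (i.choose j : ℝ) * (A * B * (r⁻¹) ^ i) := by
      intro j hj
      have hj' : j ≤ i := Nat.lt_succ_iff.1 (Finset.mem_range.1 hj)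
      rw [iteratedFDeriv_comp_const_smul (r⁻¹) (χ.smooth j), norm_smul, norm_pow, norm_inv,
        Real.norm_eq_abs, abs_of_pos hr, mul_assoc]
      refine mul_le_mul_of_nonneg_left ?_ (Nat.cast_nonneg _)
      calc (r⁻¹) ^ j * ‖iteratedFDeriv ℝ j χ (r⁻¹ • w)‖ * ‖iteratedFDeriv ℝ (i - j) F w‖
          ≤ (r⁻¹) ^ j * A * (B * (r⁻¹) ^ (i - j)) := by
            gcongr
            · exact hA j (by omega) _
            · exact hB _ (by omega) w hw
        _ = A * B * ((r⁻¹) ^ j * (r⁻¹) ^ (i - j)) := by ring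
        _ = _ := by rw [← pow_add, Nat.add_sub_cancel' hj']
    refine (Finset.sum_le_sum h1).trans ?_
    rw [← Finset.sum_mul]
    have h2 : ∑ j ∈ Finset.range (i + 1), (i.choose j : ℝ) = 2 ^ i := by
      exact_mod_cast Nat.sum_range_choose i
    rw [h2]
    calc (2 : ℝ) ^ i * (A * B * (r⁻¹) ^ i) ≤ 2 ^ J * (A * B * (r⁻¹) ^ i) := by
          gcongr
          exact one_le_two
      _ = _ := by ring
  · have h0 : (fun w => χ (r⁻¹ • w) * F w) =ᶠ[𝓝 w] fun _ => 0 := by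
      have : {w : Rn n | c * r < ‖w‖} ∈ 𝓝 w :=
        (isOpen_lt continuous_const continuous_norm).mem_nhds (not_le.1 hw)
      filter_upwards [this] with z hz
      have : r⁻¹ • z ∉ tsupport χ := fun h => by
        have h1 := hχ h
        rw [mem_closedBall_zero_iff, norm_smul, norm_inv, Real.norm_eq_abs, abs_of_pos hr,
          inv_mul_le_iff₀ hr] at h1
        have hz' : c * r < ‖z‖ := hz
        linarith
      rw [image_eq_zero_of_notMem_tsupport this, zero_mul]
    rw [(h0.iteratedFDeriv ℝ i).eq_of_nhds]
    simp only [iteratedFDeriv_fun_zero]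
    simp only [Pi.zero_apply, norm_zero]
    positivity

lemma finite_multiOrder_le (n L : ℕ) : {α : Fin n → ℕ | multiOrder α ≤ L}.Finite := by
  refine (Set.finite_Icc (0 : Fin n → ℕ) fun _ => L).subset fun α hα => ⟨zero_le, fun i => ?_⟩
  exact (Finset.single_le_sum (fun j _ => Nat.zero_le (α j)) (Finset.mem_univ i)).trans hα

/-- `S p = 0` for the polynomials `p` of degree at most `L`, in the sense of cut-offs with vanishing
moments, tested against functions with vanishing moments up to order `Q`. The cut-off polynomials are
listed as elements `h R` of the domain of `S`. -/
def VanishesOnPolys {n P₀ : ℕ} (L Q : ℕ) (S : momentSchwartz n P₀ →ₗ[ℂ] 𝓢'(Rn n, ℂ)) : Prop :=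
  ∀ η ∈ momentTest n (2 * Q), (∀ x ∈ Metric.ball (0 : Rn n) 1, η x = 1) →
    ∀ φ ∈ momentTest n Q, ∀ p ∈ polys n L,
      ∃ h : {R : ℝ // 0 < R} → momentSchwartz n P₀,
        (∀ R, (h R : 𝓢(Rn n, ℂ)) ∈ testFunctions n) ∧
        (∀ R z, (h R : 𝓢(Rn n, ℂ)) z = p z * η ((R : ℝ)⁻¹ • z)) ∧
        Tendsto (fun R => S (h R) φ) atTop (𝓝 0)

lemma exists_vanishesOnPolys {n P₀ M L : ℕ} {ν : ℝ}
    {S : momentSchwartz n P₀ →ₗ[ℂ] 𝓢'(Rn n, ℂ)}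
    (hvan : ∀ α : Fin n → ℕ, multiOrder α ≤ L → VanishesOnMonom ν M S α) :
    ∃ Q : ℕ, VanishesOnPolys L Q S := by
  choose! q hq using hvan
  obtain ⟨Q, hQ⟩ := ((finite_multiOrder_le n L).image q).bddAbove
  refine ⟨Q, fun η hη hη1 φ hφ p hp => ?_⟩
  induction hp using Submodule.span_induction with
  | mem p h =>
    obtain ⟨α, hα, rfl⟩ := h
    obtain ⟨hPq, hαq, -, H⟩ := hq α hα
    have hqQ : q α ≤ Q := hQ ⟨α, hα, rfl⟩
    refine ⟨_, fun R => ?_, fun R z => ?_, H η (momentTest_anti (by omega) hη) hη1 φ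
      (momentTest_anti hqQ hφ)⟩
    · exact (HasCompactSupport.comp_smul hη.2 (inv_ne_zero R.2.ne')).mul_left
    · rfl
  | zero =>
    exact ⟨0, fun R => HasCompactSupport.zero, fun R z => by simp, by simp⟩
  | add p₁ p₂ _ _ h₁ h₂ =>
    obtain ⟨h₁, ht₁, he₁, hl₁⟩ := h₁
    obtain ⟨h₂, ht₂, he₂, hl₂⟩ := h₂
    refine ⟨fun R => h₁ R + h₂ R, fun R => HasCompactSupport.add (ht₁ R) (ht₂ R), fun R z => ?_, ?_⟩
    · rw [Submodule.coe_add, add_apply, he₁, he₂, Pi.add_apply, add_mul]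
    · have := hl₁.add hl₂
      rw [add_zero] at this
      refine this.congr fun R => ?_
      rw [map_add]
      rfl
  | smul c p _ h =>
    obtain ⟨h, ht, he, hl⟩ := h
    refine ⟨fun R => c • h R, fun R => const_smul_mem_testFunctions c (ht R), fun R z => ?_, ?_⟩
    · rw [Submodule.coe_smul, smul_apply, he, Pi.smul_apply, smul_eq_mul, smul_eq_mul, mul_assoc]
    · have := hl.const_mul c
      rw [mul_zero] at this
      refine this.congr fun R => ?_
      rw [map_smul]
      rfl

lemma exists_cutoff_mul {n : ℕ} {χ : 𝓢(Rn n, ℂ)} {c : ℝ}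
    (hχ : tsupport χ ⊆ Metric.closedBall 0 c) {r : ℝ} (hr : 0 < r) (y : Rn n) (F : 𝓢(Rn n, ℂ)) :
    ∃ G : 𝓢(Rn n, ℂ), tsupport G ⊆ Metric.closedBall y (c * r) ∧
      ∀ z, G z = χ (r⁻¹ • (z - y)) * F z := by
  have hsub : tsupport (fun z => χ (r⁻¹ • (z - y)) * F z) ⊆ Metric.closedBall y (c * r) := by
    refine closure_minimal (fun z hz => ?_) Metric.isClosed_closedBall
    have h1 := hχ (subset_tsupport _ (left_ne_zero_of_mul hz))
    rw [mem_closedBall_zero_iff, norm_smul, norm_inv, Real.norm_eq_abs, abs_of_pos hr,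
      inv_mul_le_iff₀ hr] at h1
    rw [mem_closedBall_iff_norm, mul_comm]
    exact h1
  have hsm : ContDiff ℝ ∞ fun z => χ (r⁻¹ • (z - y)) * F z :=
    ((χ.smooth ⊤).comp ((contDiff_id.sub contDiff_const).const_smul _)).mul (F.smooth ⊤)
  exact ⟨(hasCompactSupport_of_subset_closedBall hsub).toSchwartzMap hsm, hsub, fun z => rfl⟩

lemma integrable_one_add_norm_smul {n : ℕ} {κ : ℝ} (hκ : (n : ℝ) < κ) {r : ℝ} (hr : 0 < r)
    (y : Rn n) : Integrable fun z : Rn n => (1 + ‖r⁻¹ • (y - z)‖) ^ (-κ) := by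
  have h1 : Integrable fun w : Rn n => (1 + ‖w‖) ^ (-κ) :=
    integrable_one_add_norm (by rwa [finrank_euclideanSpace_fin])
  exact (h1.comp_smul (inv_ne_zero hr.ne')).comp_sub_left y

/-- The part of a Taylor remainder near an atom at scale `r`, by weak boundedness. -/
lemma exists_norm_apply_near_le {n L P₀ P : ℕ} {ν δ : ℝ} (hδ1 : δ ≤ 1)
    {S : momentSchwartz n P₀ →ₗ[ℂ] 𝓢'(Rn n, ℂ)} {m J : ℕ} {CW : ℝ} (hCW : 0 ≤ CW)
    (hW : IsWeaklyBounded ν m J CW S) (hmP : m ≤ P) {φ : 𝓢(Rn n, ℂ)} (hφ : φ ∈ momentTest n P)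
    {ρ : ℝ} (hρ1 : 1 ≤ ρ) (hφρ : tsupport φ ⊆ Metric.closedBall 0 ρ) {χ : 𝓢(Rn n, ℂ)}
    (hχρ : tsupport χ ⊆ Metric.closedBall 0 (3 * ρ)) :
    ∃ C : ℝ, 0 ≤ C ∧ ∀ (r t : ℝ) (hr : 0 < r) (_ : 0 < t) (y : Rn n)
      (hy : atom φ hr y ∈ momentSchwartz n P₀), r ≤ t → ∀ (A : ℝ) (g G : 𝓢(Rn n, ℂ)), 0 < A →
        (∀ i ≤ max J (L + 1), ∀ z, ‖iteratedFDeriv ℝ i g z‖ ≤ A * (t⁻¹) ^ i) →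
        tsupport G ⊆ Metric.closedBall y (3 * ρ * r) →
        (∀ z, G z = χ (r⁻¹ • (z - y)) * (g z - taylorPoly L g y (z - y))) →
        ‖S ⟨atom φ hr y, hy⟩ G‖ ≤ C * A * (r / t) ^ (L - ν + δ) * t ^ (-ν) := by
  set J' := max J (L + 1) with hJ'
  have hJJ' : J ≤ J' := le_max_left _ _
  have hLJ' : L + 1 ≤ J' := le_max_right _ _
  obtain ⟨B, hB0, hB⟩ := exists_bound_iteratedFDeriv_atom φ J (c := 4 * ρ) (by linarith)
  obtain ⟨X, hX0, hX⟩ := exists_bound_iteratedFDeriv_le χ J'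
  refine ⟨CW * B * (2 ^ J' * X * (3 * ρ) ^ (L + 1) * (4 * ρ) ^ J') * (4 * ρ) ^ (n - ν),
    by positivity, fun r t hr ht y hy hrt A g G hA0 hgA hGs hG => ?_⟩
  have hρr : 0 < ρ * r := by positivity
  have hGt : G ∈ testFunctions n := hasCompactSupport_of_subset_closedBall hGs
  have hGeq : (G : Rn n → ℂ) = fun z => (fun w => χ (r⁻¹ • w) *
      (fun w => g (y + w) - taylorPoly L g y w) w) (z - y) := by
    funext z
    simp only [hG, add_sub_cancel]
  have hrem : ContDiff ℝ ∞ fun w => g (y + w) - taylorPoly L g y w :=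
    ((g.smooth ⊤).comp (contDiff_const.add contDiff_id)).sub
      (contDiff_of_mem_polys (taylorPoly_mem_polys L g y))
  have hdG : ∀ i ≤ J, ∀ z, ‖iteratedFDeriv ℝ i G z‖
      ≤ (2 ^ J' * X * (A * (3 * ρ) ^ (L + 1) * (r / t) ^ (L + 1)) * (4 * ρ) ^ J')
        * ((4 * ρ * r)⁻¹) ^ i := by
    intro i hi z
    rw [hGeq, iteratedFDeriv_comp_sub (𝕜 := ℝ) (f := fun w => χ (r⁻¹ • w) *
      (fun w => g (y + w) - taylorPoly L g y w) w) i y z]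
    refine (norm_iteratedFDeriv_cutoff_mul_le hr hχρ hX hrem hX0.le
      (B := A * (3 * ρ) ^ (L + 1) * (r / t) ^ (L + 1)) (by positivity)
      (fun l hl w hw => norm_iteratedFDeriv_scaled_remainder_le (g.smooth ⊤) ht hA0.le
        hLJ' hgA (by linarith) hr hrt hw hl) (hi.trans hJJ') _).trans ?_
    rw [mul_assoc _ ((4 * ρ) ^ J')]
    refine mul_le_mul_of_nonneg_left ?_ (by positivity)
    rw [mul_inv, mul_pow _ (r⁻¹), ← mul_assoc]
    refine le_mul_of_one_le_left (by positivity) ?_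
    rw [inv_pow, ← div_eq_mul_inv, one_le_div (by positivity)]
    exact pow_le_pow_right₀ (by linarith) (hi.trans hJJ')
  have hb := hW y (4 * ρ * r) (by positivity) _ hy
    (momentTest_anti hmP (atom_mem_momentTest hr y hφ)) G hGt
    ((tsupport_atom_subset hr y hφρ).trans (Metric.closedBall_subset_ball (by linarith)))
    (hGs.trans (Metric.closedBall_subset_ball (by linarith)))
    (B * (r ^ n)⁻¹) _ (by positivity) (by positivity) (hB r hr y) hdG
  refine hb.trans ?_
  have e0 : (r / t) ^ (L + 1) * ((r ^ n)⁻¹ * r ^ (n - ν))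
      ≤ (r / t) ^ (L - ν + δ) * t ^ (-ν) := by
    have e1 : (r ^ n)⁻¹ * r ^ (n - ν) = (r / t) ^ (-ν) * t ^ (-ν) := by
      rw [← Real.mul_rpow (by positivity) ht.le, div_mul_cancel₀ _ ht.ne', ← Real.rpow_natCast,
        ← Real.rpow_neg hr.le, ← Real.rpow_add hr]
      congr 1
      ring
    have e3 : (r / t) ^ (L + 1) * (r / t) ^ (-ν) ≤ (r / t) ^ (L - ν + δ) := by
      rw [← Real.rpow_natCast, ← Real.rpow_add (by positivity)]
      refine Real.rpow_le_rpow_of_exponent_ge (by positivity) ((div_le_one ht).2 hrt) ?_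
      push_cast
      linarith
    rw [e1, ← mul_assoc]
    gcongr
  rw [Real.mul_rpow (by positivity) hr.le]
  calc _ = CW * B * (2 ^ J' * X * (3 * ρ) ^ (L + 1) * (4 * ρ) ^ J') * (4 * ρ) ^ (n - ν) * A
        * ((r / t) ^ (L + 1) * ((r ^ n)⁻¹ * r ^ (n - ν))) := by ring
    _ ≤ CW * B * (2 ^ J' * X * (3 * ρ) ^ (L + 1) * (4 * ρ) ^ J') * (4 * ρ) ^ (n - ν) * A
        * ((r / t) ^ (L - ν + δ) * t ^ (-ν)) := mul_le_mul_of_nonneg_left e0 (by positivity)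
    _ = _ := by ring

/-- A function growing like a Taylor remainder, away from an atom at scale `r`: its growth of order
`L + δ < M + ν + γ` keeps the pairing with the kernel integrable. -/
lemma exists_norm_apply_away_le {n M L P₀ P : ℕ} {γ ν δ : ℝ}
    (hγ : 0 < γ) (hδγ : δ < γ) (hLM : (L : ℝ) ≤ M + ν)
    {S : momentSchwartz n P₀ →ₗ[ℂ] 𝓢'(Rn n, ℂ)}
    {K : Rn n → Rn n → ℂ} (hK : HasPolyApprox M γ (n + ν + M + γ) K)
    (hS : HasKernelFunction S K) (hMP : M ≤ P) {φ : 𝓢(Rn n, ℂ)} (hφ : φ ∈ momentTest n P)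
    {ρ : ℝ} (hρ1 : 1 ≤ ρ) (hφρ : tsupport φ ⊆ Metric.closedBall 0 ρ) :
    ∃ C : ℝ, 0 ≤ C ∧ ∀ (r t : ℝ) (hr : 0 < r) (_ : 0 < t) (y : Rn n)
      (hy : atom φ hr y ∈ momentSchwartz n P₀) (A : ℝ), 0 ≤ A → ∀ H ∈ testFunctions n,
        (∀ z, ‖H z‖ ≤ A * (‖z - y‖ / t) ^ (L + δ)) →
        (∀ z, ‖z - y‖ ≤ 5 / 2 * ρ * r → H z = 0) →
        ‖S ⟨atom φ hr y, hy⟩ H‖ ≤ C * A * (r / t) ^ (L - ν + δ) * t ^ (-ν) := by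
  have hρ0 : 0 < ρ := by linarith
  obtain ⟨C, hC0, hC⟩ := exists_norm_apply_atom_le hγ hK hS hMP hφ hρ0 hφρ
  set N := n + ν + M + γ with hNdef
  set κ := N - (L + δ) with hκdef
  have hκn : (n : ℝ) < κ := by rw [hκdef, hNdef]; linarith
  have hκ0 : 0 < κ := lt_of_le_of_lt (Nat.cast_nonneg n) hκn
  set I := ∫ w : Rn n, (1 + ‖w‖) ^ (-κ) with hI
  have hI0 : 0 ≤ I := integral_nonneg fun w => by positivity
  refine ⟨C * (2 ^ κ * I), by positivity, fun r t hr ht y hy A hA0 H hHt hH hzero => ?_⟩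
  have hρr : r ≤ ρ * r := le_mul_of_one_le_left hr.le hρ1
  have hsupp : ∀ z ∈ tsupport H, 2 * ρ * r < ‖z - y‖ := by
    intro z hz
    have hsub : tsupport H ⊆ {z | 5 / 2 * ρ * r ≤ ‖z - y‖} := by
      refine closure_minimal (fun z hz => ?_)
        (isClosed_le continuous_const (continuous_id.sub continuous_const).norm)
      by_contra hlt
      exact hz (hzero z (not_le.1 hlt).le)
    have h1 : 5 / 2 * ρ * r ≤ ‖z - y‖ := hsub hz
    linarith
  set E := A * t ^ (-(L + δ)) * 2 ^ κ * r ^ (-κ) with hE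
  have hbound : ∀ z, ‖z - y‖ ^ (-N) * ‖H z‖ ≤ E * (1 + ‖r⁻¹ • (y - z)‖) ^ (-κ) := by
    intro z
    by_cases hz : ‖z - y‖ ≤ 5 / 2 * ρ * r
    · rw [hzero z hz, norm_zero, mul_zero]
      positivity
    · rw [not_le] at hz
      have hrd : r ≤ ‖z - y‖ := by linarith
      have hd0 : 0 < ‖z - y‖ := by linarith
      have hHz := hH z
      have h3 : ‖r⁻¹ • (y - z)‖ = r⁻¹ * ‖z - y‖ := by
        rw [norm_smul, norm_inv, Real.norm_eq_abs, abs_of_pos hr, norm_sub_rev]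
      rw [h3]
      generalize ‖z - y‖ = d at hrd hd0 hHz
      have h2 : d ^ (-κ) ≤ 2 ^ κ * r ^ (-κ) * (1 + r⁻¹ * d) ^ (-κ) := by
        rw [mul_assoc, ← Real.mul_rpow hr.le (by positivity), mul_add, mul_one,
          mul_inv_cancel_left₀ hr.ne', Real.rpow_neg (by positivity),
          Real.rpow_neg (by positivity), ← div_eq_mul_inv, ← Real.div_rpow (by positivity)
          (by positivity), ← Real.inv_rpow (by positivity)]
        refine Real.rpow_le_rpow (by positivity) ?_ hκ0.le
        rw [inv_le_comm₀ hd0 (by positivity), inv_div]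
        linarith
      have h4 : d ^ (-N) * (d / t) ^ (L + δ) = t ^ (-(L + δ)) * d ^ (-κ) := by
        rw [Real.div_rpow hd0.le ht.le, Real.rpow_neg ht.le, mul_div_assoc',
          ← Real.rpow_add hd0, div_eq_mul_inv, mul_comm]
        congr 2
        rw [hκdef]
        ring
      calc d ^ (-N) * ‖H z‖ ≤ d ^ (-N) * (A * (d / t) ^ (L + δ)) := by gcongr
        _ = A * (d ^ (-N) * (d / t) ^ (L + δ)) := by ring
        _ = A * t ^ (-(L + δ)) * d ^ (-κ) := by rw [h4]; ring
        _ ≤ A * t ^ (-(L + δ)) * (2 ^ κ * r ^ (-κ) * (1 + r⁻¹ * d) ^ (-κ)) := by gcongr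
        _ = _ := by rw [hE]; ring
  have hb := hC r hr y hy H hHt hsupp _
    ((integrable_one_add_norm_smul hκn hr y).const_mul E) hbound
  refine hb.trans_eq ?_
  rw [integral_const_mul, integral_comp_atom hr y fun w : Rn n => (1 + ‖w‖) ^ (-κ), ← hI,
    smul_eq_mul, hE]
  have e1 : r ^ (M + γ) * (r ^ (-κ) * r ^ n) = (r / t) ^ (L - ν + δ) * t ^ (L - ν + δ) := by
    rw [← Real.mul_rpow (by positivity) ht.le, div_mul_cancel₀ _ ht.ne', ← Real.rpow_natCast r n,
      ← Real.rpow_add hr, ← Real.rpow_add hr]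
    congr 1
    rw [hκdef, hNdef]
    ring
  have e2 : t ^ (L - ν + δ) * t ^ (-(L + δ)) = t ^ (-ν) := by
    rw [← Real.rpow_add ht]
    congr 1
    ring
  calc _ = C * (2 ^ κ * I) * A * ((r ^ (M + γ) * (r ^ (-κ) * r ^ n)) * t ^ (-(L + δ))) := by ring
    _ = _ := by rw [e1, mul_assoc _ (t ^ (L - ν + δ)), e2]; ring

/-- A function minus its cut-off Taylor polynomial of order `L` is `O (|v| ^ (L + δ))` globally; the
cut-off value `e` has to be `1` for small increments only. -/
lemma norm_sub_taylorPoly_mul_le {n J L : ℕ} {f : Rn n → ℂ} {t A δ Y : ℝ} (hf : ContDiff ℝ ∞ f)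
    (ht : 0 < t) (hA0 : 0 ≤ A) (hδ0 : 0 < δ) (hδ1 : δ ≤ 1) (hL : L + 1 ≤ J)
    (hA : ∀ i ≤ J, ∀ x, ‖iteratedFDeriv ℝ i f x‖ ≤ A * (t⁻¹) ^ i) (hY : 0 ≤ Y) {a v : Rn n} {e : ℂ}
    (heY : ‖e‖ ≤ Y) (he : ‖v‖ ≤ t → e = 1) :
    ‖f (a + v) - taylorPoly L f a v * e‖ ≤ A * (1 + (L + 1) * Y) * (‖v‖ / t) ^ (L + δ) := by
  rcases le_total ‖v‖ t with hzt | hzt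
  · rw [he hzt, mul_one]
    refine (norm_scaled_remainder_le hf hL hA a v).trans ?_
    have e1 : (‖v‖ / t) ^ (L + 1) ≤ (‖v‖ / t) ^ (L + δ) := by
      have hd1 : ‖v‖ / t ≤ 1 := (div_le_one ht).2 hzt
      rcases (div_nonneg (norm_nonneg v) ht.le).eq_or_lt with h0 | h0
      · rw [← h0, zero_pow (Nat.succ_ne_zero L), Real.zero_rpow (by positivity)]
      · rw [← Real.rpow_natCast]
        refine Real.rpow_le_rpow_of_exponent_ge h0 hd1 ?_
        push_cast
        linarith
    have e2 : A ≤ A * (1 + (L + 1) * Y) :=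
      le_mul_of_one_le_right hA0 (le_add_of_nonneg_right (by positivity))
    gcongr
  · have h1 : 1 ≤ ‖v‖ / t := (one_le_div ht).2 hzt
    have h2 : ‖f (a + v)‖ ≤ A := by
      simpa using hA 0 (Nat.zero_le _) (a + v)
    have h3 := norm_scaled_taylorPoly_le ht hA0 hL hA a hzt
    have e1 : (‖v‖ / t) ^ L ≤ (‖v‖ / t) ^ (L + δ) := by
      rw [← Real.rpow_natCast]
      exact Real.rpow_le_rpow_of_exponent_le h1 (by linarith)
    have e2 : 1 ≤ (‖v‖ / t) ^ (L + δ) := Real.one_le_rpow h1 (by positivity)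
    calc _ ≤ ‖f (a + v)‖ + ‖taylorPoly L f a v‖ * ‖e‖ := by
          rw [← norm_mul]; exact norm_sub_le _ _
      _ ≤ A * 1 + (L + 1) * (A * (‖v‖ / t) ^ L) * Y := by
          rw [mul_one]
          gcongr
      _ ≤ A * (‖v‖ / t) ^ (L + δ) + (L + 1) * (A * (‖v‖ / t) ^ (L + δ)) * Y := by gcongr
      _ = _ := by ring

/-- The pairing of an atom `φ_r` with vanishing moments and an atom `ψ_t` at a larger scale. The Taylor
polynomial of `ψ_t` at the centre of `φ_r` may be subtracted since `T*` vanishes on polynomials; the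
remainder is split at the distance `≈ r`, where weak boundedness and the kernel take over from
each other. -/
lemma exists_norm_apply_atom_atom_le_of_le {n M L P₀ P : ℕ} {γ ν δ : ℝ}
    (hγ : 0 < γ) (hγ1 : γ ≤ 1) (hδ0 : 0 < δ) (hδγ : δ < γ) (hLM : (L : ℝ) ≤ M + ν)
    {T Tstar : momentSchwartz n P₀ →ₗ[ℂ] 𝓢'(Rn n, ℂ)}
    (htr : ∀ f g : momentSchwartz n P₀, T f (g : 𝓢(Rn n, ℂ)) = Tstar g (f : 𝓢(Rn n, ℂ)))
    {K : Rn n → Rn n → ℂ} (hK : HasPolyApprox M γ (n + ν + M + γ) K)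
    (hS : HasKernelFunction T K) {m J : ℕ} {CW : ℝ} (hCW : 0 ≤ CW)
    (hW : IsWeaklyBounded ν m J CW T) {Q : ℕ} (hvan : VanishesOnPolys L Q Tstar) (hn : 0 < n)
    (hMP : M ≤ P) (hmP : m ≤ P) (hQP : Q ≤ P) {φ ψ : 𝓢(Rn n, ℂ)} (hφ : φ ∈ momentTest n P)
    (hψ : ψ ∈ testFunctions n) :
    ∃ C : ℝ, 0 ≤ C ∧ ∀ (r t : ℝ) (hr : 0 < r) (ht : 0 < t) (x y : Rn n)
      (hy : atom φ hr y ∈ momentSchwartz n P₀), atom ψ ht x ∈ momentSchwartz n P₀ → r ≤ t →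
        ‖T ⟨atom φ hr y, hy⟩ (atom ψ ht x)‖
          ≤ C * (r / t) ^ (L - ν + δ) * t ^ (-(n + ν)) := by
  have hδ1 : δ ≤ 1 := by linarith
  obtain ⟨ρ, hρ1, hφρ⟩ := exists_tsupport_subset_closedBall hφ.2
  have hρ0 : 0 < ρ := by linarith
  obtain ⟨χ, hχρ, hχ1, hχle, -⟩ := exists_bump (n := n) (a := 5 / 2 * ρ) (b := 3 * ρ)
    (by positivity) (by linarith)
  obtain ⟨η, hη, hη1⟩ := exists_cutoff hn (2 * Q)
  obtain ⟨A, hA0, hA⟩ := exists_bound_iteratedFDeriv_atom ψ (max J (L + 1)) (c := 1) le_rfl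
  obtain ⟨Y, hY0, hY⟩ := exists_bound_iteratedFDeriv_le η 0
  obtain ⟨C₁, hC₁0, hC₁⟩ := exists_norm_apply_near_le (L := L) hδ1 hCW hW hmP hφ hρ1 hφρ hχρ
  obtain ⟨C₂, hC₂0, hC₂⟩ := exists_norm_apply_away_le hγ hδγ hLM hK hS hMP hφ hρ1 hφρ
  refine ⟨C₁ * A + C₂ * (A * (1 + (L + 1) * Y)), by positivity,
    fun r t hr ht x y hy hx hrt => ?_⟩
  set g := atom ψ ht x with hg
  have hum : atom φ hr y ∈ momentTest n P := atom_mem_momentTest hr y hφ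
  have hgA : ∀ i ≤ max J (L + 1), ∀ z,
      ‖iteratedFDeriv ℝ i g z‖ ≤ A * (t ^ n)⁻¹ * (t⁻¹) ^ i := by
    intro i hi z
    have := hA t ht x i hi z
    rwa [one_mul] at this
  have hp : (fun z => taylorPoly L g y (z - y)) ∈ polys n L := by
    have := comp_affine_mem_polys (taylorPoly_mem_polys L g y) 1 (-y)
    simpa [sub_eq_add_neg] using this
  obtain ⟨h, ht', hh, hlim⟩ := hvan η hη hη1 _ (momentTest_anti hQP hum) _ hp
  set R₀ := ‖y‖ + 3 * ρ * t + 1 with hR₀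
  have hρt : t ≤ ρ * t := le_mul_of_one_le_left ht.le hρ1
  have hρr : ρ * r ≤ ρ * t := mul_le_mul_of_nonneg_left hrt hρ0.le
  have hR₀0 : 0 < R₀ := by positivity
  -- on the ball of radius `3 ρ t` about `y` the cut-off of the polynomial is invisible
  have hη_eq : ∀ R : {R : ℝ // 0 < R}, R₀ ≤ R → ∀ z, ‖z - y‖ ≤ 3 * ρ * t →
      η ((R : ℝ)⁻¹ • z) = 1 := by
    intro R hR z hz
    apply hη1
    rw [mem_ball_zero_iff, norm_smul, norm_inv, Real.norm_eq_abs, abs_of_pos R.2,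
      inv_mul_lt_iff₀ R.2, mul_one]
    have : ‖z‖ ≤ ‖z - y‖ + ‖y‖ := by simpa using norm_add_le (z - y) y
    linarith
  have htn : (t ^ n)⁻¹ * t ^ (-ν) = t ^ (-(n + ν)) := by
    rw [← Real.rpow_natCast, ← Real.rpow_neg ht.le, ← Real.rpow_add ht]
    congr 1
    ring
  have hmain : ∀ R : {R : ℝ // 0 < R}, R₀ ≤ R →
      ‖T ⟨atom φ hr y, hy⟩ (g - (h R : 𝓢(Rn n, ℂ)))‖
        ≤ (C₁ * A + C₂ * (A * (1 + (L + 1) * Y))) * (r / t) ^ (L - ν + δ) * t ^ (-(n + ν)) := by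
    intro R hR
    set F : 𝓢(Rn n, ℂ) := g - (h R : 𝓢(Rn n, ℂ)) with hF
    have hFz : ∀ z, F z = g z - taylorPoly L g y (z - y) * η ((R : ℝ)⁻¹ • z) := by
      intro z
      rw [hF, sub_apply, hh]
    have hFt : F ∈ testFunctions n :=
      HasCompactSupport.sub (atom_mem_testFunctions ht x hψ) (ht' R)
    obtain ⟨G, hGs, hG⟩ := exists_cutoff_mul hχρ hr y F
    have hGt : G ∈ testFunctions n := hasCompactSupport_of_subset_closedBall hGs
    have hsplit : T ⟨atom φ hr y, hy⟩ F
        = T ⟨atom φ hr y, hy⟩ G + T ⟨atom φ hr y, hy⟩ (F - G) := by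
      rw [← map_add, add_sub_cancel]
    have hnear := hC₁ r t hr ht y hy hrt (A * (t ^ n)⁻¹) g G (by positivity) hgA hGs fun z => by
      rw [hG]
      by_cases hz : r⁻¹ • (z - y) ∈ tsupport χ
      · have h1 := hχρ hz
        rw [mem_closedBall_zero_iff, norm_smul, norm_inv, Real.norm_eq_abs, abs_of_pos hr,
          inv_mul_le_iff₀ hr] at h1
        rw [hFz, hη_eq R hR z (by linarith), mul_one]
      · rw [image_eq_zero_of_notMem_tsupport hz, zero_mul, zero_mul]
    have hFG : ∀ z, (F - G) z = (1 - χ (r⁻¹ • (z - y))) * F z := by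
      intro z
      rw [sub_apply, hG]
      ring
    have haway := hC₂ r t hr ht y hy (A * (t ^ n)⁻¹ * (1 + (L + 1) * Y)) (by positivity) (F - G)
      (HasCompactSupport.sub hFt hGt) (fun z => by
        have h1 := norm_sub_taylorPoly_mul_le (g.smooth ⊤) ht (by positivity) hδ0 hδ1
          (le_max_right J (L + 1)) hgA hY0.le (a := y) (v := z - y) (e := η ((R : ℝ)⁻¹ • z))
          (by simpa using hY 0 le_rfl ((R : ℝ)⁻¹ • z))
          (fun hz => hη_eq R hR z (by linarith))
        rw [add_sub_cancel, ← hFz] at h1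
        rw [hFG, norm_mul]
        exact (mul_le_of_le_one_left (norm_nonneg _) (hχle _)).trans h1)
      (fun z hz => by
        rw [hFG, hχ1, sub_self, zero_mul]
        rw [norm_smul, norm_inv, Real.norm_eq_abs, abs_of_pos hr, inv_mul_le_iff₀ hr]
        linarith)
    rw [hsplit]
    refine (norm_add_le _ _).trans ((add_le_add hnear haway).trans_eq ?_)
    rw [← htn]
    ring
  have hlim' := (hlim.norm).const_add
    ((C₁ * A + C₂ * (A * (1 + (L + 1) * Y))) * (r / t) ^ (L - ν + δ) * t ^ (-(n + ν)))
  rw [norm_zero, add_zero] at hlim'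
  have : Nonempty {R : ℝ // 0 < R} := ⟨⟨1, one_pos⟩⟩
  refine ge_of_tendsto hlim' ?_
  filter_upwards [eventually_ge_atTop (⟨R₀, hR₀0⟩ : {R : ℝ // 0 < R})] with R hR
  have h1 : T ⟨atom φ hr y, hy⟩ g
      = T ⟨atom φ hr y, hy⟩ (g - (h R : 𝓢(Rn n, ℂ))) + Tstar (h R) (atom φ hr y) := by
    have h2 := htr ⟨atom φ hr y, hy⟩ (h R)
    rw [map_sub, h2, sub_add_cancel]
  rw [h1]
  exact (norm_add_le _ _).trans (add_le_add (hmain R hR) le_rfl)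

/-! ### Translates of Schwartz functions in weighted spaces of finitely many derivatives -/

section Translation

open LineDeriv

variable {n : ℕ}

lemma exists_one_add_pow_mul_norm_iteratedFDeriv_le (f : 𝓢(Rn n, ℂ)) (k i : ℕ) :
    ∃ C : ℝ, 0 ≤ C ∧ ∀ x, (1 + ‖x‖) ^ k * ‖iteratedFDeriv ℝ i f x‖ ≤ C := by
  refine ⟨_, ?_, fun x =>
    SchwartzMap.one_add_le_sup_seminorm_apply (𝕜 := ℝ) (m := (k, i)) le_rfl le_rfl f x⟩
  positivity

/-- The function `x ↦ (1 + |x|) ^ k f (x)`, as a bounded continuous function. -/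
noncomputable def weighted (n k : ℕ) : 𝓢(Rn n, ℂ) →ₗ[ℂ] BoundedContinuousFunction (Rn n) ℂ where
  toFun f := BoundedContinuousFunction.ofNormedAddCommGroup
    (fun x => (((1 + ‖x‖) ^ k : ℝ) : ℂ) * f x)
    ((Complex.continuous_ofReal.comp (by fun_prop)).mul f.continuous)
    (exists_one_add_pow_mul_norm_iteratedFDeriv_le f k 0).choose (fun x => by
      have h := (exists_one_add_pow_mul_norm_iteratedFDeriv_le f k 0).choose_spec.2 x
      rw [norm_iteratedFDeriv_zero] at h
      rw [norm_mul, Complex.norm_real, Real.norm_eq_abs, abs_of_nonneg (by positivity)]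
      exact h)
  map_add' f g := by
    ext x
    exact mul_add _ _ _
  map_smul' c f := by
    ext x
    exact mul_left_comm _ _ _

lemma weighted_apply (k : ℕ) (f : 𝓢(Rn n, ℂ)) (x : Rn n) :
    weighted n k f x = (((1 + ‖x‖) ^ k : ℝ) : ℂ) * f x := rfl

lemma norm_weighted_apply (k : ℕ) (f : 𝓢(Rn n, ℂ)) (x : Rn n) :
    ‖weighted n k f x‖ = (1 + ‖x‖) ^ k * ‖f x‖ := by
  rw [weighted_apply, norm_mul, Complex.norm_real, Real.norm_eq_abs, abs_of_nonneg (by positivity)]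

/-- The tuple of all the weighted derivatives `(1 + |x|) ^ k D^σ f (x)` of order at most `N`. Every
tempered distribution factors through one of these maps into a Banach space, see
`exists_eq_comp_jet`; this is what gives access to the Bochner integral. -/
noncomputable def jet (n k N : ℕ) : 𝓢(Rn n, ℂ) →ₗ[ℂ]
    ((i : Σ l : Fin (N + 1), (Fin l → Fin n)) → BoundedContinuousFunction (Rn n) ℂ) :=
  LinearMap.pi fun i => weighted n k ∘ₗ
    (iteratedLineDerivOpCLM ℂ 𝓢(Rn n, ℂ) fun j => (basisVec (i.2 j) : Rn n)).toLinearMap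

lemma jet_apply (k N : ℕ) (f : 𝓢(Rn n, ℂ)) (i : Σ l : Fin (N + 1), (Fin l → Fin n)) :
    jet n k N f i = weighted n k (∂^{fun j => (basisVec (i.2 j) : Rn n)} f) := rfl

lemma jet_injective (k N : ℕ) : Function.Injective (jet n k N) := by
  rw [← LinearMap.ker_eq_bot, LinearMap.ker_eq_bot']
  intro f hf
  ext x
  have h := DFunLike.congr_fun (congrFun hf ⟨0, Fin.elim0⟩) x
  rw [jet_apply, weighted_apply, iteratedLineDerivOp_eq_iteratedFDeriv] at h
  have h1 : (((1 + ‖x‖) ^ k : ℝ) : ℂ) ≠ 0 := by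
    exact_mod_cast (show (0 : ℝ) < (1 + ‖x‖) ^ k by positivity).ne'
  have h2 := (mul_eq_zero.1 h).resolve_left h1
  exact (iteratedFDeriv_zero_apply (𝕜 := ℝ) (f := f) (x := x) _).symm.trans h2

lemma seminorm_le_norm_jet {k l K N : ℕ} (hk : k ≤ K) (hl : l ≤ N) (f : 𝓢(Rn n, ℂ)) :
    SchwartzMap.seminorm ℂ k l f
      ≤ (Fintype.card (Fin l → Fin n) : ℝ) * ‖jet n K N f‖ := by
  refine SchwartzMap.seminorm_le_bound ℂ k l f (by positivity) fun x => ?_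
  refine (mul_le_mul_of_nonneg_left (norm_multilinear_le_sum_basisVec _) (by positivity)).trans ?_
  rw [Finset.mul_sum]
  have hb : ∀ σ ∈ (Finset.univ : Finset (Fin l → Fin n)),
      ‖x‖ ^ k * ‖iteratedFDeriv ℝ l f x fun j => basisVec (σ j)‖ ≤ ‖jet n K N f‖ := by
    intro σ _
    refine le_trans ?_ ((BoundedContinuousFunction.norm_coe_le_norm _ x).trans
      (norm_le_pi_norm (jet n K N f) ⟨⟨l, Nat.lt_succ_of_le hl⟩, σ⟩))
    rw [jet_apply, norm_weighted_apply, iteratedLineDerivOp_eq_iteratedFDeriv]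
    refine mul_le_mul_of_nonneg_right ?_ (norm_nonneg _)
    calc ‖x‖ ^ k ≤ (1 + ‖x‖) ^ k := pow_le_pow_left₀ (norm_nonneg _) (by linarith) _
      _ ≤ (1 + ‖x‖) ^ K := pow_le_pow_right₀ (by linarith [norm_nonneg x]) hk
  refine (Finset.sum_le_card_nsmul _ _ _ hb).trans ?_
  rw [nsmul_eq_mul, Finset.card_univ]

lemma exists_norm_le_jet (u : 𝓢'(Rn n, ℂ)) :
    ∃ (k N : ℕ) (C : ℝ), 0 ≤ C ∧ ∀ f, ‖u f‖ ≤ C * ‖jet n k N f‖ := by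
  obtain ⟨s, C, -, hC⟩ := Seminorm.bound_of_continuous (schwartz_withSeminorms ℂ (Rn n) ℂ)
    ((normSeminorm ℂ ℂ).comp (u : 𝓢(Rn n, ℂ) →ₗ[ℂ] ℂ)) (by
      have h : Continuous fun f => ‖u f‖ := u.continuous.norm
      exact h)
  refine ⟨s.sup Prod.fst, s.sup Prod.snd, C * ∑ i ∈ s, (Fintype.card (Fin i.2 → Fin n) : ℝ),
    by positivity, fun f => ?_⟩
  refine (hC f).trans ?_
  rw [_root_.smul_apply, NNReal.smul_def, smul_eq_mul, mul_assoc]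
  refine mul_le_mul_of_nonneg_left ?_ C.2
  rw [Finset.sum_mul]
  refine Seminorm.finset_sup_apply_le (by positivity) fun i hi => ?_
  refine (seminorm_le_norm_jet (Finset.le_sup hi) (Finset.le_sup hi) f).trans ?_
  exact Finset.single_le_sum
    (f := fun i : ℕ × ℕ => (Fintype.card (Fin i.2 → Fin n) : ℝ) * ‖jet n _ _ f‖)
    (fun _ _ => by positivity) hi

/-- By the Hahn–Banach theorem, a tempered distribution is a continuous linear functional of
finitely many weighted derivatives. -/
lemma exists_eq_comp_jet (u : 𝓢'(Rn n, ℂ)) :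
    ∃ (k N : ℕ) (Λ : ((i : Σ l : Fin (N + 1), (Fin l → Fin n)) →
      BoundedContinuousFunction (Rn n) ℂ) →L[ℂ] ℂ), ∀ f, u f = Λ (jet n k N f) := by
  obtain ⟨k, N, C, -, hC⟩ := exists_norm_le_jet u
  let e := LinearEquiv.ofInjective (jet n k N) (jet_injective k N)
  let Λ₀ : LinearMap.range (jet n k N) →ₗ[ℂ] ℂ := (u : 𝓢(Rn n, ℂ) →ₗ[ℂ] ℂ) ∘ₗ e.symm.toLinearMap
  have hb : ∀ b, ‖Λ₀ b‖ ≤ C * ‖b‖ := by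
    intro b
    obtain ⟨f, rfl⟩ := e.surjective b
    have : Λ₀ (e f) = u f := congrArg u (e.symm_apply_apply f)
    rw [this]
    exact hC f
  obtain ⟨Λ, hΛ, -⟩ := exists_extension_norm_eq _ (Λ₀.mkContinuous C hb)
  refine ⟨k, N, Λ, fun f => ?_⟩
  have h1 := hΛ (e f)
  have h2 : Λ₀ (e f) = u f := congrArg u (e.symm_apply_apply f)
  exact (h1.trans h2).symm

lemma lineDerivOp_compSubConstCLM (y v : Rn n) (f : 𝓢(Rn n, ℂ)) :
    ∂_{v} (compSubConstCLM ℂ y f) = compSubConstCLM ℂ y (∂_{v} f) := by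
  ext x
  rw [compSubConstCLM_apply, lineDerivOp_apply_eq_fderiv, lineDerivOp_apply_eq_fderiv]
  exact congrArg (fun A : Rn n →L[ℝ] ℂ => A v) (fderiv_comp_sub (𝕜 := ℝ) (f := f) (x := x) y)

lemma iteratedLineDerivOp_compSubConstCLM (y : Rn n) {l : ℕ} (v : Fin l → Rn n)
    (f : 𝓢(Rn n, ℂ)) :
    ∂^{v} (compSubConstCLM ℂ y f) = compSubConstCLM ℂ y (∂^{v} f) := by
  induction l with
  | zero => simp
  | succ l ih =>
    rw [iteratedLineDerivOp_succ_left, iteratedLineDerivOp_succ_left, ih,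
      lineDerivOp_compSubConstCLM]

lemma lineDerivOp_comm (v w : Rn n) (f : 𝓢(Rn n, ℂ)) : ∂_{v} (∂_{w} f) = ∂_{w} (∂_{v} f) := by
  have h : ∀ (v w : Rn n) (x : Rn n), (∂_{v} (∂_{w} f) : 𝓢(Rn n, ℂ)) x
      = fderiv ℝ (fderiv ℝ f) x v w := by
    intro v w x
    rw [lineDerivOp_apply_eq_fderiv]
    have h1 : ((∂_{w} f : 𝓢(Rn n, ℂ)) : Rn n → ℂ) = fun z => fderiv ℝ f z w := by
      funext z
      exact lineDerivOp_apply_eq_fderiv w f z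
    have hd : DifferentiableAt ℝ (fderiv ℝ f) x :=
      (((f.smooth 2).fderiv_right (m := 1) (by norm_num)).differentiable (by norm_num)) x
    rw [h1, fderiv_clm_apply hd (differentiableAt_const w)]
    simp
  ext x
  rw [h, h]
  exact ((f.smooth 2).contDiffAt.isSymmSndFDerivAt (by simp)).eq v w

lemma iteratedLineDerivOp_lineDerivOp_comm {l : ℕ} (v : Fin l → Rn n) (w : Rn n)
    (f : 𝓢(Rn n, ℂ)) : ∂^{v} (∂_{w} f) = ∂_{w} (∂^{v} f) := by
  induction l with
  | zero => simp
  | succ l ih =>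
    rw [iteratedLineDerivOp_succ_left, iteratedLineDerivOp_succ_left, ih, lineDerivOp_comm]

lemma norm_jet_le_of_forall {k N : ℕ} {f : 𝓢(Rn n, ℂ)} {C : ℝ} (hC : 0 ≤ C)
    (h : ∀ (i : Σ l : Fin (N + 1), (Fin l → Fin n)) (x : Rn n),
      (1 + ‖x‖) ^ k * ‖(∂^{fun j => (basisVec (i.2 j) : Rn n)} f : 𝓢(Rn n, ℂ)) x‖ ≤ C) :
    ‖jet n k N f‖ ≤ C := by
  refine (pi_norm_le_iff_of_nonneg hC).2 fun i =>
    (BoundedContinuousFunction.norm_le hC).2 fun x => ?_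
  rw [jet_apply, norm_weighted_apply]
  exact h i x

lemma one_add_norm_pow_le (k : ℕ) (x y : Rn n) :
    (1 + ‖x‖) ^ k ≤ (1 + ‖y‖) ^ k * (1 + ‖x - y‖) ^ k := by
  rw [← mul_pow]
  refine pow_le_pow_left₀ (by positivity) ?_ _
  have := norm_le_norm_add_norm_sub' x y
  nlinarith [norm_nonneg y, norm_nonneg (x - y)]

lemma exists_norm_jet_translate_le (k N : ℕ) (f : 𝓢(Rn n, ℂ)) :
    ∃ C : ℝ, 0 ≤ C ∧ ∀ y, ‖jet n k N (compSubConstCLM ℂ y f)‖ ≤ C * (1 + ‖y‖) ^ k := by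
  choose C hC0 hC using fun i : Σ l : Fin (N + 1), (Fin l → Fin n) =>
    exists_one_add_pow_mul_norm_iteratedFDeriv_le
      (∂^{fun j => (basisVec (i.2 j) : Rn n)} f : 𝓢(Rn n, ℂ)) k 0
  have hS := Finset.sum_nonneg fun i (_ : i ∈ Finset.univ) => hC0 i
  refine ⟨∑ i, C i, hS, fun y => norm_jet_le_of_forall (by positivity) fun i x => ?_⟩
  rw [iteratedLineDerivOp_compSubConstCLM, compSubConstCLM_apply]
  have h1 := hC i (x - y)
  rw [norm_iteratedFDeriv_zero] at h1
  have h2 : C i ≤ ∑ i, C i := Finset.single_le_sum (fun i _ => hC0 i) (Finset.mem_univ i)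
  calc _ ≤ ((1 + ‖y‖) ^ k * (1 + ‖x - y‖) ^ k)
        * ‖(∂^{fun j => (basisVec (i.2 j) : Rn n)} f : 𝓢(Rn n, ℂ)) (x - y)‖ := by
        gcongr
        exact one_add_norm_pow_le k x y
    _ = (1 + ‖y‖) ^ k * ((1 + ‖x - y‖) ^ k
        * ‖(∂^{fun j => (basisVec (i.2 j) : Rn n)} f : 𝓢(Rn n, ℂ)) (x - y)‖) := by ring
    _ ≤ (1 + ‖y‖) ^ k * ∑ i, C i := by gcongr; exact h1.trans h2
    _ = _ := mul_comm _ _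

lemma exists_norm_sub_add_fderiv_le (k : ℕ) (f : 𝓢(Rn n, ℂ)) :
    ∃ C : ℝ, 0 ≤ C ∧ ∀ z v : Rn n, ‖v‖ ≤ 1 →
      (1 + ‖z‖) ^ k * ‖f (z - v) - f z + fderiv ℝ f z v‖ ≤ C * ‖v‖ ^ 2 := by
  obtain ⟨A, hA0, hA⟩ := exists_one_add_pow_mul_norm_iteratedFDeriv_le f k 2
  refine ⟨2 ^ k * A, by positivity, fun z v hv => ?_⟩
  have hz : 0 < (1 + ‖z‖) ^ k := by positivity
  set B := 2 ^ k * A / (1 + ‖z‖) ^ k with hB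
  have hB0 : 0 ≤ B := by positivity
  have hd1 : Differentiable ℝ f := (f.smooth 1).differentiable (by norm_num)
  have hd2 : Differentiable ℝ (fderiv ℝ f) :=
    ((f.smooth 2).fderiv_right (m := 1) (by norm_num)).differentiable (by norm_num)
  have h2 : ∀ w ∈ Metric.closedBall z ‖v‖, ‖fderiv ℝ (fderiv ℝ f) w‖ ≤ B := by
    intro w hw
    have hw' : ‖w - z‖ ≤ ‖v‖ := mem_closedBall_iff_norm.1 hw
    rw [← norm_iteratedFDeriv_one, norm_iteratedFDeriv_fderiv, hB, le_div_iff₀ hz]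
    have h3 : 1 + ‖z‖ ≤ 2 * (1 + ‖w‖) := by
      have h4 := norm_le_norm_add_norm_sub w z
      linarith [norm_nonneg w]
    calc ‖iteratedFDeriv ℝ (1 + 1) f w‖ * (1 + ‖z‖) ^ k
        ≤ ‖iteratedFDeriv ℝ (1 + 1) f w‖ * (2 * (1 + ‖w‖)) ^ k := by gcongr
      _ = 2 ^ k * ((1 + ‖w‖) ^ k * ‖iteratedFDeriv ℝ 2 f w‖) := by
        rw [mul_pow]; ring
      _ ≤ 2 ^ k * A := by gcongr; exact hA w
  have hconv : Convex ℝ (Metric.closedBall z ‖v‖) := convex_closedBall z ‖v‖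
  have hzm : z ∈ Metric.closedBall z ‖v‖ := Metric.mem_closedBall_self (norm_nonneg _)
  have h1 : ∀ w ∈ Metric.closedBall z ‖v‖, ‖fderiv ℝ f w - fderiv ℝ f z‖ ≤ B * ‖v‖ := by
    intro w hw
    refine (hconv.norm_image_sub_le_of_norm_fderiv_le (fun w _ => hd2 w) h2 hzm hw).trans ?_
    gcongr
    exact mem_closedBall_iff_norm.1 hw
  have hvm : z - v ∈ Metric.closedBall z ‖v‖ := by
    rw [mem_closedBall_iff_norm]; simp
  have h0 := hconv.norm_image_sub_le_of_norm_fderiv_le' (fun w _ => hd1 w) h1 hzm hvm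
  have e : f (z - v) - f z - fderiv ℝ f z (z - v - z) = f (z - v) - f z + fderiv ℝ f z v := by
    rw [show z - v - z = -v by abel, map_neg, sub_neg_eq_add]
  rw [e, show z - v - z = -v by abel, norm_neg] at h0
  calc _ ≤ (1 + ‖z‖) ^ k * (B * ‖v‖ * ‖v‖) := by gcongr
    _ = _ := by rw [hB]; field_simp

lemma hasFDerivAt_jet_translate (k N : ℕ) (f : 𝓢(Rn n, ℂ)) (y : Rn n) :
    ∃ A : Rn n →L[ℝ] ((i : Σ l : Fin (N + 1), (Fin l → Fin n)) →
        BoundedContinuousFunction (Rn n) ℂ),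
      (∀ v, A v = -jet n k N (compSubConstCLM ℂ y (∂_{v} f))) ∧
      HasFDerivAt (fun y => jet n k N (compSubConstCLM ℂ y f)) A y := by
  let A₀ : Rn n →ₗ[ℝ] ((i : Σ l : Fin (N + 1), (Fin l → Fin n)) →
      BoundedContinuousFunction (Rn n) ℂ) :=
    { toFun := fun v => -jet n k N (compSubConstCLM ℂ y (∂_{v} f))
      map_add' := fun v w => by
        rw [lineDerivOp_left_add, map_add, map_add, neg_add]
      map_smul' := fun c v => by
        have h : (∂_{c • v} f : 𝓢(Rn n, ℂ)) = (c : ℂ) • (∂_{v} f : 𝓢(Rn n, ℂ)) := by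
          rw [lineDerivOp_left_smul]
          ext x
          simp
        rw [h, map_smul, map_smul, ← smul_neg]
        rfl }
  refine ⟨LinearMap.toContinuousLinearMap A₀, fun v => rfl, ?_⟩
  choose C hC0 hC using fun i : Σ l : Fin (N + 1), (Fin l → Fin n) =>
    exists_norm_sub_add_fderiv_le k (∂^{fun j => (basisVec (i.2 j) : Rn n)} f : 𝓢(Rn n, ℂ))
  have hS := Finset.sum_nonneg fun i (_ : i ∈ Finset.univ) => hC0 i
  have key : ∀ v : Rn n, ‖v‖ ≤ 1 →
      ‖jet n k N (compSubConstCLM ℂ (y + v) f) - jet n k N (compSubConstCLM ℂ y f)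
        - LinearMap.toContinuousLinearMap A₀ v‖ ≤ ((1 + ‖y‖) ^ k * ∑ i, C i) * ‖v‖ ^ 2 := by
    intro v hv
    have e : jet n k N (compSubConstCLM ℂ (y + v) f) - jet n k N (compSubConstCLM ℂ y f)
        - LinearMap.toContinuousLinearMap A₀ v
        = jet n k N (compSubConstCLM ℂ (y + v) f - compSubConstCLM ℂ y f
          + compSubConstCLM ℂ y (∂_{v} f)) := by
      rw [map_add, map_sub]
      exact sub_neg_eq_add _ _
    rw [e]
    refine norm_jet_le_of_forall (by positivity) fun i x => ?_
    have h1 := hC i (x - y) v hv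
    have e2 : (∂^{fun j => (basisVec (i.2 j) : Rn n)} (compSubConstCLM ℂ (y + v) f
          - compSubConstCLM ℂ y f + compSubConstCLM ℂ y (∂_{v} f)) : 𝓢(Rn n, ℂ)) x
        = (∂^{fun j => (basisVec (i.2 j) : Rn n)} f : 𝓢(Rn n, ℂ)) (x - y - v)
          - (∂^{fun j => (basisVec (i.2 j) : Rn n)} f : 𝓢(Rn n, ℂ)) (x - y)
          + fderiv ℝ (∂^{fun j => (basisVec (i.2 j) : Rn n)} f : 𝓢(Rn n, ℂ)) (x - y) v := by
      rw [iteratedLineDerivOp_add, sub_eq_add_neg (compSubConstCLM ℂ (y + v) f), iteratedLineDerivOp_add,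
        iteratedLineDerivOp_neg, ← sub_eq_add_neg, iteratedLineDerivOp_compSubConstCLM,
        iteratedLineDerivOp_compSubConstCLM, iteratedLineDerivOp_compSubConstCLM,
        iteratedLineDerivOp_lineDerivOp_comm, _root_.add_apply, _root_.sub_apply,
        compSubConstCLM_apply, compSubConstCLM_apply, compSubConstCLM_apply,
        lineDerivOp_apply_eq_fderiv, sub_sub]
    rw [e2]
    have h2 : C i ≤ ∑ i, C i := Finset.single_le_sum (fun i _ => hC0 i) (Finset.mem_univ i)
    refine (mul_le_mul_of_nonneg_right (one_add_norm_pow_le k x y) (norm_nonneg _)).trans ?_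
    rw [mul_assoc, mul_assoc]
    refine mul_le_mul_of_nonneg_left (h1.trans ?_) (by positivity)
    gcongr
  rw [hasFDerivAt_iff_isLittleO_nhds_zero]
  refine Asymptotics.IsBigO.trans_isLittleO (g := fun v : Rn n => ‖v‖ ^ 2) ?_ ?_
  · refine Asymptotics.IsBigO.of_bound ((1 + ‖y‖) ^ k * ∑ i, C i) ?_
    filter_upwards [Metric.closedBall_mem_nhds (0 : Rn n) one_pos] with v hv
    rw [norm_pow, norm_norm]
    exact key v (mem_closedBall_zero_iff.1 hv)
  · exact Asymptotics.isLittleO_norm_pow_id one_lt_two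

lemma continuous_jet_translate (k N : ℕ) (f : 𝓢(Rn n, ℂ)) :
    Continuous fun y => jet n k N (compSubConstCLM ℂ y f) :=
  continuous_iff_continuousAt.2 fun y =>
    let ⟨_, _, h⟩ := hasFDerivAt_jet_translate k N f y
    h.continuousAt

end Translation

/-! ### Pairing a tempered distribution with moving atoms -/

section Pairing

open LineDeriv

variable {n : ℕ}

lemma atom_eq_translate (φ : 𝓢(Rn n, ℂ)) {r : ℝ} (hr : 0 < r) (y : Rn n) :
    atom φ hr y = compSubConstCLM ℂ y (atom φ hr 0) := by
  ext z
  rw [compSubConstCLM_apply, atom_apply, atom_apply, zero_sub, neg_sub]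

lemma lineDerivOp_atom (φ : 𝓢(Rn n, ℂ)) {r : ℝ} (hr : 0 < r) (y v : Rn n) :
    ∂_{v} (atom φ hr y) = (-(r : ℂ)⁻¹) • atom (∂_{v} φ) hr y := by
  ext z
  rw [_root_.smul_apply, lineDerivOp_apply_eq_fderiv, atom_apply, lineDerivOp_apply_eq_fderiv]
  have h0 : (atom φ hr y : Rn n → ℂ)
      = fun z => ((r : ℂ) ^ n)⁻¹ * φ (r⁻¹ • (y - z)) := by
    funext z
    exact atom_apply φ hr y z
  have hd : HasFDerivAt φ (fderiv ℝ φ (r⁻¹ • (y - z))) (r⁻¹ • (y - z)) :=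
    (((φ.smooth 1).differentiable (by norm_num)) _).hasFDerivAt
  have hi : HasFDerivAt (fun z : Rn n => r⁻¹ • (y - z))
      (r⁻¹ • -ContinuousLinearMap.id ℝ (Rn n)) z :=
    ((hasFDerivAt_id z).const_sub y).const_smul r⁻¹
  have h1 := (hd.comp z hi).const_mul ((r : ℂ) ^ n)⁻¹
  rw [h0]
  refine (congrArg (fun A : Rn n →L[ℝ] ℂ => A v) h1.fderiv).trans ?_
  simp
  ring

lemma hasFDerivAt_apply_atom (u : 𝓢'(Rn n, ℂ)) (φ : 𝓢(Rn n, ℂ)) {r : ℝ} (hr : 0 < r)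
    (y : Rn n) :
    ∃ A : Rn n →L[ℝ] ℂ, (∀ v, A v = (r : ℂ)⁻¹ * u (atom (∂_{v} φ) hr y)) ∧
      HasFDerivAt (fun y => u (atom φ hr y)) A y := by
  obtain ⟨k, N, Λ, hΛ⟩ := exists_eq_comp_jet u
  obtain ⟨A, hA, hd⟩ := hasFDerivAt_jet_translate k N (atom φ hr 0) y
  refine ⟨(Λ.restrictScalars ℝ).comp A, fun v => ?_, ?_⟩
  · have h1 : (Λ.restrictScalars ℝ).comp A v = Λ (A v) := rfl
    rw [h1, hA, map_neg, ← hΛ, lineDerivOp_atom, map_smul, map_smul, ← atom_eq_translate,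
      smul_eq_mul, neg_mul, neg_neg]
  · have h2 : (fun y => u (atom φ hr y))
        = fun y => (Λ.restrictScalars ℝ) (jet n k N (compSubConstCLM ℂ y (atom φ hr 0))) := by
      funext y
      rw [atom_eq_translate, hΛ]
      rfl
    rw [h2]
    exact (Λ.restrictScalars ℝ).hasFDerivAt.comp y hd

lemma fderiv_apply_atom (u : 𝓢'(Rn n, ℂ)) (φ : 𝓢(Rn n, ℂ)) {r : ℝ} (hr : 0 < r) (y v : Rn n) :
    fderiv ℝ (fun y => u (atom φ hr y)) y v = (r : ℂ)⁻¹ * u (atom (∂_{v} φ) hr y) := by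
  obtain ⟨A, hA, hd⟩ := hasFDerivAt_apply_atom u φ hr y
  rw [hd.fderiv, hA]

lemma contDiff_apply_atom (u : 𝓢'(Rn n, ℂ)) (φ : 𝓢(Rn n, ℂ)) {r : ℝ} (hr : 0 < r) :
    ContDiff ℝ ∞ fun y => u (atom φ hr y) := by
  rw [contDiff_infty]
  intro m
  induction m generalizing φ with
  | zero =>
    refine contDiff_zero.2 (continuous_iff_continuousAt.2 fun y => ?_)
    obtain ⟨A, -, hd⟩ := hasFDerivAt_apply_atom u φ hr y
    exact hd.continuousAt
  | succ m ih =>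
    have hcast : ((m + 1 : ℕ) : WithTop ℕ∞) = (m : WithTop ℕ∞) + 1 := by norm_cast
    rw [hcast, contDiff_succ_iff_fderiv_apply]
    refine ⟨fun y => ?_, fun h => by simp at h, fun v => ?_⟩
    · obtain ⟨A, -, hd⟩ := hasFDerivAt_apply_atom u φ hr y
      exact hd.differentiableAt
    · have : (fun y => fderiv ℝ (fun y => u (atom φ hr y)) y v)
          = fun y => (r : ℂ)⁻¹ * u (atom (∂_{v} φ) hr y) := by
        funext y
        exact fderiv_apply_atom u φ hr y v
      rw [this]
      exact contDiff_const.mul (ih (∂_{v} φ))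

/-- Differentiating in the centre of an atom differentiates its profile. -/
lemma iteratedFDeriv_apply_atom (u : 𝓢'(Rn n, ℂ)) {r : ℝ} (hr : 0 < r) {l : ℕ}
    (v : Fin l → Rn n) (φ : 𝓢(Rn n, ℂ)) (y : Rn n) :
    iteratedFDeriv ℝ l (fun y => u (atom φ hr y)) y v
      = ((r : ℂ)⁻¹) ^ l * u (atom (∂^{v} φ) hr y) := by
  induction l generalizing φ with
  | zero => simp
  | succ l ih =>
    have h1 : iteratedFDeriv ℝ (l + 1) (fun y => u (atom φ hr y)) y v
        = iteratedFDeriv ℝ l (fderiv ℝ fun y => u (atom φ hr y)) y (Fin.init v) (v (Fin.last l)) :=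
      iteratedFDeriv_succ_apply_right v
    have hc : ContDiff ℝ l (fderiv ℝ fun y => u (atom φ hr y)) :=
      ((contDiff_apply_atom u φ hr).fderiv_right (m := l) (by exact_mod_cast le_top))
    have h2 := (ContinuousLinearMap.apply ℝ ℂ (v (Fin.last l))).iteratedFDeriv_comp_left
      (hc.contDiffAt (x := y)) (i := l) le_rfl
    have h3 : (ContinuousLinearMap.apply ℝ ℂ (v (Fin.last l))) ∘
        (fderiv ℝ fun y => u (atom φ hr y))
        = fun y => (r : ℂ)⁻¹ • u (atom (∂_{v (Fin.last l)} φ) hr y) := by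
      funext y
      exact fderiv_apply_atom u φ hr y _
    have h4 : iteratedFDeriv ℝ l (fderiv ℝ fun y => u (atom φ hr y)) y (Fin.init v) (v (Fin.last l))
        = iteratedFDeriv ℝ l (fun y => (r : ℂ)⁻¹ • u (atom (∂_{v (Fin.last l)} φ) hr y)) y
          (Fin.init v) := by
      rw [← h3, h2]
      rfl
    rw [h1, h4, iteratedFDeriv_const_smul_apply'
      ((contDiff_infty.1 (contDiff_apply_atom u _ hr) l).contDiffAt), _root_.smul_apply, ih,
      iteratedLineDerivOp_succ_right, smul_eq_mul, pow_succ]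
    ring

lemma hasTemperateGrowth_monom (α : Fin n → ℕ) :
    Function.HasTemperateGrowth fun x : Rn n => (monom α x : ℂ) := by
  have h : ∀ s : Finset (Fin n),
      Function.HasTemperateGrowth fun x : Rn n => ∏ i ∈ s, ((x i : ℝ) : ℂ) ^ α i := by
    intro s
    induction s using Finset.induction_on with
    | empty => simp [Function.HasTemperateGrowth.const]
    | insert i s hi ih =>
      simp_rw [Finset.prod_insert hi]
      have hc : Function.HasTemperateGrowth fun x : Rn n => ((x i : ℝ) : ℂ) :=
        (Complex.ofRealCLM.comp (EuclideanSpace.proj i : Rn n →L[ℝ] ℝ)).hasTemperateGrowth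
      exact (hc.pow (α i)).mul ih
  simpa [monom] using h Finset.univ

lemma atom_one_zero_involutive (φ : 𝓢(Rn n, ℂ)) :
    atom (atom φ one_pos 0) one_pos 0 = φ := by
  ext z
  simp [atom_apply]

lemma lineDerivOp_mem_momentTest {P : ℕ} (v : Rn n) {φ : 𝓢(Rn n, ℂ)} (h : φ ∈ momentTest n P) :
    ∂_{v} φ ∈ momentTest n P := by
  refine ⟨fun α hα => ?_, IsCompact.of_isClosed_subset h.2 (isClosed_tsupport _)
    (tsupport_lineDerivOp_subset v φ)⟩
  -- The moment is a tempered distribution which vanishes on all the translates of `φ`; so does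
  -- its derivative in the translation parameter.
  let u : 𝓢'(Rn n, ℂ) := (hasTemperateGrowth_monom α).toTemperedDistribution volume
  have hu : ∀ f, u f = ∫ x, (monom α x : ℂ) * f x := fun f => by
    refine (Function.HasTemperateGrowth.toTemperedDistribution_apply volume
      (hasTemperateGrowth_monom α) f).trans ?_
    simp [mul_comm]
  have h0 : (fun y => u (atom (atom φ one_pos 0) one_pos y)) = fun _ => 0 := by
    funext y
    rw [hu]
    exact atom_mem_momentSchwartz one_pos y (atom_mem_momentSchwartz one_pos 0 h.1) α hα
  have h1 := fderiv_apply_atom u (atom φ one_pos 0) one_pos 0 v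
  rw [h0] at h1
  have h2 := lineDerivOp_atom (atom φ one_pos 0) one_pos 0 v
  rw [atom_one_zero_involutive] at h2
  rw [← hu, h2, map_smul]
  simp at h1
  simp [← h1]

lemma iteratedLineDerivOp_mem_testFunctions {l : ℕ} (v : Fin l → Rn n) {φ : 𝓢(Rn n, ℂ)}
    (h : φ ∈ testFunctions n) : ∂^{v} φ ∈ testFunctions n :=
  IsCompact.of_isClosed_subset h (isClosed_tsupport _)
    (tsupport_iteratedLineDerivOp_subset v φ)

lemma iteratedLineDerivOp_mem_momentTest {P l : ℕ} (v : Fin l → Rn n) {φ : 𝓢(Rn n, ℂ)}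
    (h : φ ∈ momentTest n P) : ∂^{v} φ ∈ momentTest n P := by
  induction l with
  | zero => simpa using h
  | succ l ih =>
    rw [iteratedLineDerivOp_succ_left]
    exact lineDerivOp_mem_momentTest _ (ih _)

/-! ### Smearing a tempered distribution -/

lemma atom_apply_eq_reflect (φ : 𝓢(Rn n, ℂ)) {r : ℝ} (hr : 0 < r) (x y : Rn n) :
    atom φ hr y x = atom (atom φ one_pos 0) hr x y := by
  rw [atom_apply, atom_apply, atom_apply]
  simp only [inv_one, one_smul, zero_sub, ← smul_neg, neg_sub, Complex.ofReal_one, one_pow, one_mul]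

lemma integral_mul_atom_lineDerivOp (φ f : 𝓢(Rn n, ℂ)) {r : ℝ} (hr : 0 < r) (v x : Rn n) :
    ∫ y, f y * atom (∂_{v} φ) hr y x = -(r : ℂ) * ∫ y, (∂_{v} f : 𝓢(Rn n, ℂ)) y * atom φ hr y x := by
  have hr' : (r : ℂ) ≠ 0 := by exact_mod_cast hr.ne'
  have h1 : ∀ y, f y * atom (∂_{v} φ) hr y x
      = (r : ℂ) * (f y * (∂_{v} (atom (atom φ one_pos 0) hr x) : 𝓢(Rn n, ℂ)) y) := by
    intro y
    have h2 : atom (∂_{v} φ) hr y x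
        = (r : ℂ) * (∂_{v} (atom (atom φ one_pos 0) hr x) : 𝓢(Rn n, ℂ)) y := by
      rw [atom_apply_eq_reflect, lineDerivOp_atom, lineDerivOp_atom, _root_.smul_apply, atom_apply,
        atom_apply _ hr, _root_.smul_apply]
      simp only [smul_eq_mul, Complex.ofReal_one, inv_one]
      field_simp
    rw [h2]
    ring
  rw [integral_congr_ae (Eventually.of_forall fun y =>
    congrArg (fun c => (∂_{v} f : 𝓢(Rn n, ℂ)) y * c) (atom_apply_eq_reflect φ hr x y))]
  simp_rw [h1]
  rw [integral_const_mul, integral_mul_lineDerivOp_right_eq_neg_left]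
  ring

lemma integral_mul_iteratedLineDerivOp_atom {r : ℝ} (hr : 0 < r) (x : Rn n) {l : ℕ}
    (v : Fin l → Rn n) (φ f : 𝓢(Rn n, ℂ)) :
    ∫ y, f y * (∂^{v} (atom φ hr y) : 𝓢(Rn n, ℂ)) x
      = ∫ w, φ w * (∂^{v} f : 𝓢(Rn n, ℂ)) (x + r • w) := by
  have hr' : (r : ℂ) ≠ 0 := by exact_mod_cast hr.ne'
  have h1 : ∫ y, f y * (∂^{v} (atom φ hr y) : 𝓢(Rn n, ℂ)) x
      = ∫ y, (∂^{v} f : 𝓢(Rn n, ℂ)) y * atom φ hr y x := by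
    induction l generalizing φ f with
    | zero => simp
    | succ l ih =>
      have h2 : ∀ y, f y * (∂^{v} (atom φ hr y) : 𝓢(Rn n, ℂ)) x = (-(r : ℂ)⁻¹)
          * (f y * (∂^{Fin.init v} (atom (∂_{v (Fin.last l)} φ) hr y) : 𝓢(Rn n, ℂ)) x) := by
        intro y
        rw [iteratedLineDerivOp_succ_right, lineDerivOp_atom, iteratedLineDerivOp_smul,
          _root_.smul_apply, smul_eq_mul]
        ring
      simp_rw [h2]
      rw [integral_const_mul, ih, integral_mul_atom_lineDerivOp, iteratedLineDerivOp_succ_right,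
        iteratedLineDerivOp_lineDerivOp_comm]
      field_simp
  rw [h1]
  rw [integral_congr_ae (Eventually.of_forall fun y =>
    congrArg (fun c => (∂^{v} f : 𝓢(Rn n, ℂ)) y * c) (atom_apply_eq_reflect φ hr x y)),
    integral_mul_atom, ← integral_neg_eq_self]
  congr 1
  funext w
  simp [atom_apply, mul_comm]

lemma integrable_smul_jet_atom (k N : ℕ) (φ f : 𝓢(Rn n, ℂ)) {r : ℝ} (hr : 0 < r) :
    Integrable fun y => f y • jet n k N (atom φ hr y) := by
  obtain ⟨C, hC0, hC⟩ := exists_norm_jet_translate_le k N (atom φ hr 0)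
  have e : (fun y => f y • jet n k N (atom φ hr y))
      = fun y => f y • jet n k N (compSubConstCLM ℂ y (atom φ hr 0)) := by
    funext y
    rw [← atom_eq_translate]
  rw [e]
  have : SecondCountableTopologyEither (Rn n)
      ((i : Σ l : Fin (N + 1), (Fin l → Fin n)) → BoundedContinuousFunction (Rn n) ℂ) :=
    secondCountableTopologyEither_of_left _ _
  have hint : Integrable fun y : Rn n =>
      C * 2 ^ (k - 1) * (‖y‖ ^ 0 * ‖f y‖ + ‖y‖ ^ k * ‖f y‖) :=
    ((f.integrable_pow_mul volume 0).add (f.integrable_pow_mul volume k)).const_mul _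
  refine hint.mono' (f.continuous.smul
    (continuous_jet_translate k N _)).aestronglyMeasurable (Eventually.of_forall fun y => ?_)
  rw [norm_smul]
  have h1 : (1 + ‖y‖) ^ k ≤ 2 ^ (k - 1) * (1 ^ k + ‖y‖ ^ k) :=
    add_pow_le zero_le_one (norm_nonneg y) k
  calc _ ≤ ‖f y‖ * (C * (2 ^ (k - 1) * (1 ^ k + ‖y‖ ^ k))) := by
        gcongr
        exact (hC y).trans (by gcongr)
    _ = _ := by rw [one_pow, pow_zero]; ring

lemma continuous_jet_translate_smul (k N : ℕ) (f : 𝓢(Rn n, ℂ)) (r : ℝ) :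
    Continuous fun w : Rn n => jet n k N (compSubConstCLM ℂ (-(r • w)) f) :=
  (continuous_jet_translate k N f).comp (by fun_prop)

/-- Fubini's theorem for a tempered distribution: both sides are `u` applied to the convolution of
`f` with a rescaled `φ`. -/
lemma integral_apply_atom_mul (u : 𝓢'(Rn n, ℂ)) {φ : 𝓢(Rn n, ℂ)} (hφ : φ ∈ testFunctions n)
    (f : 𝓢(Rn n, ℂ)) {r : ℝ} (hr : 0 < r) :
    ∫ y, u (atom φ hr y) * f y = ∫ w, φ w * u (compSubConstCLM ℂ (-(r • w)) f) := by
  obtain ⟨k, N, Λ, hΛ⟩ := exists_eq_comp_jet u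
  have hi1 := integrable_smul_jet_atom k N φ f hr
  have hi2 : Integrable fun w => φ w • jet n k N (compSubConstCLM ℂ (-(r • w)) f) :=
    (φ.continuous.smul (continuous_jet_translate_smul k N f r)).integrable_of_hasCompactSupport
      (HasCompactSupport.smul_right hφ)
  have key : ∫ y, f y • jet n k N (atom φ hr y)
      = ∫ w, φ w • jet n k N (compSubConstCLM ℂ (-(r • w)) f) := by
    funext i
    ext x
    let ev := (BoundedContinuousFunction.evalCLM ℂ x (β := ℂ)).comp
      (ContinuousLinearMap.proj (R := ℂ)
        (φ := fun _ : Σ l : Fin (N + 1), (Fin l → Fin n) =>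
          BoundedContinuousFunction (Rn n) ℂ) i)
    have hev : ∀ g, ev (jet n k N g) = (((1 + ‖x‖) ^ k : ℝ) : ℂ)
        * (∂^{fun j => (basisVec (i.2 j) : Rn n)} g : 𝓢(Rn n, ℂ)) x := fun g => rfl
    have h1 := ev.integral_comp_comm hi1
    have h2 := ev.integral_comp_comm hi2
    refine h1.symm.trans (Eq.trans ?_ h2)
    have e : ∀ a b c : ℂ, a * (b * c) = b * (a * c) := fun a b c => mul_left_comm a b c
    simp only [map_smul, hev, smul_eq_mul]
    simp_rw [fun c d : ℂ => e c (((1 + ‖x‖) ^ k : ℝ) : ℂ) d,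
      iteratedLineDerivOp_compSubConstCLM, compSubConstCLM_apply, sub_neg_eq_add]
    rw [integral_const_mul, integral_const_mul, integral_mul_iteratedLineDerivOp_atom]
  have h1 := Λ.integral_comp_comm hi1
  have h2 := Λ.integral_comp_comm hi2
  rw [key, ← h2] at h1
  simp only [map_smul, ← hΛ, smul_eq_mul] at h1
  simp_rw [mul_comm (u _)]
  exact h1

/-- Atoms with integral one form an approximate identity on tempered distributions. -/
lemma tendsto_integral_apply_atom_mul (u : 𝓢'(Rn n, ℂ)) {φ : 𝓢(Rn n, ℂ)}
    (hφ : φ ∈ testFunctions n) (hφ1 : ∫ w, φ w = 1) (f : 𝓢(Rn n, ℂ)) {r : ℕ → ℝ}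
    (hr : ∀ j, 0 < r j) (hr0 : Tendsto r atTop (𝓝 0)) :
    Tendsto (fun j => ∫ y, u (atom φ (hr j) y) * f y) atTop (𝓝 (u f)) := by
  obtain ⟨k, N, Λ, hΛ⟩ := exists_eq_comp_jet u
  have hcont : Continuous fun y => u (compSubConstCLM ℂ y f) := by
    simp_rw [hΛ]
    exact Λ.continuous.comp (continuous_jet_translate k N f)
  have hu0 : u f = ∫ w, φ w * u (compSubConstCLM ℂ 0 f) := by
    rw [integral_mul_const, hφ1, one_mul, compSubConstCLM_zero]
    rfl
  rw [hu0]
  simp_rw [integral_apply_atom_mul u hφ f]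
  obtain ⟨ρ, hρ1, hρ⟩ := exists_tsupport_subset_closedBall hφ
  obtain ⟨R, hR⟩ := (Metric.isBounded_range_of_tendsto r hr0).subset_closedBall 0
  have hR0 : 0 ≤ R := by
    have h := hR ⟨0, rfl⟩
    exact dist_nonneg.trans (Metric.mem_closedBall.1 h)
  obtain ⟨A, hA⟩ := (isCompact_closedBall (0 : Rn n) (R * ρ)).exists_bound_of_continuousOn
    hcont.continuousOn
  refine tendsto_integral_of_dominated_convergence (fun w => ‖φ w‖ * A) (fun j => ?_)
    (φ.integrable.norm.mul_const A) (fun j => Eventually.of_forall fun w => ?_)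
    (Eventually.of_forall fun w => ?_)
  · exact (φ.continuous.mul (hcont.comp (by fun_prop))).aestronglyMeasurable
  · rw [norm_mul]
    by_cases hw : φ w = 0
    · simp [hw]
    · have hw' : ‖w‖ ≤ ρ := mem_closedBall_zero_iff.1 (hρ (subset_tsupport _ hw))
      have hrj : |r j| ≤ R := by
        have h := hR ⟨j, rfl⟩
        rwa [mem_closedBall_zero_iff] at h
      refine mul_le_mul_of_nonneg_left (hA _ ?_) (norm_nonneg _)
      rw [mem_closedBall_zero_iff, norm_neg, norm_smul, Real.norm_eq_abs]
      gcongr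
  · refine tendsto_const_nhds.mul ((hcont.tendsto 0).comp ?_)
    have := (hr0.smul_const w).neg
    simpa using this

end Pairing

/-! ### Decay of the pairings of two atoms -/

/-- Almost orthogonality: the pairing of two atoms decays in the ratio of the scales and in the
distance of the centres. At distances beyond the supports this is the regularity of the kernel;
near the diagonal it is the cancellation `T* (x ^ α) = 0`. -/
lemma exists_norm_transpose_apply_atom_atom_le {n M L P₀ P : ℕ} {γ ν δ : ℝ}
    (hγ : 0 < γ) (hγ1 : γ ≤ 1) (hδ0 : 0 < δ) (hδγ : δ < γ) (hLM : (L : ℝ) ≤ M + ν)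
    {T Tstar : momentSchwartz n P₀ →ₗ[ℂ] 𝓢'(Rn n, ℂ)} (hT : IsSIO ν M γ T Tstar)
    {m J : ℕ} {CW : ℝ} (hCW : 0 ≤ CW)
    (hW : IsWeaklyBounded ν m J CW T) {Q : ℕ} (hvan : VanishesOnPolys L Q Tstar) (hn : 0 < n)
    (hP : P₀ ≤ P) (hMP : M ≤ P) (hmP : m ≤ P) (hQP : Q ≤ P) {φ ψ : 𝓢(Rn n, ℂ)}
    (hφ : φ ∈ momentTest n P) (hψ : ψ ∈ momentTest n P) :
    ∃ C : ℝ, 0 ≤ C ∧ ∀ (r t : ℝ) (hr : 0 < r) (ht : 0 < t) (x y : Rn n)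
      (hx : atom ψ ht x ∈ momentSchwartz n P₀), r ≤ t →
        ‖Tstar ⟨atom ψ ht x, hx⟩ (atom φ hr y)‖
          ≤ C * (r / t) ^ (L - ν + δ) * t ^ (-(n + ν))
            * (1 + ‖x - y‖ / t) ^ (-(n + ν + M + γ)) := by
  have hN : 0 < n + ν + M + γ := by
    have : (0 : ℝ) ≤ L := Nat.cast_nonneg L
    have : (0 : ℝ) ≤ n := Nat.cast_nonneg n
    linarith
  obtain ⟨⟨K, hK, hS⟩, -⟩ := hT.exists_kernel hγ
  obtain ⟨ρ₁, hρ₁1, hρ₁⟩ := exists_tsupport_subset_closedBall hψ.2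
  obtain ⟨ρ₂, hρ₂1, hρ₂⟩ := exists_tsupport_subset_closedBall hφ.2
  set ρ := max ρ₁ ρ₂ with hρdef
  have hρ1 : 1 ≤ ρ := hρ₁1.trans (le_max_left _ _)
  have hψρ : tsupport ψ ⊆ Metric.closedBall 0 ρ :=
    hρ₁.trans (Metric.closedBall_subset_closedBall (le_max_left _ _))
  have hφρ : tsupport φ ⊆ Metric.closedBall 0 ρ :=
    hρ₂.trans (Metric.closedBall_subset_closedBall (le_max_right _ _))
  obtain ⟨C₁, hC₁0, hC₁⟩ := exists_norm_apply_atom_atom_le_of_far hγ hN hK hS hMP hφ hψ.2 hρ1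
    hφρ hψρ
  obtain ⟨C₂, hC₂0, hC₂⟩ := exists_norm_apply_atom_atom_le_of_le hγ hγ1 hδ0 hδγ hLM hT.transpose
    hK hS hCW hW hvan hn hMP hmP hQP hφ hψ.2
  refine ⟨C₁ + C₂ * (1 + 4 * ρ) ^ (n + ν + M + γ), by positivity,
    fun r t hr ht x y hx hrt => ?_⟩
  have hy : atom φ hr y ∈ momentSchwartz n P₀ :=
    momentSchwartz_anti hP (atom_mem_momentSchwartz hr y hφ.1)
  have htr := hT.transpose ⟨atom φ hr y, hy⟩ ⟨atom ψ ht x, hx⟩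
  rw [← htr]
  have hrt0 : 0 < r / t := by positivity
  have hrt1 : r / t ≤ 1 := (div_le_one ht).2 hrt
  set d := 1 + ‖x - y‖ / t with hd
  have hd0 : 0 < d := by positivity
  rcases le_or_gt (4 * ρ * t) ‖x - y‖ with hfar | hnear
  · refine (hC₁ r t hr ht x y hy hrt hfar).trans ?_
    have h1 : (r / t) ^ (M + γ) ≤ (r / t) ^ (L - ν + δ) :=
      Real.rpow_le_rpow_of_exponent_ge hrt0 hrt1 (by linarith)
    gcongr
    exact le_add_of_nonneg_right (by positivity)
  · refine (hC₂ r t hr ht x y hy hx hrt).trans ?_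
    have h1 : d ≤ 1 + 4 * ρ := by
      rw [hd]
      gcongr
      exact (div_le_iff₀ ht).2 hnear.le
    have h2 : 1 ≤ (1 + 4 * ρ) ^ (n + ν + M + γ) * d ^ (-(n + ν + M + γ)) := by
      rw [Real.rpow_neg hd0.le, ← div_eq_mul_inv, one_le_div (by positivity)]
      exact Real.rpow_le_rpow hd0.le h1 hN.le
    have h3 : 0 ≤ (r / t) ^ (L - ν + δ) * t ^ (-(n + ν)) := by positivity
    calc C₂ * (r / t) ^ (L - ν + δ) * t ^ (-(n + ν))
        ≤ C₂ * (r / t) ^ (L - ν + δ) * t ^ (-(n + ν))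
          * ((1 + 4 * ρ) ^ (n + ν + M + γ) * d ^ (-(n + ν + M + γ))) :=
          le_mul_of_one_le_right (by positivity) h2
      _ = (C₂ * (1 + 4 * ρ) ^ (n + ν + M + γ)) * (r / t) ^ (L - ν + δ) * t ^ (-(n + ν))
          * d ^ (-(n + ν + M + γ)) := by ring
      _ ≤ _ := by
        gcongr
        exact le_add_of_nonneg_left hC₁0

/-! ### Sums of smooth functions at dyadic scales -/

section DyadicSeries

variable {n : ℕ}

lemma one_add_norm_div_rpow_le {N t : ℝ} (hN : 0 ≤ N) (ht : 0 < t) {x y h : Rn n}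
    (hh : ‖h‖ ≤ (t + ‖x - y‖) / 2) :
    (1 + ‖x - (y + h)‖ / t) ^ (-N) ≤ 2 ^ N * (1 + ‖x - y‖ / t) ^ (-N) := by
  have h1 : ‖x - y‖ - ‖h‖ ≤ ‖x - (y + h)‖ := by
    rw [← sub_sub]
    exact norm_sub_norm_le _ _
  have h2 : (1 + ‖x - y‖ / t) / 2 ≤ 1 + ‖x - (y + h)‖ / t := by
    have h3 : (‖x - y‖ - (t + ‖x - y‖) / 2) / t ≤ ‖x - (y + h)‖ / t := by
      gcongr
      linarith
    have h4 : (‖x - y‖ - (t + ‖x - y‖) / 2) / t = (‖x - y‖ / t - 1) / 2 := by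
      field_simp
      ring
    linarith
  have h5 : 0 < (1 + ‖x - y‖ / t) / 2 := by positivity
  refine (Real.rpow_le_rpow_of_nonpos h5 h2 (by linarith)).trans (le_of_eq ?_)
  rw [Real.div_rpow (by positivity) zero_le_two, Real.rpow_neg zero_le_two, div_inv_eq_mul,
    mul_comm]

/-- Smooth functions `F j` that live at the scales `t 2 ^ (-j)` around their centre `x`: up to the
order `m`, a derivative of order `l` of `F j` is bounded by `2 ^ (j (l - s)) t ^ (-l)` times the weight
`(1 + |x - y| / t) ^ (-N)`. -/
structure IsDyadicFamily (m : ℕ) (s N A t : ℝ) (x : Rn n) (F : ℕ → Rn n → ℂ) : Prop where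
  contDiff : ∀ j, ContDiff ℝ ∞ (F j)
  bound : ∀ l ≤ m, ∀ j y, ‖iteratedFDeriv ℝ l (F j) y‖
    ≤ A * (t⁻¹) ^ l * ((2 : ℝ) ^ ((l : ℝ) - s)) ^ j * (1 + ‖x - y‖ / t) ^ (-N)

variable {m : ℕ} {s N A t : ℝ} {x : Rn n} {F : ℕ → Rn n → ℂ}

lemma one_add_rpow_neg_le_one (hN : 0 ≤ N) (ht : 0 < t) (y : Rn n) :
    (1 + ‖x - y‖ / t) ^ (-N) ≤ 1 :=
  Real.rpow_le_one_of_one_le_of_nonpos (le_add_of_nonneg_right (by positivity)) (by linarith)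

lemma two_rpow_lt_one {a : ℝ} (ha : a < 0) : (2 : ℝ) ^ a < 1 :=
  Real.rpow_lt_one_of_one_lt_of_neg one_lt_two ha

namespace IsDyadicFamily

lemma bound_one (h : IsDyadicFamily m s N A t x F) (hN : 0 ≤ N) (ht : 0 < t) (hA : 0 ≤ A) {l : ℕ}
    (hl : l ≤ m) (j : ℕ) (y : Rn n) : ‖iteratedFDeriv ℝ l (F j) y‖
      ≤ A * (t⁻¹) ^ l * ((2 : ℝ) ^ ((l : ℝ) - s)) ^ j :=
  (h.bound l hl j y).trans (mul_le_of_le_one_right (by positivity)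
    (one_add_rpow_neg_le_one hN ht y))

lemma summable_bound {l : ℕ} (B : ℝ) (hl : (l : ℝ) < s) :
    Summable fun j : ℕ => B * ((2 : ℝ) ^ ((l : ℝ) - s)) ^ j :=
  (summable_geometric_of_lt_one (by positivity) (two_rpow_lt_one (by linarith))).mul_left _

lemma cast_lt (hs : (m : ℝ) < s) {l : ℕ} (hl : l ≤ m) : (l : ℝ) < s :=
  lt_of_le_of_lt (by exact_mod_cast hl) hs

lemma contDiff_tsum (h : IsDyadicFamily m s N A t x F) (hs : (m : ℝ) < s) (hN : 0 ≤ N)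
    (ht : 0 < t) (hA : 0 ≤ A) : ContDiff ℝ m fun y => ∑' j, F j y := by
  refine _root_.contDiff_tsum (v := fun l j => A * (t⁻¹) ^ l * ((2 : ℝ) ^ ((l : ℝ) - s)) ^ j)
    (fun j => (h.contDiff j).of_le (by exact_mod_cast le_top)) (fun l hl => ?_)
    (fun l j y hl => h.bound_one hN ht hA (by exact_mod_cast hl) j y)
  exact summable_bound _ (cast_lt hs (by exact_mod_cast hl))

lemma iteratedFDeriv_tsum (h : IsDyadicFamily m s N A t x F) (hs : (m : ℝ) < s) (hN : 0 ≤ N)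
    (ht : 0 < t) (hA : 0 ≤ A) {l : ℕ} (hl : l ≤ m) (y : Rn n) :
    iteratedFDeriv ℝ l (fun y => ∑' j, F j y) y = ∑' j, iteratedFDeriv ℝ l (F j) y := by
  refine congrFun (_root_.iteratedFDeriv_tsum (N := m)
    (v := fun l j => A * (t⁻¹) ^ l * ((2 : ℝ) ^ ((l : ℝ) - s)) ^ j)
    (fun j => (h.contDiff j).of_le (by exact_mod_cast le_top)) (fun l hl => ?_)
    (fun l j y hl => h.bound_one hN ht hA (by exact_mod_cast hl) j y) (by exact_mod_cast hl)) y
  exact summable_bound _ (cast_lt hs (by exact_mod_cast hl))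

lemma summable_iteratedFDeriv (h : IsDyadicFamily m s N A t x F) (hs : (m : ℝ) < s) (hN : 0 ≤ N)
    (ht : 0 < t) (hA : 0 ≤ A) {l : ℕ} (hl : l ≤ m) (y : Rn n) :
    Summable fun j => iteratedFDeriv ℝ l (F j) y :=
  Summable.of_norm_bounded (summable_bound _ (cast_lt hs hl)) fun j => h.bound_one hN ht hA hl j y

lemma norm_iteratedFDeriv_tsum_le (h : IsDyadicFamily m s N A t x F) (hs : (m : ℝ) < s)
    (hN : 0 ≤ N) (ht : 0 < t) (hA : 0 ≤ A) {l : ℕ} (hl : l ≤ m) (y : Rn n) :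
    ‖iteratedFDeriv ℝ l (fun y => ∑' j, F j y) y‖
      ≤ A * (1 - (2 : ℝ) ^ ((l : ℝ) - s))⁻¹ * (t⁻¹) ^ l * (1 + ‖x - y‖ / t) ^ (-N) := by
  rw [h.iteratedFDeriv_tsum hs hN ht hA hl]
  have hg := hasSum_geometric_of_lt_one (r := (2 : ℝ) ^ ((l : ℝ) - s)) (by positivity)
    (two_rpow_lt_one (by linarith [cast_lt hs hl]))
  refine (tsum_of_norm_bounded (hg.mul_left (A * (t⁻¹) ^ l * (1 + ‖x - y‖ / t) ^ (-N)))
    fun j => (h.bound l hl j y).trans (le_of_eq (by ring))).trans (le_of_eq (by ring))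

/-- The derivative of top order is Hölder continuous: interpolate, term by term, between the bound
for the derivative of order `m` and the one for the derivative of order `m + 1`. -/
lemma norm_iteratedFDeriv_tsum_sub_le (h : IsDyadicFamily (m + 1) s N A t x F) (hs : (m : ℝ) < s)
    (hN : 0 ≤ N) (ht : 0 < t) (hA : 0 ≤ A) {κ : ℝ} (hκ0 : 0 < κ) (hκ1 : κ ≤ 1)
    (hκs : m + κ < s) {y v : Rn n} (hv : ‖v‖ ≤ (t + ‖x - y‖) / 2) :
    ‖iteratedFDeriv ℝ m (fun y => ∑' j, F j y) (y + v)
        - iteratedFDeriv ℝ m (fun y => ∑' j, F j y) y‖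
      ≤ A * (2 ^ N + 1) * (1 - (2 : ℝ) ^ (m + κ - s))⁻¹ * (t⁻¹) ^ m * (t⁻¹ * ‖v‖) ^ κ
        * (1 + ‖x - y‖ / t) ^ (-N) := by
  have h' : IsDyadicFamily m s N A t x F := ⟨h.contDiff, fun l hl => h.bound l (by omega)⟩
  rw [h'.iteratedFDeriv_tsum hs hN ht hA le_rfl, h'.iteratedFDeriv_tsum hs hN ht hA le_rfl,
    ← Summable.tsum_sub (h'.summable_iteratedFDeriv hs hN ht hA le_rfl _)
      (h'.summable_iteratedFDeriv hs hN ht hA le_rfl _)]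
  set w := (1 + ‖x - y‖ / t) ^ (-N) with hw
  have hw0 : 0 ≤ w := by positivity
  have hg := hasSum_geometric_of_lt_one (r := (2 : ℝ) ^ (m + κ - s)) (by positivity)
    (two_rpow_lt_one (by linarith))
  refine (tsum_of_norm_bounded (hg.mul_left (A * (2 ^ N + 1) * (t⁻¹) ^ m * (t⁻¹ * ‖v‖) ^ κ * w))
    fun j => ?_).trans (le_of_eq (by ring))
  have hwv : ∀ v' : Rn n, ‖v'‖ ≤ ‖v‖ → (1 + ‖x - (y + v')‖ / t) ^ (-N) ≤ 2 ^ N * w := fun v' hv' =>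
    one_add_norm_div_rpow_le hN ht (hv'.trans hv)
  set b := (2 : ℝ) ^ ((m : ℝ) - s) with hb
  have hb0 : 0 < b := by positivity
  set p := 2 ^ j * (t⁻¹ * ‖v‖) with hp
  have hp0 : 0 ≤ p := by positivity
  set D := A * (t⁻¹) ^ m * b ^ j * w with hD
  have hD0 : 0 ≤ D := by positivity
  have h1 : ‖iteratedFDeriv ℝ m (F j) (y + v) - iteratedFDeriv ℝ m (F j) y‖ ≤ D * (2 ^ N + 1) := by
    have e1 := h'.bound m le_rfl j (y + v)
    have e2 := h'.bound m le_rfl j y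
    have e3 : A * (t⁻¹) ^ m * b ^ j * (1 + ‖x - (y + v)‖ / t) ^ (-N)
        ≤ A * (t⁻¹) ^ m * b ^ j * (2 ^ N * w) := by
      gcongr
      exact hwv v le_rfl
    refine (norm_sub_le _ _).trans ((add_le_add (e1.trans e3) e2).trans (le_of_eq ?_))
    rw [hD]; ring
  have h2 : ‖iteratedFDeriv ℝ m (F j) (y + v) - iteratedFDeriv ℝ m (F j) y‖
      ≤ D * (2 ^ N + 1) * p := by
    have hd : Differentiable ℝ (iteratedFDeriv ℝ m (F j)) :=
      (h.contDiff j).differentiable_iteratedFDeriv (by exact_mod_cast WithTop.coe_lt_top m)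
    have hbd : ∀ z ∈ Metric.closedBall y ‖v‖, ‖fderiv ℝ (iteratedFDeriv ℝ m (F j)) z‖
        ≤ A * (t⁻¹) ^ (m + 1) * ((2 : ℝ) ^ (((m + 1 : ℕ) : ℝ) - s)) ^ j * (2 ^ N * w) := by
      intro z hz
      rw [norm_fderiv_iteratedFDeriv]
      refine (h.bound (m + 1) le_rfl j z).trans ?_
      gcongr
      have := hwv (z - y) (mem_closedBall_iff_norm.1 hz)
      rwa [add_sub_cancel] at this
    have e := (convex_closedBall y ‖v‖).norm_image_sub_le_of_norm_fderiv_le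
      (fun z _ => hd z) hbd (Metric.mem_closedBall_self (norm_nonneg _))
      (show y + v ∈ Metric.closedBall y ‖v‖ by simp)
    rw [add_sub_cancel_left] at e
    refine e.trans ?_
    have e4 : (2 : ℝ) ^ (((m + 1 : ℕ) : ℝ) - s) = 2 * b := by
      rw [hb, Nat.cast_add, Nat.cast_one, add_sub_right_comm, Real.rpow_add two_pos, Real.rpow_one,
        mul_comm]
    rw [e4, mul_pow]
    calc A * (t⁻¹) ^ (m + 1) * (2 ^ j * b ^ j) * (2 ^ N * w) * ‖v‖
        = D * 2 ^ N * p := by rw [hD, hp]; ring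
      _ ≤ _ := by
        gcongr
        exact le_add_of_nonneg_right zero_le_one
  have h3 : ‖iteratedFDeriv ℝ m (F j) (y + v) - iteratedFDeriv ℝ m (F j) y‖
      ≤ D * (2 ^ N + 1) * p ^ κ := by
    have hE : 0 ≤ D * (2 ^ N + 1) := by positivity
    rcases le_total p 1 with hp1 | hp1
    · refine h2.trans (mul_le_mul_of_nonneg_left ?_ hE)
      exact Real.self_le_rpow_of_le_one hp0 hp1 hκ1
    · refine h1.trans (le_mul_of_one_le_right hE (Real.one_le_rpow hp1 hκ0.le))
  refine h3.trans (le_of_eq ?_)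
  have e5 : p ^ κ = ((2 : ℝ) ^ κ) ^ j * (t⁻¹ * ‖v‖) ^ κ := by
    rw [hp, Real.mul_rpow (by positivity) (by positivity), ← Real.rpow_natCast, ← Real.rpow_mul
      zero_le_two, mul_comm (j : ℝ), Real.rpow_mul zero_le_two, Real.rpow_natCast]
  have e6 : (2 : ℝ) ^ (m + κ - s) = b * 2 ^ κ := by
    rw [hb, ← Real.rpow_add two_pos]
    congr 1
    ring
  rw [e5, e6, hD, mul_pow]
  ring

end IsDyadicFamily

end DyadicSeries

/-! ### The kernel of the smoothed operator -/

section SmoothedKernel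

open LineDeriv

variable {n : ℕ}

lemma atom_congr (φ : 𝓢(Rn n, ℂ)) {r r' : ℝ} (hr : 0 < r) (hr' : 0 < r') (h : r = r') (y : Rn n) :
    atom φ hr y = atom φ hr' y := by
  subst h
  rfl

/-- The terms of the telescoping series `u (φ_t) + ∑ⱼ u (φ_{t / 2 ^ (j + 1)} - φ_{t / 2 ^ j})`, as
functions of the centre of the atoms; here `χ` is the dyadic difference of `φ`. -/
noncomputable def dyadicTerm (u : 𝓢'(Rn n, ℂ)) (φ χ : 𝓢(Rn n, ℂ)) {t : ℝ} (ht : 0 < t) :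
    ℕ → Rn n → ℂ
  | 0, y => u (atom φ ht y)
  | j + 1, y => u (atom χ (div_pos ht (pow_pos two_pos j)) y)

lemma sum_range_dyadicTerm (u : 𝓢'(Rn n, ℂ)) {φ χ : 𝓢(Rn n, ℂ)}
    (hχ : ∀ (r : ℝ) (hr : 0 < r) (y : Rn n), atom φ (half_pos hr) y - atom φ hr y = atom χ hr y)
    {t : ℝ} (ht : 0 < t) (J : ℕ) (y : Rn n) :
    ∑ j ∈ Finset.range (J + 1), dyadicTerm u φ χ ht j y
      = u (atom φ (div_pos ht (pow_pos two_pos J)) y) := by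
  induction J with
  | zero =>
    rw [zero_add, Finset.sum_range_one]
    exact congrArg u (atom_congr φ _ _ (by simp) y)
  | succ J ih =>
    rw [Finset.sum_range_succ, ih]
    have h := hχ _ (div_pos ht (pow_pos two_pos J)) y
    have e : dyadicTerm u φ χ ht (J + 1) y = u (atom χ (div_pos ht (pow_pos two_pos J)) y) := rfl
    rw [e, ← h, map_sub, add_sub_cancel]
    exact congrArg u (atom_congr φ _ _ (by rw [pow_succ]; field_simp) y)

lemma norm_iteratedFDeriv_apply_atom_le (u : 𝓢'(Rn n, ℂ)) {r : ℝ} (hr : 0 < r) (l : ℕ)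
    (φ : 𝓢(Rn n, ℂ)) (y : Rn n) {c : (Fin l → Fin n) → ℝ}
    (h : ∀ σ, ‖u (atom (∂^{fun j => (basisVec (σ j) : Rn n)} φ) hr y)‖ ≤ c σ) :
    ‖iteratedFDeriv ℝ l (fun y => u (atom φ hr y)) y‖ ≤ (r⁻¹) ^ l * ∑ σ, c σ := by
  refine (norm_multilinear_le_sum_basisVec _).trans ?_
  rw [Finset.mul_sum]
  refine Finset.sum_le_sum fun σ _ => ?_
  rw [iteratedFDeriv_apply_atom, norm_mul, norm_pow, norm_inv, Complex.norm_real, Real.norm_eq_abs,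
    abs_of_pos hr]
  gcongr
  exact h σ

lemma sum_fiber_le {m : ℕ} {C : (Σ l : Fin (m + 1), (Fin l → Fin n)) → ℝ} (hC : ∀ i, 0 ≤ C i)
    {l : ℕ} (hl : l < m + 1) : ∑ σ, C ⟨⟨l, hl⟩, σ⟩ ≤ ∑ i, C i := by
  rw [Fintype.sum_sigma]
  exact Finset.single_le_sum (f := fun l => ∑ σ, C ⟨l, σ⟩)
    (fun l _ => Finset.sum_nonneg fun σ _ => hC _) (Finset.mem_univ (⟨l, hl⟩ : Fin (m + 1)))

/-- The terms of the telescoping series inherit their bounds from those for the pairings of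
atoms, since their derivatives are pairings of the same kind. -/
lemma exists_isDyadicFamily_dyadicTerm {P₀ P : ℕ} {ν s N : ℝ}
    {S : momentSchwartz n P₀ →ₗ[ℂ] 𝓢'(Rn n, ℂ)} {ψ φ χ : 𝓢(Rn n, ℂ)}
    (hcoarse : ∀ φ ∈ testFunctions n, ∃ C : ℝ, 0 ≤ C ∧ ∀ (t : ℝ) (ht : 0 < t) (x y : Rn n)
      (hx : atom ψ ht x ∈ momentSchwartz n P₀),
        ‖S ⟨atom ψ ht x, hx⟩ (atom φ ht y)‖
          ≤ C * t ^ (-(n + ν)) * (1 + ‖x - y‖ / t) ^ (-N))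
    (hfine : ∀ φ ∈ momentTest n P, ∃ C : ℝ, 0 ≤ C ∧ ∀ (r t : ℝ) (hr : 0 < r) (ht : 0 < t)
      (x y : Rn n) (hx : atom ψ ht x ∈ momentSchwartz n P₀), r ≤ t →
        ‖S ⟨atom ψ ht x, hx⟩ (atom φ hr y)‖
          ≤ C * (r / t) ^ s * t ^ (-(n + ν)) * (1 + ‖x - y‖ / t) ^ (-N))
    (hφ : φ ∈ testFunctions n) (hχ : χ ∈ momentTest n P) (m : ℕ) :
    ∃ A : ℝ, 0 ≤ A ∧ ∀ (t : ℝ) (ht : 0 < t) (x : Rn n) (hx : atom ψ ht x ∈ momentSchwartz n P₀),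
      IsDyadicFamily m s N (A * t ^ (-(n + ν))) t x
        (dyadicTerm (S ⟨atom ψ ht x, hx⟩) φ χ ht) := by
  choose C₀ hC₀0 hC₀ using fun i : Σ l : Fin (m + 1), (Fin l → Fin n) =>
    hcoarse _ (iteratedLineDerivOp_mem_testFunctions (fun j => (basisVec (i.2 j) : Rn n)) hφ)
  choose C₁ hC₁0 hC₁ using fun i : Σ l : Fin (m + 1), (Fin l → Fin n) =>
    hfine _ (iteratedLineDerivOp_mem_momentTest (fun j => (basisVec (i.2 j) : Rn n)) hχ)
  have hS₀ : 0 ≤ ∑ i, C₀ i := Finset.sum_nonneg fun i _ => hC₀0 i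
  have hS₁ : 0 ≤ ∑ i, C₁ i := Finset.sum_nonneg fun i _ => hC₁0 i
  refine ⟨∑ i, C₀ i + 2 ^ s * ∑ i, C₁ i, by positivity, fun t ht x hx =>
    ⟨fun j => ?_, fun l hl j y => ?_⟩⟩
  · cases j with
    | zero => exact contDiff_apply_atom _ φ ht
    | succ j => exact contDiff_apply_atom _ χ _
  · set w := (1 + ‖x - y‖ / t) ^ (-N) with hw
    have hw0 : 0 ≤ w := by positivity
    have hl' : l < m + 1 := Nat.lt_succ_of_le hl
    cases j with
    | zero =>
      have h1 := norm_iteratedFDeriv_apply_atom_le (S ⟨atom ψ ht x, hx⟩) ht l φ y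
        fun σ => hC₀ ⟨⟨l, hl'⟩, σ⟩ t ht x y hx
      refine h1.trans ?_
      rw [← Finset.sum_mul, ← Finset.sum_mul, pow_zero, mul_one]
      have h2 := sum_fiber_le hC₀0 hl'
      calc (t⁻¹) ^ l * ((∑ σ, C₀ ⟨⟨l, hl'⟩, σ⟩) * t ^ (-(n + ν)) * w)
          ≤ (t⁻¹) ^ l * ((∑ i, C₀ i + 2 ^ s * ∑ i, C₁ i) * t ^ (-(n + ν)) * w) := by
            gcongr
            exact h2.trans (le_add_of_nonneg_right (by positivity))
        _ = _ := by ring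
    | succ j =>
      have hr : 0 < t / 2 ^ j := div_pos ht (pow_pos two_pos j)
      have hrt : t / 2 ^ j ≤ t := div_le_self ht.le (one_le_pow₀ one_le_two)
      have h1 := norm_iteratedFDeriv_apply_atom_le (S ⟨atom ψ ht x, hx⟩) hr l χ y
        fun σ => hC₁ ⟨⟨l, hl'⟩, σ⟩ _ t hr ht x y hx hrt
      refine h1.trans ?_
      rw [← Finset.sum_mul, ← Finset.sum_mul, ← Finset.sum_mul]
      have h2 := sum_fiber_le hC₁0 hl'
      set b := (2 : ℝ) ^ ((l : ℝ) - s) with hb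
      have hb0 : 0 < b := by positivity
      have e1 : (t / 2 ^ j / t) ^ s = ((2 : ℝ) ^ (-s)) ^ j := by
        have e : t / 2 ^ j / t = (2 : ℝ) ^ (-(j : ℝ)) := by
          rw [Real.rpow_neg zero_le_two, Real.rpow_natCast]
          field_simp
        rw [e, ← Real.rpow_mul zero_le_two, ← Real.rpow_natCast, ← Real.rpow_mul zero_le_two]
        congr 1
        ring
      have e2 : ((t / 2 ^ j)⁻¹) ^ l = (t⁻¹) ^ l * ((2 : ℝ) ^ (l : ℝ)) ^ j := by
        rw [inv_div, div_eq_inv_mul, mul_pow, Real.rpow_natCast, ← pow_mul, ← pow_mul, mul_comm j]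
      have e3 : ((2 : ℝ) ^ (l : ℝ)) ^ j * ((2 : ℝ) ^ (-s)) ^ j = b ^ j := by
        rw [← mul_pow, ← Real.rpow_add two_pos, hb, sub_eq_add_neg]
      have e4 : b ^ j ≤ 2 ^ s * b ^ (j + 1) := by
        have e5 : 1 ≤ 2 ^ s * b := by
          rw [hb, ← Real.rpow_add two_pos, add_sub_cancel]
          exact Real.one_le_rpow one_le_two (Nat.cast_nonneg l)
        calc b ^ j ≤ (2 ^ s * b) * b ^ j := le_mul_of_one_le_left (by positivity) e5
          _ = _ := by ring
      rw [e1, e2]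
      calc (t⁻¹) ^ l * ((2 : ℝ) ^ (l : ℝ)) ^ j * ((∑ σ, C₁ ⟨⟨l, hl'⟩, σ⟩) * ((2 : ℝ) ^ (-s)) ^ j
            * t ^ (-(n + ν)) * w)
          = (∑ σ, C₁ ⟨⟨l, hl'⟩, σ⟩) * t ^ (-(n + ν)) * (t⁻¹) ^ l
            * (((2 : ℝ) ^ (l : ℝ)) ^ j * ((2 : ℝ) ^ (-s)) ^ j) * w := by ring
        _ ≤ (∑ i, C₁ i) * t ^ (-(n + ν)) * (t⁻¹) ^ l * (2 ^ s * b ^ (j + 1)) * w := by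
          rw [e3]
          gcongr
        _ = (2 ^ s * ∑ i, C₁ i) * t ^ (-(n + ν)) * (t⁻¹) ^ l * b ^ (j + 1) * w := by ring
        _ ≤ _ := by
          gcongr
          exact le_add_of_nonneg_left hS₀

/-- The telescoping series represents `u`. -/
lemma integral_tsum_dyadicTerm_mul (u : 𝓢'(Rn n, ℂ)) {φ χ : 𝓢(Rn n, ℂ)}
    (hφ : φ ∈ testFunctions n) (hφ1 : ∫ w, φ w = 1)
    (hχ : ∀ (r : ℝ) (hr : 0 < r) (y : Rn n), atom φ (half_pos hr) y - atom φ hr y = atom χ hr y)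
    {s N A t : ℝ} (hs : 0 < s) (hN : 0 ≤ N) (ht : 0 < t) (hA : 0 ≤ A) {x : Rn n}
    (h : IsDyadicFamily 0 s N A t x (dyadicTerm u φ χ ht)) (f : 𝓢(Rn n, ℂ)) :
    ∫ y, (∑' j, dyadicTerm u φ χ ht j y) * f y = u f := by
  have hs' : ((0 : ℕ) : ℝ) < s := by simpa using hs
  set a := (2 : ℝ) ^ (((0 : ℕ) : ℝ) - s) with ha
  have ha0 : 0 < a := by positivity
  have ha1 : a < 1 := two_rpow_lt_one (by linarith)
  have hF : ∀ j y, ‖dyadicTerm u φ χ ht j y‖ ≤ A * a ^ j := by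
    intro j y
    have h1 := h.bound_one hN ht hA le_rfl j y
    rwa [norm_iteratedFDeriv_zero, pow_zero, mul_one] at h1
  have hsum : Summable fun j : ℕ => A * a ^ j := IsDyadicFamily.summable_bound A hs'
  have hr0 : Tendsto (fun J : ℕ => t / 2 ^ J) atTop (𝓝 0) :=
    tendsto_const_nhds.div_atTop (tendsto_pow_atTop_atTop_of_one_lt one_lt_two)
  have h1 := tendsto_integral_apply_atom_mul u hφ hφ1 f
    (r := fun J : ℕ => t / 2 ^ J) (fun J => div_pos ht (pow_pos two_pos J)) hr0
  refine tendsto_nhds_unique ?_ h1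
  simp_rw [← sum_range_dyadicTerm u hχ ht]
  refine tendsto_integral_of_dominated_convergence (fun y => (∑' j, A * a ^ j) * ‖f y‖)
    (fun J => ?_) (f.integrable.norm.const_mul _) (fun J => Eventually.of_forall fun y => ?_)
    (Eventually.of_forall fun y => ?_)
  · exact ((continuous_finsetSum _ fun j _ => (h.contDiff j).continuous).mul
      f.continuous).aestronglyMeasurable
  · rw [norm_mul]
    refine mul_le_mul_of_nonneg_right ?_ (norm_nonneg _)
    refine (norm_sum_le_of_le _ fun j _ => hF j y).trans ?_
    exact hsum.sum_le_tsum _ fun j _ => by positivity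
  · refine Tendsto.mul_const _ ?_
    have h2 : Summable fun j => dyadicTerm u φ χ ht j y :=
      Summable.of_norm_bounded hsum fun j => hF j y
    exact h2.hasSum.tendsto_sum_nat.comp (tendsto_add_atTop_nat 1)

lemma norm_pderiv_sub_le (α : Fin n → ℕ) (f : Rn n → ℂ) (a b : Rn n) :
    ‖pderiv α f a - pderiv α f b‖
      ≤ ‖iteratedFDeriv ℝ (multiOrder α) f a - iteratedFDeriv ℝ (multiOrder α) f b‖ := by
  rw [← length_directions]
  refine ((iteratedFDeriv ℝ (directions α).length f a
    - iteratedFDeriv ℝ (directions α).length f b).le_opNorm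
      fun j => EuclideanSpace.single ((directions α).get j) (1 : ℝ)).trans ?_
  simp

lemma scale_eq_bumpDecay (ν N : ℝ) (k : ℤ) (l : ℕ) (z : Rn n) :
    ((2 : ℝ) ^ (-k)) ^ (-(n + ν)) * (((2 : ℝ) ^ (-k))⁻¹) ^ l * (1 + ‖z‖ / (2 : ℝ) ^ (-k)) ^ (-N)
      = (2 : ℝ) ^ ((ν + l) * k) * bumpDecay N k z := by
  have h1 : ((2 : ℝ) ^ (-k)) ^ (-(n + ν)) = (2 : ℝ) ^ ((n + ν) * k) := by
    rw [← Real.rpow_intCast, ← Real.rpow_mul zero_le_two]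
    congr 1
    push_cast
    ring
  have h2 : (((2 : ℝ) ^ (-k))⁻¹) ^ l = (2 : ℝ) ^ ((l : ℝ) * k) := by
    rw [zpow_neg, inv_inv, ← Real.rpow_intCast, ← Real.rpow_natCast, ← Real.rpow_mul zero_le_two,
      mul_comm]
  have h3 : ‖z‖ / (2 : ℝ) ^ (-k) = (2 : ℝ) ^ k * ‖z‖ := by
    rw [zpow_neg, div_inv_eq_mul, mul_comm]
  have h4 : (2 : ℝ) ^ (k * n : ℤ) = (2 : ℝ) ^ ((k : ℝ) * n) := by
    rw [← Real.rpow_intCast]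
    push_cast
    rfl
  rw [bumpDecay, h1, h2, h3, h4, ← Real.rpow_add two_pos, ← mul_assoc, ← Real.rpow_add two_pos]
  congr 2
  ring

end SmoothedKernel

theorem theorem3p1 {n : ℕ} (hn : 0 < n) (ν : ℝ) (M L : ℕ) (hνL : ν ≤ L) (hLM : (L : ℝ) ≤ M + ν)
    (γ : ℝ) (hγ0 : 0 < γ) (hγ1 : γ ≤ 1) (P₀ : ℕ)
    (T Tstar : momentSchwartz n P₀ →ₗ[ℂ] 𝓢'(Rn n, ℂ)) (hT : IsSIO ν M γ T Tstar)
    (hWBP : SatisfiesWBP ν T Tstar)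
    (hvan : ∀ α : Fin n → ℕ, multiOrder α ≤ L → VanishesOnMonom ν M Tstar α) :
    ∃ (P₁ : ℕ) (hP₁ : P₀ ≤ P₁), ∀ (P : ℕ) (hP : P₁ ≤ P), ∀ ψ ∈ momentTest n P,
      ∃ θ : ℤ → Rn n → Rn n → ℂ,
        (∀ (f : 𝓢(Rn n, ℂ)) (hf : f ∈ momentSchwartz n P) (k : ℤ) (x : Rn n),
          convDilate ψ k (T ⟨f, momentSchwartz_anti (hP₁.trans hP) hf⟩) x
            = ∫ y, θ k x y * f y) ∧
        (∀ (k : ℤ) (x : Rn n), ContDiff ℝ ⌊(L : ℝ) - ν⌋₊ (θ k x)) ∧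
        (∀ α : Fin n → ℕ, multiOrder α ≤ ⌊(L : ℝ) - ν⌋₊ →
          ∃ C : ℝ, ∀ (k : ℤ) (x y : Rn n),
            ‖pderiv α (θ k x) y‖
              ≤ C * (2 : ℝ) ^ ((ν + multiOrder α) * k) * bumpDecay (n + ν + M + γ) k (x - y)) ∧
        (∀ γ' : ℝ, 0 < γ' → γ' < γ → ∀ α : Fin n → ℕ, multiOrder α = ⌊(L : ℝ) - ν⌋₊ →
          ∃ C : ℝ, ∀ (k : ℤ) (x y h : Rn n), ‖h‖ < ((2 : ℝ) ^ (-k) + ‖x - y‖) / 2 →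
            ‖pderiv α (θ k x) (y + h) - pderiv α (θ k x) y‖
              ≤ C * (2 : ℝ) ^ ((ν + multiOrder α) * k) * ((2 : ℝ) ^ k * ‖h‖) ^ γ'
                * bumpDecay (n + ν + M + γ) k (x - y)) := by
  obtain ⟨mW, J, CW, hPmW, hCW, hW, hWstar⟩ := hWBP.exists_isWeaklyBounded hn
  obtain ⟨Q, hQ⟩ := exists_vanishesOnPolys hvan
  obtain ⟨-, K, hK, hKS⟩ := hT.exists_kernel hγ0
  have hN : 0 < n + ν + M + γ := by
    have : (0 : ℝ) ≤ L := Nat.cast_nonneg L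
    have : (0 : ℝ) ≤ n := Nat.cast_nonneg n
    linarith
  set m := ⌊(L : ℝ) - ν⌋₊ with hm
  have hmL : (m : ℝ) ≤ L - ν := Nat.floor_le (by linarith)
  refine ⟨max mW (max M Q), hPmW.trans (le_max_left _ _), fun P hP ψ hψ => ?_⟩
  have hmP : mW ≤ P := (le_max_left _ _).trans hP
  have hMP : M ≤ P := (le_max_left _ _).trans ((le_max_right _ _).trans hP)
  have hQP : Q ≤ P := (le_max_right _ _).trans ((le_max_right _ _).trans hP)
  have hP₀ : P₀ ≤ P := hPmW.trans hmP
  obtain ⟨φ, hφ, hφ1, hφm⟩ := exists_approximate_identity n P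
  obtain ⟨χ, hχ, hφχ⟩ := exists_dyadic_difference hφ hφm
  have ht : ∀ k : ℤ, (0 : ℝ) < 2 ^ (-k) := fun k => zpow_pos two_pos (-k)
  have hx : ∀ (k : ℤ) (x : Rn n), atom ψ (ht k) x ∈ momentSchwartz n P₀ := fun k x =>
    momentSchwartz_anti hP₀ (atom_mem_momentSchwartz _ _ hψ.1)
  have hfam : ∀ δ : ℝ, 0 < δ → δ < γ → ∃ A : ℝ, 0 ≤ A ∧ ∀ (k : ℤ) (x : Rn n),
      IsDyadicFamily (m + 1) (L - ν + δ) (n + ν + M + γ)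
        (A * ((2 : ℝ) ^ (-k)) ^ (-(n + ν))) (2 ^ (-k)) x
        (dyadicTerm (Tstar ⟨atom ψ (ht k) x, hx k x⟩) φ χ (ht k)) := by
    intro δ hδ0 hδγ
    obtain ⟨A, hA0, hA⟩ := exists_isDyadicFamily_dyadicTerm (ψ := ψ) (P := P) (s := L - ν + δ)
      (fun φ hφ => exists_norm_apply_atom_atom_le hγ0 hN hK hKS hCW hWstar hMP hmP hψ hφ)
      (fun φ hφ => exists_norm_transpose_apply_atom_atom_le hγ0 hγ1 hδ0 hδγ hLM hT hCW hW hQ hn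
        hP₀ hMP hmP hQP hφ hψ) hφ hχ (m + 1)
    exact ⟨A, hA0, fun k x => hA _ (ht k) x (hx k x)⟩
  obtain ⟨A, hA0, hA⟩ := hfam (γ / 2) (by linarith) (by linarith)
  have hA0' : ∀ k : ℤ, 0 ≤ A * ((2 : ℝ) ^ (-k)) ^ (-(n + ν)) := fun k => by positivity
  have hmono : ∀ m' ≤ m + 1, ∀ (k : ℤ) (x : Rn n),
      IsDyadicFamily m' (L - ν + γ / 2) (n + ν + M + γ)
        (A * ((2 : ℝ) ^ (-k)) ^ (-(n + ν))) (2 ^ (-k)) x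
        (dyadicTerm (Tstar ⟨atom ψ (ht k) x, hx k x⟩) φ χ (ht k)) := fun m' hm' k x =>
    ⟨(hA k x).contDiff, fun l hl => (hA k x).bound l (hl.trans hm')⟩
  have hms : (m : ℝ) < L - ν + γ / 2 := by linarith
  refine ⟨fun k x y => ∑' j, dyadicTerm (Tstar ⟨atom ψ (ht k) x, hx k x⟩) φ χ (ht k) j y,
    fun f hf k x => ?_, fun k x => ?_, fun α hα => ?_, fun γ' hγ'0 hγ'γ α hα => ?_⟩
  · rw [integral_tsum_dyadicTerm_mul _ hφ hφ1 hφχ (by linarith) hN.le (ht k) (hA0' k)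
      (hmono 0 (Nat.zero_le _) k x), convDilate, dilateReflect_eq_atom]
    exact hT.transpose ⟨f, _⟩ ⟨atom ψ (ht k) x, hx k x⟩
  · exact (hmono m (Nat.le_succ m) k x).contDiff_tsum hms hN.le (ht k) (hA0' k)
  · refine ⟨A * (1 - (2 : ℝ) ^ ((multiOrder α : ℝ) - (L - ν + γ / 2)))⁻¹, fun k x y => ?_⟩
    refine (norm_pderiv_le α _ y).trans (((hmono m (Nat.le_succ m) k x).norm_iteratedFDeriv_tsum_le
      hms hN.le (ht k) (hA0' k) hα y).trans (le_of_eq ?_))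
    rw [mul_assoc (A * _) (_ ^ _) (bumpDecay _ _ _), ← scale_eq_bumpDecay]
    ring
  · obtain ⟨A', hA'0, hA'⟩ := hfam ((γ' + γ) / 2) (by linarith) (by linarith)
    refine ⟨A' * (2 ^ (n + ν + M + γ) + 1) * (1 - (2 : ℝ) ^ (m + γ' - (L - ν + (γ' + γ) / 2)))⁻¹,
      fun k x y h hh => ?_⟩
    refine (norm_pderiv_sub_le α _ _ _).trans ?_
    rw [hα]
    refine ((hA' k x).norm_iteratedFDeriv_tsum_sub_le (by linarith) hN.le (ht k) (by positivity)
      hγ'0 (by linarith) (by linarith) hh.le).trans (le_of_eq ?_)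
    have e : ∀ a b c d : ℝ, a * b * c * d = a * c * (b * d) := fun a b c d => by ring
    rw [e _ _ _ (bumpDecay _ _ _), ← scale_eq_bumpDecay, zpow_neg, inv_inv]
    ring
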